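/- Let $n\ge 1$ be an integer. The stylic monoid $\mathsf{styl}_n$ of rank $n$ is the monoid with generators $1<2<\dots<n$ and defining relations $$acb=cab\ (a\le b<c),\qquad bac=bca\ (a<b\le c),\qquad a^2=a,$$ where $a,b,c$ range over the generators. A monoid identity $u\approx v$ is a pair of words over the variables $x_0,x_1,x_2,\dots$; its length is $l=|u|+|v|$. A monoid $M$ satisfies $u\approx v$ if $\psi(u)=\psi(v)$ for every monoid morphism $\psi$ from the free monoid on the variables to $M$. The problem $\textsc{Check-Id}(M)$ asks, given an identity $u\approx v$, whether $M$ satisfies it. For each $n\ge 1$, $\textsc{Check-Id}(\mathsf{styl}_n)$ is decidable in linearithmic time: there is a random access machine (depending only on $n$) which, given any identity of length $l$, decides whether $\mathsf{styl}_n$ satisfies it in $O(l\log l)$ steps, the constant depending only on $n$. (Unit-cost model with words of logarithmic length: the instructions are constants, copying, addition, truncated subtraction, indirect loads and stores, jumps and comparisons; each letter of the input occupies one memory cell; for a constant $c$ depending only on $n$, there are $(l+2)^c$ memory cells and all numbers are at most $(l+m+2)^c$, where $m$ is the largest index of a variable in the identity, or $0$ if no variable occurs.) Moreover, $\textsc{Check-Id}(\mathsf{styl}_n)$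 is in the complexity class $\mathsf{P}$: when identities are written as strings over a finite alphabet, with the indices of variables in binary, the language of all identities satisfied by $\mathsf{styl}_n$ is decided by a Turing machine in time polynomial in the length of its input string. -/

import Mathlib

/-! ### The stylic monoid -/

/-- The stylic relations on words over the ordered alphabet `Fin n`: the two families of Knuth
relations together with the idempotency of the generators. -/
inductive StylicRel (n : ℕ) : FreeMonoid (Fin n) → FreeMonoid (Fin n) → Prop
  | knuth_left (a b c : Fin n) (hab : a ≤ b) (hbc : b < c) :
      StylicRel n (.of a * .of c * .of b) (.of c * .of a * .of b)
  | knuth_right (a b c : Fin n) (hab : a < b) (hbc : b ≤ c) :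
      StylicRel n (.of b * .of a * .of c) (.of b * .of c * .of a)
  | idem (a : Fin n) : StylicRel n (.of a * .of a) (.of a)

/-- The stylic monoid of rank `n`. -/
abbrev StylicMonoid (n : ℕ) : Type := PresentedMonoid (StylicRel n)

/-! ### Monoid identities and the identity checking problem -/

/-- A monoid identity `u ≈ v` over the countable set of variables `x₀, x₁, x₂, …`; the variable
`xᵢ` is represented by its index `i`. -/
structure MonoidIdentity where
  lhs : FreeMonoid ℕ
  rhs : FreeMonoid ℕ

namespace MonoidIdentity

/-- The length of an identity: the sum of the lengths of its two sides. -/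
def length (e : MonoidIdentity) : ℕ := e.lhs.toList.length + e.rhs.toList.length

/-- The sequence of all letters of an identity, first those of the left-hand side. -/
def letters (e : MonoidIdentity) : List ℕ := e.lhs.toList ++ e.rhs.toList

/-- The largest index of a variable occurring in an identity (`0` if there is none). -/
def maxVar (e : MonoidIdentity) : ℕ := e.letters.foldr max 0

/-- `M` satisfies `u ≈ v` if every evaluation of the variables in `M` makes both sides equal. -/
def SatisfiedBy (e : MonoidIdentity) (M : Type*) [Monoid M] : Prop :=
  ∀ ψ : FreeMonoid ℕ →* M, ψ e.lhs = ψ e.rhs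

end MonoidIdentity

/-- The identity checking problem of `M`, as the set of its positive instances. -/
def CheckId (M : Type*) [Monoid M] : Set MonoidIdentity := {e | e.SatisfiedBy M}

/-! ### Random access machines with unit cost and bounded words

A machine has finitely many registers that its program mentions, and a memory; both hold natural
numbers. A run is relative to a memory size `S` (the memory consists of the cells with addresses
`0, …, S - 1`) and to a largest machine word `W`. A machine that addresses a cell outside the memory
or computes a number greater than `W` crashes and gives no answer. -/

namespace RAM

/-- The instructions. Numbers `d a b` denote registers, `k` is a program position. -/
inductive Instr where
  /-- put the constant `v` into register `d` -/
  | const (d v : ℕ)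
  /-- copy register `a` to register `d` -/
  | move (d a : ℕ)
  /-- put the sum of registers `a` and `b` into register `d` -/
  | add (d a b : ℕ)
  /-- put the truncated difference of registers `a` and `b` into register `d` -/
  | sub (d a b : ℕ)
  /-- put the memory cell whose address is in register `a` into register `d` -/
  | load (d a : ℕ)
  /-- put register `b` into the memory cell whose address is in register `a` -/
  | store (a b : ℕ)
  /-- continue at position `k` -/
  | jump (k : ℕ)
  /-- continue at position `k` if register `a` is less than register `b` -/
  | jumpLt (a b k : ℕ)
  /-- stop with the given answer -/
  | halt (answer : Bool)

/-- A program is a finite list of instructions, at positions `0, 1, 2, …`. -/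
abbrev Program := List Instr

/-- A configuration: the program counter, the registers and the memory. -/
structure Config where
  pc : ℕ
  reg : ℕ → ℕ
  mem : ℕ → ℕ

/-- Write `v` into register `d` and go to the next instruction. -/
def Config.put (c : Config) (d v : ℕ) : Config :=
  { c with pc := c.pc + 1, reg := Function.update c.reg d v }

/-- One step of a machine with memory size `S` and largest word `W`; the value is `none` if the
machine has stopped or crashes. -/
def step (P : Program) (S W : ℕ) (c : Config) : Option Config :=
  match P[c.pc]? with
  | none => none
  | some (.const d v) => if v ≤ W then some (c.put d v) else none
  | some (.move d a) => some (c.put d (c.reg a))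
  | some (.add d a b) =>
      if c.reg a + c.reg b ≤ W then some (c.put d (c.reg a + c.reg b)) else none
  | some (.sub d a b) => some (c.put d (c.reg a - c.reg b))
  | some (.load d a) => if c.reg a < S then some (c.put d (c.mem (c.reg a))) else none
  | some (.store a b) =>
      if c.reg a < S then
        some { c with pc := c.pc + 1, mem := Function.update c.mem (c.reg a) (c.reg b) }
      else none
  | some (.jump k) => some { c with pc := k }
  | some (.jumpLt a b k) => some { c with pc := if c.reg a < c.reg b then k else c.pc + 1 }
  | some (.halt _) => none

/-- Started in a configuration, the machine stops with the answer `b` after executing exactly `t`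
instructions (the final `halt` included). -/
inductive Answers (P : Program) (S W : ℕ) : Config → ℕ → Bool → Prop
  | halt {c : Config} {b : Bool} (h : P[c.pc]? = some (.halt b)) : Answers P S W c 1 b
  | step {c c' : Config} {t : ℕ} {b : Bool} (h : step P S W c = some c')
      (h' : Answers P S W c' t b) : Answers P S W c (t + 1) b

/-- The initial configuration on the input `u ≈ v`: the letters of `u` followed by those of `v`
occupy the memory cells `0, 1, …`, one letter in each, the registers `0` and `1` hold the lengths
of `u` and `v`, and everything else is `0`. -/
def init (e : MonoidIdentity) : Config where
  pc := 0
  reg i := if i = 0 then e.lhs.toList.length else if i = 1 then e.rhs.toList.length else 0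
  mem i := e.letters.getD i 0

/-- The decision problem `L` for identities is decidable in time `O(f(l))`, where `l` is the length
of the identity: one program answers every instance correctly, executing at most `T l = O(f(l))`
instructions. Addresses of memory cells and machine words have logarithmic length: the memory has
polynomially many cells in `l`, and machine words are bounded by a polynomial in `l` and the largest
index of a variable, so that a variable fits into one word. -/
def DecidableInTime (L : Set MonoidIdentity) (f : ℕ → ℝ) : Prop :=
  ∃ (P : Program) (c : ℕ) (T : ℕ → ℕ), 0 < c ∧
    (fun l : ℕ => (T l : ℝ)) =O[Filter.atTop] f ∧
    ∀ e : MonoidIdentity, ∃ t ≤ T e.length, ∃ b : Bool,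
      Answers P ((e.length + 2) ^ c) ((e.length + e.maxVar + 2) ^ c) (init e) t b ∧
      (b = true ↔ e ∈ L)

end RAM

/-! ### The complexity class P -/

open Classical in
/-- The complexity class `P` over an alphabet `Γ`: the languages whose membership problem is
decided by a (multi-stack) Turing machine in a number of steps bounded by a polynomial in the length
of the input string. -/
def ClassP (Γ : Type) : Set (Language Γ) :=
  {L | ∃ m : Turing.TM2ComputableInPolyTime (id : List Γ → List Γ) Computability.encodeBool
      (fun s => decide (s ∈ L)), ∀ k, Finite (m.tm.Γ k)}

/-- The symbols used to write down an identity: binary digits, a mark that ends the index of a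
variable, and the mark between the two sides. -/
inductive IdSymbol where
  | bit (b : Bool)
  | sep
  | approx

/-- A word is written as the sequence of the binary expansions of the indices of its letters (least
significant digit first, the empty expansion for `0`), each followed by `sep`. -/
def encodeWord (w : FreeMonoid ℕ) : List IdSymbol :=
  w.toList.flatMap fun i => i.bits.map IdSymbol.bit ++ [IdSymbol.sep]

/-- The string that represents the identity `u ≈ v`. -/
def encodeIdentity (e : MonoidIdentity) : List IdSymbol :=
  encodeWord e.lhs ++ IdSymbol.approx :: encodeWord e.rhs

/-! The stylic monoid of rank `n` satisfies `u ≈ v` exactly when `u` and `v` have the same scattered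
subwords of length at most `n`, that is, when they are congruent in the sense of Simon
(`mem_checkId_stylicMonoid_iff`). Both complexity statements then concern algorithms for this
congruence.

Necessity: let the generator `i` act on ℕ by moving only the point `i`, to `i + 1`. For a word `s`
of length at most `n`, send each variable to the increasing product of the generators indexed by its
positions in `s`. The image of `0` under a word then measures how much of `s` can be matched in that
word (`stylicMove_lift_apply`), so evaluations detect all subwords of length at most `n`.

Sufficiency uses only the relations `a² = a` and `aba = bab = ba` for `a < b`. Congruent words can
be made equal by inserting letters one at a time without leaving the congruence class
(`SimonEq.insert_of_ne`), so it is enough that such an insertion of `a` into `pq` does not change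
the product. A count of lengths (`SimonEq.insert`) reduces it to `p ~ pa` at level `#{letters > a} +
1` or `q ~ aq` at level `#{letters < a} + 1`, and one-sided insertions at these levels follow from
the relations by induction (`IsKiselev.prod_concat` and its dual). Congruence is preserved by
substitutions, which passes from words in the generators to identities.

Algorithm: let `F k i` be the last end of the leftmost embeddings into `v` of subwords of length at
most `k` of the prefix of length `i` of `u`. Next positions of a letter are monotone, so `F (k+1)
(i+1)` is the maximum of `F (k+1) i` and the next position after `F k i` of the letter that follows
the prefix. All short subwords of `u` embed into `v` iff `F n |u| ≤ |v|` (`simonEq_iff_front`). On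
the random access machine, a heap sort replaces variables by small class numbers in time `O(l log
l)`; then `n` rounds compute `F`, each in linear time because a table of next positions is only
moved forward. On the Turing machine, each letter of `v` carries the finite set of levels `k` whose
front has not yet been passed there, and each letter of `u` costs one pass over `v`.

Both algorithms are structured programs whose cost is the exact number of steps of their jump code
(`Cmd.Runs.steps`); budgets serve as termination measures, and the jump code is translated to either
machine model. -/

/-! ### Simon's congruence -/

section Simon

open scoped List

variable {α : Type*}

/-- Two words are `k`-equivalent if they have the same scattered subwords of length at most `k`. -/
def SimonEq (k : ℕ) (u v : List α) : Prop :=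
  ∀ s : List α, s.length ≤ k → (s <+ u ↔ s <+ v)

namespace SimonEq

theorem symm {k : ℕ} {u v : List α} (h : SimonEq k u v) : SimonEq k v u :=
  fun s hs => (h s hs).symm

theorem trans {k : ℕ} {u v w : List α} (h : SimonEq k u v) (h' : SimonEq k v w) :
    SimonEq k u w :=
  fun s hs => (h s hs).trans (h' s hs)

theorem of_sublist {k : ℕ} {u v : List α} (huv : u <+ v)
    (h : ∀ s : List α, s.length ≤ k → s <+ v → s <+ u) : SimonEq k u v :=
  fun s hs => ⟨fun hu => hu.trans huv, h s hs⟩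

theorem reverse {k : ℕ} {u v : List α} (h : SimonEq k u v) :
    SimonEq k u.reverse v.reverse := by
  intro s hs
  have := h s.reverse (by simpa using hs)
  rwa [← List.reverse_sublist, List.reverse_reverse, ← List.reverse_sublist (l₁ := s.reverse),
    List.reverse_reverse] at this

/-- An embedding of `s` into the image of `u` uses the images of at most `|s|` letter occurrences;
these occurrences form a subword of `u` that is short enough to be transferred to `v`. -/
theorem flatMap {β : Type*} {k : ℕ} {u v : List α} (h : SimonEq k u v) (σ : α → List β) :
    SimonEq k (u.flatMap σ) (v.flatMap σ) := by
  have key : ∀ (u : List α) (s : List β), s <+ u.flatMap σ →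
      ∃ s' : List α, s' <+ u ∧ s'.length ≤ s.length ∧ s <+ s'.flatMap σ := by
    intro u
    induction u with
    | nil => intro s hs; exact ⟨[], by simp, by simp, by simpa using hs⟩
    | cons a u ih =>
      intro s hs
      rw [List.flatMap_cons, List.sublist_append_iff] at hs
      obtain ⟨s₁, s₂, rfl, h₁, h₂⟩ := hs
      obtain ⟨t, ht, hl, hs⟩ := ih s₂ h₂
      cases s₁ with
      | nil => exact ⟨t, ht.cons a, by simpa using hl, by simpa using hs⟩
      | cons b s₁ =>
        refine ⟨a :: t, ht.cons_cons a, by simp; omega, ?_⟩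
        rw [List.flatMap_cons]
        exact h₁.append hs
  have mono : ∀ {s u : List α}, s <+ u → s.flatMap σ <+ u.flatMap σ := by
    intro s u hsu
    induction hsu with
    | slnil => exact List.Sublist.refl _
    | cons a _ ih => exact ih.trans (by simp)
    | cons_cons a _ ih => simpa using ih
  have main : ∀ {u v : List α}, SimonEq k u v → ∀ s : List β, s.length ≤ k →
      s <+ u.flatMap σ → s <+ v.flatMap σ := by
    intro u v h s hs hu
    obtain ⟨t, ht, hl, hst⟩ := key u s hu
    exact hst.trans (mono ((h t (hl.trans hs)).1 ht))
  exact fun s hs => ⟨main h s hs, main h.symm s hs⟩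

end SimonEq

theorem sublist_concat_cases {p s : List α} {a : α} (h : s <+ p ++ [a]) (h' : ¬ s <+ p) :
    ∃ t, s = t ++ [a] ∧ t <+ p := by
  rw [List.sublist_append_iff] at h
  obtain ⟨s₁, s₂, rfl, h₁, h₂⟩ := h
  rcases List.sublist_singleton.1 h₂ with rfl | rfl
  · exact absurd (by simpa using h₁) h'
  · exact ⟨s₁, rfl, h₁⟩

theorem sublist_cons_cases {p s : List α} {a : α} (h : s <+ a :: p) (h' : ¬ s <+ p) :
    ∃ t, s = a :: t ∧ t <+ p := by
  rcases List.sublist_cons_iff.1 h with h | ⟨t, rfl, ht⟩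
  · exact absurd h h'
  · exact ⟨t, rfl, ht⟩

/-- The marked letter `a` lands on one side of the boundary, and takes along everything before it or
everything after it. -/
theorem append_cons_sublist_append {s t p q : List α} {a : α} (h : s ++ a :: t <+ p ++ q) :
    s ++ [a] <+ p ∨ a :: t <+ q := by
  rw [List.sublist_append_iff] at h
  obtain ⟨l₁, l₂, h, h₁, h₂⟩ := h
  rcases List.append_eq_append_iff.1 h with ⟨c, rfl, hc⟩ | ⟨c, rfl, rfl⟩
  · cases c with
    | nil => exact Or.inr (by simp at hc; rwa [hc])
    | cons x c =>
      obtain ⟨rfl, rfl⟩ := by simpa using hc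
      refine Or.inl (List.Sublist.trans ?_ h₁)
      simp
  · exact Or.inr ((List.sublist_append_right c _).trans h₂)

/-- If both alternatives fail, there are witnesses `s a` not in `p` and `a t` not in `q`. They share
the letter `a`, so the glued word `s a t` has length at most `i + j - 1 ≤ k`. It embeds into `p a
q`, hence into `p q`, and the place of its `a` contradicts one of the witnesses. -/
theorem SimonEq.insert {k i j : ℕ} {p q : List α} {a : α} (hk : i + j ≤ k + 1)
    (h : SimonEq k (p ++ q) (p ++ a :: q)) :
    SimonEq i p (p ++ [a]) ∨ SimonEq j q (a :: q) := by
  by_contra! hcon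
  obtain ⟨h₁, h₂⟩ := hcon
  have e₁ : ∃ s : List α, s.length ≤ i ∧ s <+ p ++ [a] ∧ ¬ s <+ p := by
    by_contra! hc
    exact h₁ (.of_sublist (by simp) fun s hs hs' => hc s hs hs')
  have e₂ : ∃ s : List α, s.length ≤ j ∧ s <+ a :: q ∧ ¬ s <+ q := by
    by_contra! hc
    exact h₂ (.of_sublist (by simp) fun s hs hs' => hc s hs hs')
  obtain ⟨s, hs, hs₁, hs₂⟩ := e₁
  obtain ⟨t, ht, ht₁, ht₂⟩ := e₂
  obtain ⟨s, rfl, hs'⟩ := sublist_concat_cases hs₁ hs₂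
  obtain ⟨t, rfl, ht'⟩ := sublist_cons_cases ht₁ ht₂
  have := (h (s ++ a :: t) (by simp at hs ht ⊢; omega)).2 (hs'.append (ht'.cons_cons a))
  rcases append_cons_sublist_append this with h | h
  · exact hs₂ h
  · exact ht₂ h

/-- The basic step of Simon's theorem: of two equivalent words that first differ in the letters `a`
and `b`, one admits the insertion of the letter of the other. -/
theorem SimonEq.insert_of_ne {k : ℕ} {r u v : List α} {a b : α}
    (h : SimonEq k (r ++ a :: u) (r ++ b :: v)) (hab : a ≠ b) :
    SimonEq k (r ++ a :: u) (r ++ b :: a :: u) ∨ SimonEq k (r ++ b :: v) (r ++ a :: b :: v) := by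
  have e₁ : ∀ (a b : α) (w : List α), ¬ SimonEq k (r ++ a :: w) (r ++ b :: a :: w) →
      ∃ s t : List α, (s ++ b :: t).length ≤ k ∧ s <+ r ∧ t <+ a :: w ∧
        ¬ (s ++ b :: t) <+ r ++ a :: w := by
    intro a b w hw
    have : ∃ s : List α, s.length ≤ k ∧ s <+ r ++ b :: a :: w ∧ ¬ s <+ r ++ a :: w := by
      by_contra! hc
      exact hw (.of_sublist (by simp) fun s hs hs' => hc s hs hs')
    obtain ⟨s, hs, hs₁, hs₂⟩ := this
    rw [List.sublist_append_iff] at hs₁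
    obtain ⟨s₁, s₂, rfl, h₁, h₂⟩ := hs₁
    by_cases h₃ : s₂ <+ a :: w
    · exact absurd (h₁.append h₃) hs₂
    · obtain ⟨t, rfl, ht⟩ := sublist_cons_cases h₂ h₃
      exact ⟨s₁, t, hs, h₁, ht, hs₂⟩
  -- Transfer `x a t` (or, if `t` itself starts with the displayed `a`, just `x t`). As `x a` does
  -- not fit into `r`, the rest goes into `b v`, and even into `v` because `a ≠ b`. So `t` embeds
  -- into `v` and `s b t` into `r b v`, which contradicts the choice of `s b t`.
  have key : ∀ (a b : α) (u v s t x : List α), SimonEq k (r ++ a :: u) (r ++ b :: v) → a ≠ b →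
      (s ++ b :: t).length ≤ k → s <+ r → t <+ a :: u → ¬ (s ++ b :: t) <+ r ++ a :: u →
      x <+ r → ¬ x ++ [a] <+ r → (x ++ a :: t).length ≤ k → False := by
    intro a b u v s t x h hne hl hs ht hn hx hxr hxl
    have aux : ∀ t', x ++ a :: t' <+ r ++ a :: u → (x ++ a :: t').length ≤ k → a :: t' <+ v := by
      intro t' h₁ h₂
      rcases append_cons_sublist_append ((h _ h₂).1 h₁) with h₃ | h₃
      · exact absurd h₃ hxr
      · rcases List.sublist_cons_iff.1 h₃ with h₃ | ⟨t, h₄, -⟩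
        · exact h₃
        · exact absurd (List.cons.inj h₄).1 hne
    have htv : t <+ v := by
      rcases List.sublist_cons_iff.1 ht with ht' | ⟨t', rfl, ht'⟩
      · exact (List.sublist_cons_self a t).trans (aux t (hx.append (ht'.cons_cons a)) hxl)
      · exact aux t' (hx.append (ht'.cons_cons a)) (by simp at hxl ⊢; omega)
    exact hn ((h _ hl).2 (hs.append (htv.cons_cons b)))
  by_contra! hcon
  obtain ⟨s, t, h₁, h₂, h₃, h₄⟩ := e₁ _ _ _ hcon.1
  obtain ⟨s', t', h₁', h₂', h₃', h₄'⟩ := e₁ _ _ _ hcon.2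
  have hb : ¬ s ++ [b] <+ r := fun hc => h₄ (by simpa using hc.append h₃)
  have ha : ¬ s' ++ [a] <+ r := fun hc => h₄' (by simpa using hc.append h₃')
  simp only [List.length_append, List.length_cons] at h₁ h₁'
  -- The crossed words `s' a t` and `s b t'` have the same total length as `s b t` and `s' a t'`, at
  -- most `2 k`, so one of them has length at most `k`.
  by_cases hl : (s' ++ a :: t).length ≤ k
  · exact key a b u v s t s' h hab (by simpa using h₁) h₂ h₃ h₄ h₂' ha hl
  · refine key b a v u s' t' s h.symm (Ne.symm hab) (by simpa using h₁') h₂' h₃' h₄' h₂ hb ?_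
    simp at hl ⊢
    omega

end Simon

/-! ### Monoids with the relations of Kiselev -/

section Kiselev

open scoped List

/-- Append `a` to a subword `s` of `p a q c`. By the hypothesis `s a` embeds into the word without
the extra `a`, and its final letter lies no later than the last `a`; so `s` already embeds into `p`.
The additional letter is what costs one level. -/
theorem SimonEq.of_last_occurrence {α : Type*} {r : ℕ} {a c : α} {p q q' : List α} (ha : a ∉ q ++ c :: q')
    (h : SimonEq (r + 1) (p ++ a :: (q ++ c :: q')) (p ++ a :: (q ++ c :: q') ++ [a])) :
    SimonEq r (p ++ a :: q) (p ++ a :: q ++ [c]) := by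
  refine .of_sublist (by simp) fun s hs hs' => ?_
  have h₁ : s ++ [a] <+ p ++ a :: (q ++ c :: q') ++ [a] :=
    List.Sublist.append (hs'.trans (by simp)) (List.Sublist.refl _)
  have h₂ := (h _ (by simpa using hs)).2 h₁
  rcases append_cons_sublist_append (t := [])
    (show s ++ [a] <+ (p ++ [a]) ++ (q ++ c :: q') by simpa using h₂) with h₃ | h₃
  · have : s <+ p := by simpa using h₃
    exact this.trans (by simp)
  · exact absurd (h₃.mem (by simp)) ha

theorem List.exists_last_occurrence {α : Type*} {a : α} {p : List α} (h : a ∈ p) :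
    ∃ q q', p = q ++ a :: q' ∧ a ∉ q' := by
  obtain ⟨s, t, hst, ha⟩ := List.eq_append_cons_of_mem (List.mem_reverse.2 h)
  refine ⟨t.reverse, s.reverse, ?_, by simpa using ha⟩
  rw [← List.reverse_reverse p, hst]
  simp

/-- The relations `a² = a` and `aba = bab = ba` for `a < b`. -/
structure IsKiselev {α M : Type*} [LinearOrder α] [Monoid M] (f : α → M) : Prop where
  idem : ∀ a, f a * f a = f a
  left : ∀ a b, a < b → f a * f b * f a = f b * f a
  right : ∀ a b, a < b → f b * f a * f b = f b * f a

namespace IsKiselev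

variable {α M : Type*} [LinearOrder α] [Monoid M] {f : α → M}

/-- Reversing both the order and the multiplication exchanges the two relations for `a < b`, so that
insertions at the left end reduce to those at the right end. -/
theorem dual (hf : IsKiselev f) :
    IsKiselev (fun a : αᵒᵈ => MulOpposite.op (f (OrderDual.ofDual a))) where
  idem a := by simp only [← MulOpposite.op_mul, hf.idem]
  left a b h := by
    simp only [← MulOpposite.op_mul, ← mul_assoc]
    rw [hf.right _ _ (OrderDual.ofDual_lt_ofDual.2 h)]
  right a b h := by
    simp only [← MulOpposite.op_mul, ← mul_assoc]
    rw [hf.left _ _ (OrderDual.ofDual_lt_ofDual.2 h)]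

/-- For `c < a` the relation `a c = a c a` carries a copy of `a` across `c`; repeated, it carries
`a` across all of `z`. -/
theorem prod_absorb (hf : IsKiselev f) (a : α) (z : List α) (hz : ∀ c ∈ z, c < a) :
    f a * (z.map f).prod * f a = f a * (z.map f).prod := by
  induction z with
  | nil => simpa using hf.idem a
  | cons c z ih =>
    have hc := hf.right c a (hz c (by simp))
    have ih := ih fun c hc => hz c (by simp [hc])
    calc f a * ((c :: z).map f).prod * f a = f a * f c * (z.map f).prod * f a := by
          simp [mul_assoc]
      _ = f a * f c * (f a * (z.map f).prod * f a) := by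
          nth_rewrite 1 [← hc]; simp only [mul_assoc]
      _ = f a * f c * f a * (z.map f).prod := by rw [ih]; simp only [mul_assoc]
      _ = f a * ((c :: z).map f).prod := by rw [hc]; simp [mul_assoc]

variable [Fintype α]

/-- After the last `a` of `p`, each letter `c > a` can be removed by induction: the prefix before
`c` is congruent to its extension by `c` one level lower, and fewer letters exceed `c` than `a`.
Only letters below `a` remain behind the last `a`, and these absorb the new one. -/
theorem prod_concat (hf : IsKiselev f) (r : ℕ) (a : α) (p : List α)
    (h : SimonEq r p (p ++ [a])) (hr : (Finset.univ.filter (a < ·)).card + 1 ≤ r) :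
    ((p ++ [a]).map f).prod = (p.map f).prod := by
  induction r generalizing a p with
  | zero => omega
  | succ r ih =>
    have hap : a ∈ p := by simpa using (h [a] (by simp)).2 (by simp)
    obtain ⟨p, q, rfl, haq⟩ := List.exists_last_occurrence hap
    -- `q₀` is the part that is still to be cleared of large letters, processed from its right end;
    -- `z` collects the small letters met so far.
    have key : ∀ q₀ q₁ z : List α, q = q₀ ++ q₁ → (∀ c ∈ z, c < a) →
        ((p ++ a :: q₀ ++ z ++ [a]).map f).prod = ((p ++ a :: q₀ ++ z).map f).prod := by
      intro q₀
      induction q₀ using List.reverseRecOn with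
      | nil =>
        intro q₁ z _ hz
        have := hf.prod_absorb a z hz
        simp only [List.map_append, List.prod_append, List.map_cons, List.prod_cons, List.map_nil,
          List.prod_nil, mul_one, mul_assoc] at this ⊢
        rw [this]
      | append_singleton q₀ c ihq =>
        intro q₁ z hq hz
        have hq' : q = q₀ ++ c :: q₁ := by simpa using hq
        rcases lt_trichotomy c a with hc | hc | hc
        · have := ihq (c :: q₁) (c :: z) hq' (by simpa [hc] using hz)
          simpa [mul_assoc] using this
        · exact absurd (by simp [hq', hc]) haq
        · have hs : SimonEq r (p ++ a :: q₀) (p ++ a :: q₀ ++ [c]) := by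
            subst hq'
            exact SimonEq.of_last_occurrence haq h
          have hcard : (Finset.univ.filter (c < ·)).card + 1 ≤ r := by
            have : (Finset.univ.filter (c < ·)).card < (Finset.univ.filter (a < ·)).card :=
              Finset.card_lt_card (Finset.ssubset_iff_of_subset (fun x hx => by
                simp only [Finset.mem_filter_univ] at hx ⊢
                exact hc.trans hx) |>.2 ⟨c, by simpa using hc, by simp⟩)
            omega
          have hdel := ih c _ hs hcard
          have := ihq (c :: q₁) z hq' hz
          have e : p ++ a :: (q₀ ++ [c]) = p ++ a :: q₀ ++ [c] := by simp
          rw [e]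
          rw [List.append_assoc (p ++ a :: q₀ ++ [c]) z, List.map_append,
            List.prod_append (l₂ := List.map f (z ++ [a])), hdel,
            List.map_append (l₁ := p ++ a :: q₀ ++ [c]),
            List.prod_append (l₂ := List.map f z), hdel]
          simpa [mul_assoc] using this
    simpa using key q [] [] (by simp) (by simp)

theorem prod_cons (hf : IsKiselev f) (r : ℕ) (a : α) (p : List α)
    (h : SimonEq r p (a :: p)) (hr : (Finset.univ.filter (· < a)).card + 1 ≤ r) :
    ((a :: p).map f).prod = (p.map f).prod := by
  classical
  have := hf.dual.prod_concat r (OrderDual.toDual a) (p.reverse.map OrderDual.toDual)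
    (by
      have := h.reverse.flatMap (fun x => [OrderDual.toDual x])
      simpa [← List.map_eq_flatMap] using this)
    (by
      have : (Finset.univ.filter (OrderDual.toDual a < ·)).card =
          (Finset.univ.filter (· < a)).card :=
        Finset.card_nbij' OrderDual.ofDual OrderDual.toDual
          (fun x hx => by simpa using OrderDual.toDual_lt.1 (by simpa using hx))
          (fun x hx => by simpa using hx) (fun _ _ => rfl) (fun _ _ => rfl)
      omega)
  apply MulOpposite.op_injective
  have e : ∀ w : List α, MulOpposite.op (w.map f).prod =
      ((w.reverse.map OrderDual.toDual).map
        fun a : αᵒᵈ => MulOpposite.op (f (OrderDual.ofDual a))).prod := by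
    intro w
    rw [MulOpposite.op_list_prod]
    simp [Function.comp_def]
  rw [e, e, ← this]
  simp

/-- The levels needed on the two sides, `#{> a} + 1` and `#{< a} + 1`, add up to `Fintype.card α +
1`, which is exactly what `SimonEq.insert` can distribute. -/
theorem prod_insert (hf : IsKiselev f) {p q : List α} {a : α}
    (h : SimonEq (Fintype.card α) (p ++ q) (p ++ a :: q)) :
    ((p ++ q).map f).prod = ((p ++ a :: q).map f).prod := by
  classical
  have hcard : (Finset.univ.filter (a < ·)).card + (Finset.univ.filter (· < a)).card + 1 =
      Fintype.card α := by
    have h₁ : insert a (Finset.univ.filter (a < ·) ∪ Finset.univ.filter (· < a)) =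
        (Finset.univ : Finset α) := by
      ext x
      rcases lt_trichotomy x a with h | h | h <;> simp [h]
    rw [← Finset.card_univ, ← congrArg Finset.card h₁, Finset.card_insert_of_notMem (by simp),
      Finset.card_union_of_disjoint]
    rw [Finset.disjoint_left]
    intro x hx hx'
    simp only [Finset.mem_filter_univ] at hx hx'
    exact lt_asymm hx hx'
  rcases h.insert (i := (Finset.univ.filter (a < ·)).card + 1) (j := (Finset.univ.filter (· < a)).card + 1) (by omega)
    with h | h
  · have := hf.prod_concat _ a p h le_rfl
    rw [List.map_append, List.prod_append, ← this]
    simp [mul_assoc]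
  · have := hf.prod_cons _ a q h le_rfl
    rw [List.map_append, List.prod_append, ← this]
    simp

/-- Behind the common prefix `r`, inserting the first letter of one remainder in front of the other
keeps the class and the product, lengthens the common prefix, and leaves remainders of smaller total
length. -/
theorem prod_eq_of_simonEq (hf : IsKiselev f) {u v : List α}
    (h : SimonEq (Fintype.card α) u v) : (u.map f).prod = (v.map f).prod := by
  have key : ∀ (N : ℕ) (r u v : List α), u.length + v.length ≤ N →
      SimonEq (Fintype.card α) (r ++ u) (r ++ v) →
      ((r ++ u).map f).prod = ((r ++ v).map f).prod := by
    have prefix_case : ∀ r v : List α, SimonEq (Fintype.card α) r (r ++ v) →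
        (r.map f).prod = ((r ++ v).map f).prod := by
      intro r v
      induction v using List.reverseRecOn with
      | nil => simp
      | append_singleton v b ih =>
        intro h
        have h₁ : SimonEq (Fintype.card α) r (r ++ v) :=
          .of_sublist (by simp) fun s hs hs' => (h s hs).2 (hs'.trans (by simp))
        rw [ih h₁]
        have := hf.prod_insert (p := r ++ v) (q := []) (a := b)
          (by simpa using h₁.symm.trans h)
        simpa using this
    intro N
    induction N with
    | zero =>
      intro r u v hN _
      obtain rfl := List.length_eq_zero_iff.1 (show u.length = 0 by omega)
      obtain rfl := List.length_eq_zero_iff.1 (show v.length = 0 by omega)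
      rfl
    | succ N ih =>
      intro r u v hN h
      match u, v with
      | [], v => simpa using prefix_case r v (by simpa using h)
      | a :: u, [] => simpa using (prefix_case r (a :: u) (by simpa using h.symm)).symm
      | a :: u, b :: v =>
        simp only [List.length_cons] at hN
        by_cases hab : a = b
        · subst hab
          simpa using ih (r ++ [a]) u v (by omega) (by simpa using h)
        · rcases h.insert_of_ne hab with h' | h'
          · have e := ih (r ++ [b]) (a :: u) v (by simp; omega) (by simpa using h'.symm.trans h)
            have := hf.prod_insert h'
            rw [this]
            simpa using e
          · have e := ih (r ++ [a]) u (b :: v) (by simp; omega) (by simpa using h.trans h')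
            have := hf.prod_insert h'
            rw [this]
            simpa using e
  simpa using key _ [] u v le_rfl (by simpa using h)

end IsKiselev

end Kiselev

/-! ### The identities of the stylic monoid -/

section Stylic

open scoped List

/-- These are the Knuth relations in which two of the three letters coincide, simplified by
idempotency. -/
theorem stylic_isKiselev (n : ℕ) : IsKiselev (PresentedMonoid.of (StylicRel n)) := by
  have e : ∀ a b : Fin n, a < b → PresentedMonoid.of (StylicRel n) a * .of _ b * .of _ a =
      .of _ b * .of _ a := by
    intro a b hab
    have h₁ : PresentedMonoid.of (StylicRel n) a * .of _ b * .of _ a =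
        .of _ b * .of _ a * .of _ a :=
      PresentedMonoid.mk_eq_mk_of_rel (.knuth_left a a b le_rfl hab)
    have h₂ : PresentedMonoid.of (StylicRel n) a * .of _ a = .of _ a :=
      PresentedMonoid.mk_eq_mk_of_rel (.idem a)
    rw [h₁, mul_assoc, h₂]
  refine ⟨fun a => PresentedMonoid.mk_eq_mk_of_rel (.idem a), e, fun a b hab => ?_⟩
  have h₁ : PresentedMonoid.of (StylicRel n) b * .of _ a * .of _ b =
      .of _ b * .of _ b * .of _ a :=
    PresentedMonoid.mk_eq_mk_of_rel (.knuth_right a b b hab le_rfl)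
  have h₂ : PresentedMonoid.of (StylicRel n) b * .of _ b = .of _ b :=
    PresentedMonoid.mk_eq_mk_of_rel (.idem b)
  rw [h₁, h₂]

/-- The map that moves the point `i` to `i + 1` and fixes all other points. -/
def stylicShift (i j : ℕ) : ℕ := if j = i then i + 1 else j

/-- The action of the stylic monoid by order-preserving and extensive maps. -/
def stylicAction (n : ℕ) : StylicMonoid n →* Function.End ℕ :=
  PresentedMonoid.lift (M := Function.End ℕ) (rels := StylicRel n) (fun i : Fin n => (stylicShift i : Function.End ℕ)) (by
    intro u v h
    rcases h with ⟨a, b, c, hab, hbc⟩ | ⟨a, b, c, hab, hbc⟩ | a <;> funext j <;>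
      simp only [map_mul]
    · change stylicShift a (stylicShift c (stylicShift b j)) =
        stylicShift c (stylicShift a (stylicShift b j))
      rw [Fin.le_def] at hab
      rw [Fin.lt_def] at hbc
      simp only [stylicShift]
      split_ifs <;> omega
    · change stylicShift b (stylicShift a (stylicShift c j)) =
        stylicShift b (stylicShift c (stylicShift a j))
      rw [Fin.lt_def] at hab
      rw [Fin.le_def] at hbc
      simp only [stylicShift]
      split_ifs <;> omega
    · change stylicShift a (stylicShift a j) = stylicShift a j
      simp only [stylicShift]
      split_ifs <;> omega)

/-- The image of a point under an element of the stylic monoid. -/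
def stylicMove (n : ℕ) (x : StylicMonoid n) (j : ℕ) : ℕ := stylicAction n x j

theorem stylicMove_one (n j : ℕ) : stylicMove n 1 j = j := by
  rw [stylicMove, map_one]; rfl

theorem stylicMove_mul (n : ℕ) (x y : StylicMonoid n) (j : ℕ) :
    stylicMove n (x * y) j = stylicMove n x (stylicMove n y j) := by
  rw [stylicMove, map_mul]; rfl

theorem stylicMove_of (n : ℕ) (i : Fin n) (j : ℕ) :
    stylicMove n (.of _ i) j = if j = (i : ℕ) then (i : ℕ) + 1 else j := rfl

/-- The product, in increasing order, of the generators whose index is the position of the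
letter `x` in the word `s`. -/
def stylicSubst (n : ℕ) (s : List ℕ) (x : ℕ) : StylicMonoid n :=
  (((List.finRange n).filter fun i : Fin n => s[(i : ℕ)]? = some x).map (PresentedMonoid.of (StylicRel n))).prod

/-- The last factor acts first. In an increasing product a point moved from `j` to `j + 1` meets
only generators below `j` afterwards, so it moves at most once. -/
theorem stylicMove_prod_apply {n : ℕ} (l : List (Fin n)) (hl : l.Pairwise (· < ·)) (j : ℕ) :
    stylicMove n (l.map (PresentedMonoid.of (StylicRel n))).prod j =
      if ∃ i ∈ l, (i : ℕ) = j then j + 1 else j := by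
  induction l with
  | nil => simp [stylicMove_one]
  | cons a l ih =>
    rw [List.pairwise_cons] at hl
    rw [List.map_cons, List.prod_cons, stylicMove_mul, ih hl.2,
      stylicMove_of]
    by_cases h : ∃ i ∈ l, (i : ℕ) = j
    · obtain ⟨i, hi, rfl⟩ := h
      have hai := hl.1 i hi
      rw [Fin.lt_def] at hai
      rw [if_pos (⟨i, hi, rfl⟩ : ∃ i' ∈ l, (i' : ℕ) = i),
        if_pos (⟨i, by simp [hi], rfl⟩ : ∃ i' ∈ a :: l, (i' : ℕ) = i), if_neg (by omega)]
    · rw [if_neg h]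
      by_cases haj : (a : ℕ) = j
      · rw [if_pos haj.symm, if_pos ⟨a, by simp, haj⟩, haj]
      · rw [if_neg (Ne.symm haj), if_neg]
        rintro ⟨i, hi, hij⟩
        rcases List.mem_cons.1 hi with rfl | hi
        · exact haj hij
        · exact h ⟨i, hi, hij⟩

theorem stylicMove_stylicSubst {n : ℕ} {s : List ℕ} (hs : s.length ≤ n) (x j : ℕ) :
    stylicMove n (stylicSubst n s x) j = if s[j]? = some x then j + 1 else j := by
  rw [stylicSubst, stylicMove_prod_apply _ ((List.pairwise_lt_finRange n).filter _)]
  congr 1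
  simp only [List.mem_filter, List.mem_finRange, true_and, decide_eq_true_eq, eq_iff_iff]
  constructor
  · rintro ⟨i, hi, rfl⟩
    exact hi
  · intro h
    have : j < s.length := by
      by_contra hc
      simp [List.getElem?_eq_none (not_lt.1 hc)] at h
    exact ⟨⟨j, by omega⟩, h, rfl⟩

/-- The last letter of `w` acts first, and a letter moves the point `j` exactly if it equals `s[j]`.
The point therefore matches `s` greedily against `w` read backwards, which explains the reversal. -/
theorem stylicMove_lift_apply {n : ℕ} {s : List ℕ} (hs : s.length ≤ n) (w : FreeMonoid ℕ) :
    stylicMove n (FreeMonoid.lift (stylicSubst n s) w) 0 ≤ s.length ∧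
    ∀ j ≤ s.length, (j ≤ stylicMove n (FreeMonoid.lift (stylicSubst n s) w) 0 ↔
      (s.take j).reverse <+ w.toList) := by
  induction w using FreeMonoid.inductionOn' with
  | one =>
    simp only [map_one, stylicMove_one, FreeMonoid.toList_one, List.sublist_nil,
      List.reverse_eq_nil_iff, List.take_eq_nil_iff]
    refine ⟨Nat.zero_le _, fun j hj => ⟨fun h => .inl (by omega), ?_⟩⟩
    rintro (h | rfl)
    · omega
    · simpa using hj
  | of_mul x w ih =>
    rw [map_mul, stylicMove_mul, FreeMonoid.lift_eval_of,
      stylicMove_stylicSubst hs, FreeMonoid.toList_mul, FreeMonoid.toList_of]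
    set m := stylicMove n (FreeMonoid.lift (stylicSubst n s) w) 0
    obtain ⟨hm, ih⟩ := ih
    constructor
    · split_ifs with h
      · by_contra hc
        simp [List.getElem?_eq_none (show s.length ≤ m by omega)] at h
      · exact hm
    · intro j hj
      cases j with
      | zero => simp
      | succ j =>
        have hj' : j < s.length := hj
        have e : (s.take (j + 1)).reverse = s[j] :: (s.take j).reverse := by
          rw [List.take_succ_eq_append_getElem hj', List.reverse_append]; rfl
        have h₁ : (s.take (j + 1)).reverse <+ [x] ++ w.toList ↔
            (j + 1 ≤ m ∨ s[j] = x ∧ j ≤ m) := by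
          rw [ih _ hj, ih _ hj'.le, e]
          simp only [List.singleton_append, List.sublist_cons_iff, List.cons.injEq]
          constructor
          · rintro (h | ⟨t, ⟨h₁, rfl⟩, h⟩)
            · exact .inl h
            · exact .inr ⟨h₁, h⟩
          · rintro (h | ⟨h₁, h⟩)
            · exact .inl h
            · exact .inr ⟨_, ⟨h₁, rfl⟩, h⟩
        rw [h₁]
        split_ifs with h
        · constructor
          · intro h'
            rcases Nat.lt_or_ge j m with h'' | h''
            · exact .inl h''
            · obtain rfl : j = m := by omega
              rw [List.getElem?_eq_getElem hj'] at h
              exact .inr ⟨by simpa using h, le_rfl⟩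
          · rintro (h | h) <;> omega
        · constructor
          · exact .inl
          · rintro (h' | ⟨h', h''⟩)
            · exact h'
            · rcases Nat.lt_or_ge j m with h₂ | h₂
              · exact h₂
              · obtain rfl : j = m := by omega
                rw [List.getElem?_eq_getElem hj', h'] at h
                exact absurd rfl h

/-- Subwords `s` are detected by the evaluation built from `s.reverse`. Conversely, the values of an
evaluation are represented by words in the generators, so that both sides become images of congruent
words under a substitution into an alphabet of `n` letters. -/
theorem mem_checkId_stylicMonoid_iff (n : ℕ) (e : MonoidIdentity) :
    e ∈ CheckId (StylicMonoid n) ↔ SimonEq n e.lhs.toList e.rhs.toList := by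
  constructor
  · intro h s hs
    have hs' : s.reverse.length ≤ n := by simpa using hs
    have h' := congrArg (stylicMove n · 0) (h (FreeMonoid.lift (stylicSubst n s.reverse)))
    have key := fun w => (stylicMove_lift_apply hs' w).2 s.reverse.length le_rfl
    simp only [List.take_length, List.reverse_reverse] at key
    rw [← key, ← key]
    rw [h']
  · intro h ψ
    have hsurj := PresentedMonoid.surjective_mk (rels := StylicRel n)
    choose σ hσ using fun x => hsurj (ψ (.of x))
    have hψ : ∀ w : FreeMonoid ℕ, ψ w =
        ((w.toList.flatMap fun x => (σ x).toList).map (PresentedMonoid.of (StylicRel n))).prod := by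
      intro w
      induction w using FreeMonoid.inductionOn' with
      | one => simp
      | of_mul x w ih =>
        rw [map_mul, ih, FreeMonoid.toList_mul, FreeMonoid.toList_of, List.singleton_append,
          List.flatMap_cons, List.map_append, List.prod_append, ← hσ]
        congr 1
        rw [← FreeMonoid.lift_apply]
        exact DFunLike.congr_fun (FreeMonoid.hom_eq (f := PresentedMonoid.mk (StylicRel n))
          fun _ => by simp [PresentedMonoid.of]) (σ x)
    rw [hψ, hψ]
    exact (stylic_isKiselev n).prod_eq_of_simonEq (by simpa using h.flatMap _)

end Stylic

/-! ### Greedy embeddings of all short subwords -/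

section Greedy

open scoped List

/-- The least position `> j` of the letter `a` in the word `v`, where positions are counted from
`1`; it is `|v| + 1` if there is none. -/
def nextPos (v : List ℕ) (a j : ℕ) : ℕ := min (j + (v.drop j).idxOf a + 1) (v.length + 1)

theorem nextPos_of_le {v : List ℕ} {j : ℕ} (a : ℕ) (h : v.length ≤ j) :
    nextPos v a j = v.length + 1 := by
  simp [nextPos, List.drop_eq_nil_of_le h]
  omega

theorem nextPos_of_lt {v : List ℕ} {j : ℕ} (a : ℕ) (h : j < v.length) :
    nextPos v a j = if v[j] = a then j + 1 else nextPos v a (j + 1) := by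
  rw [nextPos, List.drop_eq_getElem_cons h, List.idxOf_cons]
  by_cases hv : v[j] = a
  · simp [hv]; omega
  · simp only [hv, if_false, nextPos, cond_eq_ite, beq_iff_eq]
    congr 1
    omega

theorem nextPos_le (v : List ℕ) (a j : ℕ) : nextPos v a j ≤ v.length + 1 := min_le_right _ _

theorem nextPos_mono_succ (v : List ℕ) (a j : ℕ) : nextPos v a j ≤ nextPos v a (j + 1) := by
  rcases Nat.lt_or_ge j v.length with h | h
  · rw [nextPos_of_lt a h]
    split_ifs
    · simp only [nextPos]
      omega
    · exact le_rfl
  · rw [nextPos_of_le a h, nextPos_of_le a (by omega)]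

/-- Ending later never helps: this monotonicity justifies keeping only the largest end in `front`.
-/
theorem nextPos_mono (v : List ℕ) (a : ℕ) : Monotone (nextPos v a) :=
  monotone_nat_of_le_succ (nextPos_mono_succ v a)

/-- The position at which the leftmost embedding of `s` into the part of `v` after the position `j`
ends; it is `|v| + 1` if there is no embedding. -/
def greedyEnd (v s : List ℕ) (j : ℕ) : ℕ := s.foldl (fun j a => nextPos v a j) j

/-- Greedy matching is optimal, since the first occurrence of the first letter of `s` may always be
used for it. A failed match stays failed: the value `|v| + 1` is a fixed point of all next-position
maps. -/
theorem sublist_drop_iff (v s : List ℕ) (j : ℕ) (hj : j ≤ v.length) :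
    s <+ v.drop j ↔ greedyEnd v s j ≤ v.length := by
  induction hk : v.length - j generalizing s j with
  | zero =>
    obtain rfl : j = v.length := by omega
    cases s with
    | nil => simp [greedyEnd]
    | cons a s =>
      have : ∀ s : List ℕ, greedyEnd v s (v.length + 1) = v.length + 1 := by
        intro s
        induction s with
        | nil => rfl
        | cons b s ih =>
          rw [greedyEnd, List.foldl_cons, nextPos_of_le b (by omega)]; exact ih
      rw [greedyEnd, List.foldl_cons, nextPos_of_le a le_rfl]
      have := this s
      rw [greedyEnd] at this
      simp [this]
  | succ k ih =>
    have hj : j < v.length := by omega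
    cases s with
    | nil => simpa [greedyEnd] using hj.le
    | cons a s =>
      rw [List.drop_eq_getElem_cons hj, greedyEnd, List.foldl_cons, nextPos_of_lt a hj]
      by_cases h : v[j] = a
      · rw [if_pos h, h, List.cons_sublist_cons]
        exact ih s (j + 1) hj (by omega)
      · rw [if_neg h]
        have := ih (a :: s) (j + 1) hj (by omega)
        rw [greedyEnd, List.foldl_cons] at this
        rw [← this, List.sublist_cons_iff]
        refine ⟨fun h' => ?_, .inl⟩
        rcases h' with h' | ⟨r, h', -⟩
        · exact h'
        · exact absurd (List.cons.inj h').1.symm h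

/-- The last end of the leftmost embeddings into `v` of the subwords of length at most `k` of the
prefix of length `i` of `u`. -/
def front (u v : List ℕ) : ℕ → ℕ → ℕ
  | 0, _ => 0
  | _ + 1, 0 => 0
  | k + 1, i + 1 => max (front u v (k + 1) i) (nextPos v (u.getD i 0) (front u v k i))

theorem front_zero_right (u v : List ℕ) (k : ℕ) : front u v k 0 = 0 := by
  cases k <;> rfl

theorem front_le (u v : List ℕ) (k i : ℕ) : front u v k i ≤ v.length + 1 := by
  induction i generalizing k with
  | zero => simp [front_zero_right]
  | succ i ih =>
    cases k with
    | zero => simp [front]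
    | succ k => exact max_le (ih _) (nextPos_le _ _ _)

theorem front_mono_right (u v : List ℕ) (k i : ℕ) : front u v k i ≤ front u v k (i + 1) := by
  cases k with
  | zero => simp [front]
  | succ k => exact le_max_left _ _

/-- A subword that needs the last letter `a` of the prefix is `t a` with `t` one letter shorter; by
monotonicity, the end of `t` may be replaced by its largest possible value. -/
theorem greedyEnd_le_front (u v : List ℕ) (k i : ℕ) (hi : i ≤ u.length) (s : List ℕ)
    (hs : s.length ≤ k) (h : s <+ u.take i) : greedyEnd v s 0 ≤ front u v k i := by
  induction i generalizing k s with
  | zero =>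
    obtain rfl : s = [] := by simpa using h
    simp [greedyEnd]
  | succ i ih =>
    have hi' : i < u.length := hi
    by_cases h' : s <+ u.take i
    · exact (ih k (by omega) s hs h').trans (front_mono_right _ _ _ _)
    · rw [List.take_succ_eq_append_getElem hi'] at h
      obtain ⟨t, rfl, ht⟩ := sublist_concat_cases h h'
      cases k with
      | zero => simp at hs
      | succ k =>
        rw [front, greedyEnd, List.foldl_append]
        refine le_trans ?_ (le_max_right _ _)
        rw [List.getD_eq_getElem _ _ (by omega)]
        exact nextPos_mono _ _ (ih k (by omega) t (by simpa using hs) ht)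

theorem exists_greedyEnd_eq_front (u v : List ℕ) (k i : ℕ) (hi : i ≤ u.length) :
    ∃ s : List ℕ, s.length ≤ k ∧ s <+ u.take i ∧ greedyEnd v s 0 = front u v k i := by
  induction i generalizing k with
  | zero => exact ⟨[], by simp, by simp, by simp [greedyEnd, front_zero_right]⟩
  | succ i ih =>
    cases k with
    | zero => exact ⟨[], by simp, by simp, by simp [greedyEnd, front]⟩
    | succ k =>
      rw [front, List.take_succ_eq_append_getElem (by omega)]
      rcases le_total (front u v (k + 1) i) (nextPos v (u.getD i 0) (front u v k i)) with h | h
      · rw [max_eq_right h]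
        obtain ⟨s, h₁, h₂, h₃⟩ := ih k (by omega)
        refine ⟨s ++ [u[i]], by simpa using h₁, h₂.append (List.Sublist.refl _), ?_⟩
        rw [greedyEnd, List.foldl_append, List.getD_eq_getElem _ _ (by omega), ← h₃]
        rfl
      · rw [max_eq_left h]
        obtain ⟨s, h₁, h₂, h₃⟩ := ih (k + 1) (by omega)
        exact ⟨s, h₁, h₂.trans (List.sublist_append_left _ _), h₃⟩

/-- The bound `front` is attained by some short subword, so a single number decides whether all of
them embed. -/
theorem front_le_length_iff (u v : List ℕ) (k : ℕ) :
    front u v k u.length ≤ v.length ↔ ∀ s : List ℕ, s.length ≤ k → s <+ u → s <+ v := by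
  have key : ∀ s : List ℕ, s <+ v ↔ greedyEnd v s 0 ≤ v.length :=
    fun s => by simpa using sublist_drop_iff v s 0 (Nat.zero_le _)
  constructor
  · intro h s hs hsu
    exact (key s).2 ((greedyEnd_le_front u v k _ le_rfl s hs (by simpa using hsu)).trans h)
  · intro h
    obtain ⟨s, h₁, h₂, h₃⟩ := exists_greedyEnd_eq_front u v k _ le_rfl
    rw [← h₃]
    exact (key s).1 (h s h₁ (by simpa using h₂))

theorem simonEq_iff_front (u v : List ℕ) (k : ℕ) :
    SimonEq k u v ↔ front u v k u.length ≤ v.length ∧ front v u k v.length ≤ u.length := by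
  rw [front_le_length_iff, front_le_length_iff]
  exact ⟨fun h => ⟨fun s hs => (h s hs).1, fun s hs => (h s hs).2⟩,
    fun h s hs => ⟨h.1 s hs, h.2 s hs⟩⟩

end Greedy

/-! ### Structured programs and their translation to jump code -/

section Structured

/-- Structured programs with basic actions in `α` and tests in `τ`. -/
inductive Cmd (α τ : Type) where
  | skip
  | act (a : α)
  | seq (c d : Cmd α τ)
  | ite (b : τ) (c d : Cmd α τ)
  | loop (b : τ) (c : Cmd α τ)

namespace Cmd

variable {α τ S : Type}

/-- The program that performs the listed actions. -/
def block : List α → Cmd α τ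
  | [] => skip
  | a :: l => seq (act a) (block l)

/-- The program `c` transforms the state `s` into `s'` at the cost `t`. -/
inductive Runs (A : α → S → Option S) (B : τ → S → Bool) : Cmd α τ → S → ℕ → S → Prop
  | skip (s : S) : Runs A B skip s 0 s
  | act {a : α} {s s' : S} (h : A a s = some s') : Runs A B (act a) s 1 s'
  | seq {c d : Cmd α τ} {s s' s'' : S} {t t' : ℕ} (h : Runs A B c s t s')
      (h' : Runs A B d s' t' s'') : Runs A B (seq c d) s (t + t') s''
  | ite_true {b : τ} {c d : Cmd α τ} {s s' : S} {t : ℕ} (hb : B b s = true)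
      (h : Runs A B c s t s') : Runs A B (ite b c d) s (t + 1) s'
  | ite_false {b : τ} {c d : Cmd α τ} {s s' : S} {t : ℕ} (hb : B b s = false)
      (h : Runs A B d s t s') : Runs A B (ite b c d) s (t + 2) s'
  | loop_true {b : τ} {c : Cmd α τ} {s s' s'' : S} {t t' : ℕ} (hb : B b s = true)
      (h : Runs A B c s t s') (h' : Runs A B (loop b c) s' t' s'') :
      Runs A B (loop b c) s (t + t' + 2) s''
  | loop_false {b : τ} {c : Cmd α τ} {s : S} (hb : B b s = false) :
      Runs A B (loop b c) s 2 s

/-- Started in `s`, the program stops at a cost of at most `T` in a state with the property `Q`. -/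
def Ensures (A : α → S → Option S) (B : τ → S → Bool) (c : Cmd α τ) (s : S) (T : ℕ)
    (Q : S → Prop) : Prop :=
  ∃ t ≤ T, ∃ s', Runs A B c s t s' ∧ Q s'

variable {A : α → S → Option S} {B : τ → S → Bool}

namespace Ensures

theorem mono {c : Cmd α τ} {s : S} {T T' : ℕ} {Q Q' : S → Prop} (h : Ensures A B c s T Q)
    (hT : T ≤ T') (hQ : ∀ s', Q s' → Q' s') : Ensures A B c s T' Q' := by
  obtain ⟨t, ht, s', hr, hq⟩ := h
  exact ⟨t, ht.trans hT, s', hr, hQ s' hq⟩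

theorem skip {s : S} {T : ℕ} {Q : S → Prop} (h : Q s) : Ensures A B .skip s T Q :=
  ⟨0, Nat.zero_le _, s, .skip s, h⟩

theorem act {a : α} {s s' : S} {T : ℕ} {Q : S → Prop} (h : A a s = some s') (hT : 1 ≤ T)
    (hQ : Q s') : Ensures A B (.act a) s T Q :=
  ⟨1, hT, s', .act h, hQ⟩

theorem seq {c d : Cmd α τ} {s : S} {T₁ T₂ : ℕ} {Q : S → Prop}
    (h : Ensures A B c s T₁ fun s' => Ensures A B d s' T₂ Q) :
    Ensures A B (.seq c d) s (T₁ + T₂) Q := by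
  obtain ⟨t, ht, s', hr, t', ht', s'', hr', hq⟩ := h
  exact ⟨t + t', add_le_add ht ht', s'', .seq hr hr', hq⟩

theorem ite {b : τ} {c d : Cmd α τ} {s : S} {T : ℕ} {Q : S → Prop}
    (h₁ : B b s = true → Ensures A B c s T Q) (h₂ : B b s = false → Ensures A B d s T Q) :
    Ensures A B (.ite b c d) s (T + 2) Q := by
  cases hb : B b s with
  | true =>
    obtain ⟨t, ht, s', hr, hq⟩ := h₁ hb
    exact ⟨t + 1, by omega, s', .ite_true hb hr, hq⟩
  | false =>
    obtain ⟨t, ht, s', hr, hq⟩ := h₂ hb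
    exact ⟨t + 2, by omega, s', .ite_false hb hr, hq⟩

/-- A loop whose invariant `I s T` bounds the remaining cost by `T`. -/
theorem loop {b : τ} {c : Cmd α τ} {Q : S → Prop} (I : S → ℕ → Prop)
    (hbody : ∀ s T, I s T → B b s = true → ∃ T₁,
      Ensures A B c s T₁ fun s' => ∃ T₂, T₁ + T₂ + 2 ≤ T ∧ I s' T₂)
    (hend : ∀ s T, I s T → B b s = false → 2 ≤ T ∧ Q s) {s : S} {T : ℕ} (h : I s T) :
    Ensures A B (.loop b c) s T Q := by
  induction T using Nat.strong_induction_on generalizing s with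
  | _ T ih =>
    cases hb : B b s with
    | true =>
      obtain ⟨T₁, t, ht, s', hr, T₂, hT, hI⟩ := hbody s T h hb
      obtain ⟨t', ht', s'', hr', hq⟩ := ih T₂ (by omega) hI
      exact ⟨t + t' + 2, by omega, s'', .loop_true hb hr hr', hq⟩
    | false =>
      obtain ⟨h₁, h₂⟩ := hend s T h hb
      exact ⟨2, h₁, s, .loop_false hb, h₂⟩

end Ensures

/-! #### Refinement -/

/-- Replace the actions of a program by programs and its tests by tests. -/
def bind {α' τ' : Type} (f : α → Cmd α' τ') (g : τ → τ') : Cmd α τ → Cmd α' τ'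
  | skip => skip
  | act a => f a
  | seq c d => seq (c.bind f g) (d.bind f g)
  | ite b c d => ite (g b) (c.bind f g) (d.bind f g)
  | loop b c => loop (g b) (c.bind f g)

/-- A simulation argument: `K` bounds the cost of a translated action, tests are translated one for
one, and `1 ≤ K` lets the factor `K` cover the control steps too. -/
theorem Runs.bind {α' τ' S' : Type} {A' : α' → S' → Option S'} {B' : τ' → S' → Bool}
    {f : α → Cmd α' τ'} {g : τ → τ'} {R : S → S' → Prop} {K : ℕ} (hK : 1 ≤ K)
    (hact : ∀ a s s₁ σ, A a s = some s₁ → R s σ → Ensures A' B' (f a) σ K (R s₁))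
    (htest : ∀ b s σ, R s σ → B' (g b) σ = B b s)
    {c : Cmd α τ} {s s₁ : S} {t : ℕ} (h : Runs A B c s t s₁) {σ : S'} (hR : R s σ) :
    Ensures A' B' (c.bind f g) σ (K * t) (R s₁) := by
  induction h generalizing σ with
  | skip s => exact .skip hR
  | act h => simpa [Cmd.bind] using hact _ _ _ _ h hR
  | seq h h' ih ih' =>
    rw [mul_add]
    exact .seq ((ih hR).mono le_rfl fun _ h => ih' h)
  | ite_true hb h ih =>
    obtain ⟨t, ht, s', hr, hq⟩ := ih hR
    exact ⟨t + 1, by rw [mul_add]; omega, s', .ite_true ((htest _ _ _ hR).trans hb) hr, hq⟩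
  | ite_false hb h ih =>
    obtain ⟨t, ht, s', hr, hq⟩ := ih hR
    exact ⟨t + 2, by rw [mul_add]; omega, s', .ite_false ((htest _ _ _ hR).trans hb) hr, hq⟩
  | loop_true hb h h' ih ih' =>
    obtain ⟨t, ht, s', hr, hq⟩ := ih hR
    obtain ⟨t', ht', s'', hr', hq'⟩ := ih' hq
    exact ⟨t + t' + 2, by rw [mul_add, mul_add]; omega, s'',
      .loop_true ((htest _ _ _ hR).trans hb) hr hr', hq'⟩
  | loop_false hb => exact ⟨2, by omega, σ, .loop_false ((htest _ _ _ hR).trans hb), hR⟩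

end Cmd

/-! #### Jump code -/

/-- The instructions of jump code. A `branch` jumps if the test is positive. -/
inductive Jmp (α τ : Type) where
  | act (a : α)
  | jump (k : ℕ)
  | branch (b : τ) (k : ℕ)

namespace Jmp

variable {α τ S : Type}

/-- One step of jump code. -/
def step (A : α → S → Option S) (B : τ → S → Bool) (P : List (Jmp α τ)) (c : ℕ × S) :
    Option (ℕ × S) :=
  match P[c.1]? with
  | none => none
  | some (.act a) => (A a c.2).map fun s => (c.1 + 1, s)
  | some (.jump k) => some (k, c.2)
  | some (.branch b k) => some (if B b c.2 = true then k else c.1 + 1, c.2)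

/-- Execution of jump code for a given number of steps. -/
inductive Steps (A : α → S → Option S) (B : τ → S → Bool) (P : List (Jmp α τ)) :
    ℕ × S → ℕ → ℕ × S → Prop
  | refl (c : ℕ × S) : Steps A B P c 0 c
  | head {c c' c'' : ℕ × S} {t : ℕ} (h : step A B P c = some c') (h' : Steps A B P c' t c'') :
      Steps A B P c (t + 1) c''

variable {A : α → S → Option S} {B : τ → S → Bool} {P : List (Jmp α τ)}

theorem Steps.trans {c c' c'' : ℕ × S} {t t' : ℕ} (h : Steps A B P c t c')
    (h' : Steps A B P c' t' c'') : Steps A B P c (t + t') c'' := by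
  induction h with
  | refl c => simpa using h'
  | head h _ ih =>
    rw [Nat.add_right_comm]
    exact .head h (ih h')

theorem Steps.single {c c' : ℕ × S} (h : step A B P c = some c') : Steps A B P c 1 c' :=
  .head h (.refl _)

end Jmp

namespace Cmd

variable {α τ S : Type} {A : α → S → Option S} {B : τ → S → Bool}

/-- The jump code of a program, to be placed at the position `p`. -/
def code : Cmd α τ → ℕ → List (Jmp α τ)
  | skip, _ => []
  | act a, _ => [.act a]
  | seq c d, p => c.code p ++ d.code (p + (c.code p).length)
  | ite b c d, p =>
      let cd := d.code (p + 1)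
      let cc := c.code (p + 1 + cd.length + 1)
      .branch b (p + 1 + cd.length + 1) ::
        (cd ++ .jump (p + 1 + cd.length + 1 + cc.length) :: cc)
  | loop b c, p =>
      let cc := c.code (p + 2)
      .branch b (p + 2) :: .jump (p + 2 + cc.length + 1) :: (cc ++ [.jump p])

/-- The costs in `Runs` are exact: a positive test jumps straight to its branch, a negative one also
pays for the jump past the other branch, and a round of a loop pays for the test and the jump back.
The surrounding code is arbitrary so that the induction applies to subprograms. -/
theorem Runs.steps {c : Cmd α τ} {s s' : S} {t : ℕ} (h : Runs A B c s t s')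
    (l₁ l₂ : List (Jmp α τ)) :
    Jmp.Steps A B (l₁ ++ c.code l₁.length ++ l₂) (l₁.length, s) t
      (l₁.length + (c.code l₁.length).length, s') := by
  induction h generalizing l₁ l₂ with
  | skip s => exact .refl _
  | act h =>
    refine .single ?_
    simp [Jmp.step, code, h]
  | @seq c d s s' s'' t t' h h' ih ih' =>
    have h₁ := ih l₁ (d.code (l₁.length + (c.code l₁.length).length) ++ l₂)
    have h₂ := ih' (l₁ ++ c.code l₁.length) l₂
    simp only [code, List.length_append, List.append_assoc, ← Nat.add_assoc] at h₁ h₂ ⊢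
    exact h₁.trans h₂
  | @ite_true b c d s s' t hb h ih =>
    set cd := d.code (l₁.length + 1)
    have h₁ := ih (l₁ ++ .branch b (l₁.length + 1 + cd.length + 1) ::
        (cd ++ [.jump (l₁.length + 1 + cd.length + 1 +
          (c.code (l₁.length + 1 + cd.length + 1)).length)])) l₂
    have e : ∀ x : ℕ, x + (cd.length + (0 + 1) + 1) = x + 1 + cd.length + 1 := by omega
    simp only [List.length_append, List.length_cons, List.length_nil, List.append_assoc,
      List.cons_append, List.nil_append, e] at h₁
    refine .head (c' := (l₁.length + 1 + cd.length + 1, s)) ?_ ?_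
    · simp [Jmp.step, code, hb, cd]
    · have e' : l₁.length + 1 + cd.length + 1 + (c.code (l₁.length + 1 + cd.length + 1)).length =
          l₁.length + ((ite b c d).code l₁.length).length := by
        simp [code, cd]; omega
      rw [← e']
      simpa [code, cd] using h₁
  | @ite_false b c d s s' t hb h ih =>
    set cd := d.code (l₁.length + 1) with hcd
    set cc := c.code (l₁.length + 1 + cd.length + 1) with hcc
    have h₁ := ih (l₁ ++ [.branch b (l₁.length + 1 + cd.length + 1)])
        (.jump (l₁.length + 1 + cd.length + 1 + cc.length) :: (cc ++ l₂))
    simp only [List.length_append, List.length_cons, List.length_nil, List.append_assoc,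
      List.cons_append, List.nil_append, Nat.zero_add, ← hcd] at h₁
    have hP : l₁ ++ (ite b c d).code l₁.length ++ l₂ =
        l₁ ++ .branch b (l₁.length + 1 + cd.length + 1) :: (cd ++
          .jump (l₁.length + 1 + cd.length + 1 + cc.length) :: (cc ++ l₂)) := by
      simp [code, cd, cc]
    have hlen : l₁.length + ((ite b c d).code l₁.length).length =
        l₁.length + 1 + cd.length + 1 + cc.length := by
      simp [code, cd, cc]; omega
    rw [hP, hlen]
    refine .head (c' := (l₁.length + 1, s)) (by simp [Jmp.step, hb]) (h₁.trans (.single ?_))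
    have : (l₁ ++ .branch b (l₁.length + 1 + cd.length + 1) :: (cd ++
          .jump (l₁.length + 1 + cd.length + 1 + cc.length) :: (cc ++ l₂)))[l₁.length + 1 +
            cd.length]? = some (.jump (l₁.length + 1 + cd.length + 1 + cc.length)) := by
      rw [List.getElem?_append_right (by omega)]
      rw [show l₁.length + 1 + cd.length - l₁.length = cd.length + 1 by omega]
      simp
    simp only [Jmp.step, this]
  | @loop_true b c s s' s'' t t' hb h h' ih ih' =>
    have h₁ := ih (l₁ ++ [.branch b (l₁.length + 2),
      .jump (l₁.length + 2 + (c.code (l₁.length + 2)).length + 1)]) (.jump l₁.length :: l₂)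
    have h₂ := ih' l₁ l₂
    set cc := c.code (l₁.length + 2) with hcc
    have hP : l₁ ++ (loop b c).code l₁.length ++ l₂ =
        l₁ ++ .branch b (l₁.length + 2) :: .jump (l₁.length + 2 + cc.length + 1) ::
          (cc ++ .jump l₁.length :: l₂) := by
      simp [code, cc]
    rw [hP] at h₂ ⊢
    simp only [List.length_append, List.length_cons, List.length_nil, List.append_assoc,
      List.cons_append, List.nil_append, Nat.zero_add, Nat.reduceAdd, ← hcc] at h₁
    rw [show t + t' + 2 = (t + (1 + t')) + 1 by omega]
    refine .head (c' := (l₁.length + 2, s)) (by simp [Jmp.step, hb])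
      (h₁.trans ((Jmp.Steps.single ?_).trans h₂))
    have : (l₁ ++ .branch b (l₁.length + 2) :: .jump (l₁.length + 2 + cc.length + 1) ::
          (cc ++ .jump l₁.length :: l₂))[l₁.length + 2 + cc.length]? =
            some (.jump l₁.length) := by
      rw [List.getElem?_append_right (by omega)]
      rw [show l₁.length + 2 + cc.length - l₁.length = cc.length + 2 by omega]
      simp
    simp only [Jmp.step, this]
  | @loop_false b c s hb =>
    refine .head (c' := (l₁.length + 1, s)) (by simp [Jmp.step, code, hb]) (.single ?_)
    simp [Jmp.step, code]
    omega

end Cmd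

end Structured

/-! ### Programs with arrays and their translation to random access machines -/

section Arrays

/-- Basic operations on registers and arrays. -/
inductive ArrOp where
  | const (d v : ℕ)
  | move (d a : ℕ)
  | add (d a b : ℕ)
  | sub (d a b : ℕ)
  /-- put the entry of the array `k` whose index is in register `a` into register `d` -/
  | load (d k a : ℕ)
  /-- put register `b` into the entry of the array `k` whose index is in register `a` -/
  | store (k a b : ℕ)

/-- The registers and the arrays. -/
structure ArrState where
  reg : ℕ → ℕ
  arr : ℕ → ℕ → ℕ

namespace ArrState

/-- Assign a value to a register. -/
def set (s : ArrState) (d v : ℕ) : ArrState := ⟨fun r => if r = d then v else s.reg r, s.arr⟩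

/-- Assign a value to an entry of an array. -/
def put (s : ArrState) (k i v : ℕ) : ArrState :=
  ⟨s.reg, fun k' => if k' = k then Function.update (s.arr k) i v else s.arr k'⟩

@[simp] theorem set_reg (s : ArrState) (d v r : ℕ) :
    (s.set d v).reg r = if r = d then v else s.reg r := rfl

@[simp] theorem set_arr (s : ArrState) (d v : ℕ) : (s.set d v).arr = s.arr := rfl

@[simp] theorem put_reg (s : ArrState) (k i v : ℕ) : (s.put k i v).reg = s.reg := rfl

@[simp] theorem put_arr (s : ArrState) (k i v k' : ℕ) :
    (s.put k i v).arr k' = if k' = k then Function.update (s.arr k) i v else s.arr k' := rfl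

end ArrState

namespace ArrOp

/-- The effect of an operation, for `N` arrays of size `D` and numbers up to `W`. -/
def run (N D W : ℕ) : ArrOp → ArrState → Option ArrState
  | const d v, s => if v ≤ W then some (s.set d v) else none
  | move d a, s => some (s.set d (s.reg a))
  | add d a b, s => if s.reg a + s.reg b ≤ W then some (s.set d (s.reg a + s.reg b)) else none
  | sub d a b, s => some (s.set d (s.reg a - s.reg b))
  | load d k a, s => if k < N ∧ s.reg a < D then some (s.set d (s.arr k (s.reg a))) else none
  | store k a b, s =>
      if k < N ∧ s.reg a < D then some (s.put k (s.reg a) (s.reg b)) else none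

/-- The tests compare two registers. -/
def test (b : ℕ × ℕ) (s : ArrState) : Bool := decide (s.reg b.1 < s.reg b.2)

/-- The weakest precondition of a list of operations. -/
def wp (N D W : ℕ) : List ArrOp → ArrState → (ArrState → Prop) → Prop
  | [], s, Q => Q s
  | const d v :: l, s, Q => v ≤ W ∧ wp N D W l (s.set d v) Q
  | move d a :: l, s, Q => wp N D W l (s.set d (s.reg a)) Q
  | add d a b :: l, s, Q => s.reg a + s.reg b ≤ W ∧ wp N D W l (s.set d (s.reg a + s.reg b)) Q
  | sub d a b :: l, s, Q => wp N D W l (s.set d (s.reg a - s.reg b)) Q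
  | load d k a :: l, s, Q =>
      k < N ∧ s.reg a < D ∧ wp N D W l (s.set d (s.arr k (s.reg a))) Q
  | store k a b :: l, s, Q =>
      k < N ∧ s.reg a < D ∧ wp N D W l (s.put k (s.reg a) (s.reg b)) Q

theorem wp_cons {N D W : ℕ} {a : ArrOp} {l : List ArrOp} {s : ArrState} {Q : ArrState → Prop}
    (h : wp N D W (a :: l) s Q) : ∃ s', run N D W a s = some s' ∧ wp N D W l s' Q := by
  cases a <;> simp only [wp] at h
  · exact ⟨_, if_pos h.1, h.2⟩
  · exact ⟨_, rfl, h⟩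
  · exact ⟨_, if_pos h.1, h.2⟩
  · exact ⟨_, rfl, h⟩
  · exact ⟨_, if_pos ⟨h.1, h.2.1⟩, h.2.2⟩
  · exact ⟨_, if_pos ⟨h.1, h.2.1⟩, h.2.2⟩

theorem ensures_block {N D W : ℕ} {l : List ArrOp} {s : ArrState} {Q : ArrState → Prop}
    (h : wp N D W l s Q) : Cmd.Ensures (run N D W) test (.block l) s l.length Q := by
  induction l generalizing s with
  | nil => exact .skip h
  | cons a l ih =>
    obtain ⟨s', h₁, h₂⟩ := wp_cons h
    rw [List.length_cons, Nat.add_comm]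
    exact .seq (.act h₁ le_rfl (ih h₂))

end ArrOp

end Arrays

/-! ### Compilation of array programs to random access machines -/

section Machine

/-- The instructions of a random access machine that are not jumps, as actions on the registers and
the memory. -/
def ramAct (S W : ℕ) (i : RAM.Instr) (s : (ℕ → ℕ) × (ℕ → ℕ)) : Option ((ℕ → ℕ) × (ℕ → ℕ)) :=
  match i with
  | .jump _ => none
  | .jumpLt _ _ _ => none
  | .halt _ => none
  | i => (RAM.step [i] S W ⟨0, s.1, s.2⟩).map fun c => (c.reg, c.mem)

/-- The tests of a random access machine. -/
def ramTest (b : ℕ × ℕ) (s : (ℕ → ℕ) × (ℕ → ℕ)) : Bool := decide (s.1 b.1 < s.1 b.2)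

/-- Jump code as a program of a random access machine. -/
def ramInstr : Jmp RAM.Instr (ℕ × ℕ) → RAM.Instr
  | .act i => i
  | .jump k => .jump k
  | .branch b k => .jumpLt b.1 b.2 k

theorem ram_step_of_jmp_step {S W : ℕ} {P : List (Jmp RAM.Instr (ℕ × ℕ))} (Q : RAM.Program)
    {c c' : ℕ × ((ℕ → ℕ) × (ℕ → ℕ))} (h : Jmp.step (ramAct S W) ramTest P c = some c') :
    RAM.step (P.map ramInstr ++ Q) S W ⟨c.1, c.2.1, c.2.2⟩ = some ⟨c'.1, c'.2.1, c'.2.2⟩ := by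
  obtain ⟨p, r, m⟩ := c
  rw [Jmp.step] at h
  cases hP : P[p]? with
  | none => simp [hP] at h
  | some i =>
    have hp : p < P.length := by
      by_contra hc
      simp [List.getElem?_eq_none (not_lt.1 hc)] at hP
    have hP' : (P.map ramInstr ++ Q)[p]? = some (ramInstr i) := by
      rw [List.getElem?_append_left (by simpa using hp), List.getElem?_map, hP]
      rfl
    cases i with
    | act i =>
      simp only [hP, Option.map_eq_some_iff] at h
      obtain ⟨s, hs, rfl⟩ := h
      cases i <;> simp only [ramAct, RAM.step, List.getElem?_cons_zero, reduceCtorEq] at hs <;>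
        simp only [RAM.step, hP', ramInstr] <;>
        simp only [RAM.Config.put, Option.map_eq_some_iff, Option.some.injEq,
          Option.ite_none_right_eq_some, exists_eq_left'] at hs ⊢ <;>
        grind
    | jump k =>
      simp only [hP, Option.some.injEq] at h
      subst h
      simp [RAM.step, hP', ramInstr]
    | branch b k =>
      simp only [hP, Option.some.injEq] at h
      subst h
      simp [RAM.step, hP', ramInstr, ramTest]

theorem ram_answers_of_jmp_steps {S W : ℕ} {P : List (Jmp RAM.Instr (ℕ × ℕ))} {Q : RAM.Program}
    {c c' : ℕ × ((ℕ → ℕ) × (ℕ → ℕ))} {t : ℕ} (h : Jmp.Steps (ramAct S W) ramTest P c t c')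
    {t' : ℕ} {b : Bool}
    (h' : RAM.Answers (P.map ramInstr ++ Q) S W ⟨c'.1, c'.2.1, c'.2.2⟩ t' b) :
    RAM.Answers (P.map ramInstr ++ Q) S W ⟨c.1, c.2.1, c.2.2⟩ (t + t') b := by
  induction h with
  | refl => simpa using h'
  | head h _ ih =>
    rw [Nat.add_right_comm]
    exact .step (ram_step_of_jmp_step Q h) (ih h')

/-- The instructions for an array operation: the register `i` is the register `2 * i` of the machine,
the register `2 * k + 3` holds the address at which the array `k` starts. -/
def ArrOp.toRam : ArrOp → Cmd RAM.Instr (ℕ × ℕ)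
  | const d v => .act (.const (2 * d) v)
  | move d a => .act (.move (2 * d) (2 * a))
  | add d a b => .act (.add (2 * d) (2 * a) (2 * b))
  | sub d a b => .act (.sub (2 * d) (2 * a) (2 * b))
  | load d k a => .seq (.act (.add 1 (2 * k + 3) (2 * a))) (.act (.load (2 * d) 1))
  | store k a b => .seq (.act (.add 1 (2 * k + 3) (2 * a))) (.act (.store 1 (2 * b)))

/-- The registers and the memory of a machine represent registers and arrays. -/
structure ArrState.Represents (N D : ℕ) (s : ArrState) (σ : (ℕ → ℕ) × (ℕ → ℕ)) : Prop where
  reg : ∀ i, σ.1 (2 * i) = s.reg i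
  base : ∀ k < N, σ.1 (2 * k + 3) = k * D
  mem : ∀ k < N, ∀ i < D, σ.2 (k * D + i) = s.arr k i

theorem mul_add_injective {D k k' i i' : ℕ} (hi : i < D) (hi' : i' < D)
    (h : k * D + i = k' * D + i') : k = k' ∧ i = i' := by
  have hk : k = k' := by
    have h₁ : (k * D + i) / D = k := by
      rw [Nat.mul_comm, Nat.mul_add_div (by omega), Nat.div_eq_of_lt hi, Nat.add_zero]
    have h₂ : (k' * D + i') / D = k' := by
      rw [Nat.mul_comm, Nat.mul_add_div (by omega), Nat.div_eq_of_lt hi', Nat.add_zero]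
    rw [← h₁, h, h₂]
  subst hk
  exact ⟨rfl, by omega⟩

theorem mul_add_lt {N D k i : ℕ} (hk : k < N) (hi : i < D) : k * D + i < N * D := by
  calc k * D + i < k * D + D := by omega
    _ = (k + 1) * D := by ring
    _ ≤ N * D := Nat.mul_le_mul_right D hk

/-- Even machine registers hold the simulated registers, odd ones from `3` on the array bases, and
register `1` serves as scratch space for addresses, so no write disturbs another component. The
bounds on `N * D` make every computed address a legal word and a legal cell. -/
theorem ArrOp.toRam_ensures {N D S W : ℕ} (hS : N * D ≤ S) (hW : N * D ≤ W) (a : ArrOp)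
    (s s₁ : ArrState) (σ : (ℕ → ℕ) × (ℕ → ℕ)) (h : a.run N D W s = some s₁)
    (hR : s.Represents N D σ) :
    Cmd.Ensures (ramAct S W) ramTest a.toRam σ 2 (s₁.Represents N D) := by
  have hset : ∀ d v, (s.set d v).Represents N D (Function.update σ.1 (2 * d) v, σ.2) := by
    intro d v
    refine ⟨fun i => ?_, fun k hk => ?_, hR.mem⟩
    · simp only [Function.update_apply, ArrState.set_reg, ← hR.reg]
      split_ifs <;> first | rfl | omega
    · rw [← hR.base k hk]
      exact Function.update_of_ne (by omega) _ _
  have htmp : ∀ v, s.Represents N D (Function.update σ.1 1 v, σ.2) := by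
    intro v
    refine ⟨fun i => ?_, fun k hk => ?_, hR.mem⟩
    · rw [← hR.reg]
      exact Function.update_of_ne (show 2 * i ≠ 1 by omega) _ _
    · rw [← hR.base k hk]
      exact Function.update_of_ne (show 2 * k + 3 ≠ 1 by omega) v σ.1
  cases a with
  | const d v =>
    simp only [run, Option.ite_none_right_eq_some, Option.some.injEq] at h
    obtain ⟨hv, rfl⟩ := h
    refine .act (s' := (Function.update σ.1 (2 * d) v, σ.2)) ?_ (by omega) (hset d v)
    simp [ramAct, RAM.step, RAM.Config.put, hv]
  | move d a =>
    simp only [run, Option.some.injEq] at h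
    subst h
    refine .act (s' := (Function.update σ.1 (2 * d) (s.reg a), σ.2)) ?_ (by omega) (hset d _)
    simp [ramAct, RAM.step, RAM.Config.put, hR.reg]
  | add d a b =>
    simp only [run, Option.ite_none_right_eq_some, Option.some.injEq] at h
    obtain ⟨hv, rfl⟩ := h
    refine .act (s' := (Function.update σ.1 (2 * d) (s.reg a + s.reg b), σ.2)) ?_ (by omega)
      (hset d _)
    simp [ramAct, RAM.step, RAM.Config.put, hR.reg, hv]
  | sub d a b =>
    simp only [run, Option.some.injEq] at h
    subst h
    refine .act (s' := (Function.update σ.1 (2 * d) (s.reg a - s.reg b), σ.2)) ?_ (by omega)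
      (hset d _)
    simp [ramAct, RAM.step, RAM.Config.put, hR.reg]
  | load d k a =>
    simp only [run, Option.ite_none_right_eq_some, Option.some.injEq] at h
    obtain ⟨⟨hk, ha⟩, rfl⟩ := h
    have hlt := mul_add_lt hk ha
    refine .seq (T₁ := 1) (T₂ := 1)
      (.act (s' := (Function.update σ.1 1 (k * D + s.reg a), σ.2)) ?_ le_rfl
      (.act (s' := (Function.update (Function.update σ.1 1 (k * D + s.reg a)) (2 * d)
        (s.arr k (s.reg a)), σ.2)) ?_ le_rfl ?_))
    · simp [ramAct, RAM.step, RAM.Config.put, hR.reg, hR.base k hk]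
      omega
    · simp [ramAct, RAM.step, RAM.Config.put, hR.mem k hk _ ha]
      omega
    · refine ⟨fun i => ?_, fun k' hk' => ?_, hR.mem⟩
      · simp only [Function.update_apply, ArrState.set_reg, ← hR.reg]
        split_ifs <;> first | rfl | omega
      · rw [← hR.base k' hk']
        simp only [Function.update_apply]
        split_ifs <;> first | rfl | omega
  | store k a b =>
    simp only [run, Option.ite_none_right_eq_some, Option.some.injEq] at h
    obtain ⟨⟨hk, ha⟩, rfl⟩ := h
    have hlt := mul_add_lt hk ha
    refine .seq (T₁ := 1) (T₂ := 1)
      (.act (s' := (Function.update σ.1 1 (k * D + s.reg a), σ.2)) ?_ le_rfl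
      (.act (s' := (Function.update σ.1 1 (k * D + s.reg a),
        Function.update σ.2 (k * D + s.reg a) (s.reg b))) ?_ le_rfl ?_))
    · simp [ramAct, RAM.step, RAM.Config.put, hR.reg, hR.base k hk]
      omega
    · simp [ramAct, RAM.step, hR.reg]
      omega
    · refine ⟨(htmp _).reg, (htmp _).base, fun k' hk' i hi => ?_⟩
      simp only [Function.update_apply, ArrState.put_arr]
      by_cases hc : k' * D + i = k * D + s.reg a
      · obtain ⟨rfl, rfl⟩ := mul_add_injective hi ha hc
        simp
      · rw [if_neg hc, hR.mem k' hk' i hi]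
        split_ifs with h₁
        · subst h₁
          rw [Function.update_of_ne (by rintro rfl; exact hc rfl)]
        · rfl

/-- The initial registers and arrays on an identity of length `D - 2`: the array `0` holds the
letters and the registers `0` and `1` the lengths of the two sides. -/
def arrInit (e : MonoidIdentity) : ArrState where
  reg i := if i = 0 then e.lhs.toList.length else if i = 1 then e.rhs.toList.length else 0
  arr k i := e.letters.getD (k * (e.length + 2) + i) 0

/-- The length of the right side is first moved to register `2`, its simulated place; this frees
register `1` to build `D = l + 2`, and the bases `0, D, …, 5 D` are then accumulated. The input
already starts at address `0`, so the array `0` needs no copying. -/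
theorem ramInit_represents (e : MonoidIdentity) {S W : ℕ} (hW : 6 * (e.length + 2) ≤ W) :
    Cmd.Ensures (ramAct S W) ramTest
      (.block [.move 2 1, .add 1 1 0, .const 3 2, .add 1 1 3, .const 3 0, .add 5 3 1, .add 7 5 1,
        .add 9 7 1, .add 11 9 1, .add 13 11 1])
      ((RAM.init e).reg, (RAM.init e).mem) 10 ((arrInit e).Represents 6 (e.length + 2)) := by
  have hl : e.rhs.toList.length + e.lhs.toList.length = e.length := by
    rw [MonoidIdentity.length]; omega
  have key : ∀ (i : RAM.Instr) (l : List RAM.Instr) (T : ℕ) (s s' : (ℕ → ℕ) × (ℕ → ℕ))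
      (Q : (ℕ → ℕ) × (ℕ → ℕ) → Prop), ramAct S W i s = some s' →
      Cmd.Ensures (ramAct S W) ramTest (.block l) s' T Q →
      Cmd.Ensures (ramAct S W) ramTest (.block (i :: l)) s (T + 1) Q := by
    intro i l T s s' Q h h'
    rw [Nat.add_comm]
    exact .seq (.act h le_rfl h')
  set r := (RAM.init e).reg with hr
  set m := (RAM.init e).mem with hm
  have h₀ : r 0 = e.lhs.toList.length := rfl
  have h₁ : r 1 = e.rhs.toList.length := rfl
  have h₂ : ∀ i, 2 ≤ i → r i = 0 := by
    intro i hi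
    simp only [hr, RAM.init]
    rw [if_neg (by omega), if_neg (by omega)]
  set D := e.length + 2 with hD
  have hadd : ∀ (d a b x y : ℕ) (f : ℕ → ℕ), f a = x → f b = y → x + y ≤ W →
      ramAct S W (.add d a b) (f, m) = some (Function.update f d (x + y), m) := by
    rintro d a b x y f rfl rfl h
    simp [ramAct, RAM.step, RAM.Config.put, h]
  have hconst : ∀ (d v : ℕ) (f : ℕ → ℕ), v ≤ W →
      ramAct S W (.const d v) (f, m) = some (Function.update f d v, m) := by
    intro d v f h
    simp [ramAct, RAM.step, RAM.Config.put, h]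
  have hmove : ramAct S W (.move 2 1) (r, m) = some (Function.update r 2 (r 1), m) := by
    simp [ramAct, RAM.step, RAM.Config.put]
  refine key _ _ 9 _ _ _ hmove (key _ _ 8 _ _ _ (hadd _ _ _ (r 1) (r 0) _ ?_ ?_ ?_)
    (key _ _ 7 _ _ _ (hconst _ _ _ ?_) (key _ _ 6 _ _ _ (hadd _ _ _ (r 1 + r 0) 2 _ ?_ ?_ ?_)
    (key _ _ 5 _ _ _ (hconst _ _ _ ?_) (key _ _ 4 _ _ _ (hadd _ _ _ 0 D _ ?_ ?_ ?_)
    (key _ _ 3 _ _ _ (hadd _ _ _ D D _ ?_ ?_ ?_) (key _ _ 2 _ _ _ (hadd _ _ _ (2 * D) D _ ?_ ?_ ?_)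
    (key _ _ 1 _ _ _ (hadd _ _ _ (3 * D) D _ ?_ ?_ ?_)
    (key _ _ 0 _ _ _ (hadd _ _ _ (4 * D) D _ ?_ ?_ ?_)
    (.skip ?_))))))))))
  case refine_24 =>
    refine ⟨fun i => ?_, fun k hk => ?_, fun k hk i hi => rfl⟩
    · simp only [Function.update_apply, arrInit, h₀, h₁]
      rcases i with _ | _ | i
      · simp [h₀]
      · simp
      · have := h₂ (2 * (i + 1 + 1)) (by omega)
        split_ifs <;> first | omega | contradiction
    · interval_cases k <;> simp <;> omega
  all_goals first | omega | (simp <;> omega)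

/-- A program with six arrays whose answer is positive if register `0` is less than register `1`
yields a random access machine. -/
theorem decidableInTime_of_ensures {L : Set MonoidIdentity} {f : ℕ → ℝ} (c : Cmd ArrOp (ℕ × ℕ))
    (C : ℕ) (T : ℕ → ℕ) (hT : (fun l => (T l : ℝ)) =O[Filter.atTop] f)
    (hf : (fun _ => (1 : ℝ)) =O[Filter.atTop] f)
    (h : ∀ (e : MonoidIdentity) (W : ℕ), C * (e.length + 2) ≤ W →
      Cmd.Ensures (ArrOp.run 6 (e.length + 2) W) ArrOp.test c (arrInit e) (T e.length)
        fun s => s.reg 0 < s.reg 1 ↔ e ∈ L) :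
    RAM.DecidableInTime L f := by
  let pre : Cmd RAM.Instr (ℕ × ℕ) := .block [.move 2 1, .add 1 1 0, .const 3 2, .add 1 1 3,
    .const 3 0, .add 5 3 1, .add 7 5 1, .add 9 7 1, .add 11 9 1, .add 13 11 1]
  let full : Cmd RAM.Instr (ℕ × ℕ) := .seq pre (c.bind ArrOp.toRam fun b => (2 * b.1, 2 * b.2))
  let P := full.code 0
  refine ⟨P.map ramInstr ++ [.jumpLt 0 2 (P.length + 2), .halt false, .halt true], C + 7,
    fun l => 2 * T l + 12, by omega, ?_, fun e => ?_⟩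
  · have := (hT.const_mul_left 2).add (hf.const_mul_left 12)
    simpa using this
  · set S := (e.length + 2) ^ (C + 7) with hS
    set W := (e.length + e.maxVar + 2) ^ (C + 7) with hW
    -- One factor of the power supplies `l + 2`, and the others exceed `C + 6` because the base is
    -- at least `2`. The summand `6` pays for the arrays, `C` for the numbers of the program.
    have h₁ : (C + 6) * (e.length + 2) ≤ S := by
      rw [hS, pow_succ]
      refine Nat.mul_le_mul_right _ ?_
      calc C + 6 ≤ 2 ^ (C + 6) := Nat.lt_two_pow_self.le
        _ ≤ (e.length + 2) ^ (C + 6) := Nat.pow_le_pow_left (by omega) _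
    have h₂ : S ≤ W := Nat.pow_le_pow_left (by omega) _
    rw [add_mul] at h₁
    have hpre := ramInit_represents e (S := S) (W := W) (by omega)
    obtain ⟨t, ht, s, hr, hs⟩ := h e W (by omega)
    have hfull : Cmd.Ensures (ramAct S W) ramTest full ((RAM.init e).reg, (RAM.init e).mem)
        (10 + 2 * t) (s.Represents 6 (e.length + 2)) :=
      .seq (hpre.mono le_rfl fun σ hσ => hr.bind (by omega)
        (fun a s s₁ σ h hR => ArrOp.toRam_ensures (by omega) (by omega) a s s₁ σ h hR)
        (fun b s σ hR => by simp [ramTest, ArrOp.test, hR.reg]) hσ)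
    obtain ⟨t', ht', σ, hr', hσ⟩ := hfull
    have hsteps := hr'.steps [] []
    simp only [List.nil_append, List.append_nil, List.length_nil, Nat.zero_add] at hsteps
    refine ⟨t' + 2, by dsimp only; omega, decide (s.reg 0 < s.reg 1), ?_, by simpa using hs⟩
    refine ram_answers_of_jmp_steps (c := (0, (RAM.init e).reg, (RAM.init e).mem)) hsteps ?_
    have hg : ∀ i, (List.map ramInstr (full.code 0) ++
        [.jumpLt 0 2 (P.length + 2), .halt false, .halt true])[P.length + i]? =
        ([.jumpLt 0 2 (P.length + 2), .halt false, .halt true] : List RAM.Instr)[i]? := by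
      intro i
      rw [List.getElem?_append_right (by simp [P])]
      simp [P]
    have hr0 : σ.1 0 = s.reg 0 := hσ.reg 0
    have hr2 : σ.1 2 = s.reg 1 := hσ.reg 1
    refine .step (t := 1) (c' := ⟨if s.reg 0 < s.reg 1 then P.length + 2 else P.length + 1, σ.1,
      σ.2⟩) ?_ (.halt ?_)
    · have := hg 0
      simp only [Nat.add_zero, P] at this
      simp only [RAM.step, this, List.getElem?_cons_zero, hr0, hr2, P]
    · by_cases hlt : s.reg 0 < s.reg 1
      · simpa [hlt] using hg 2
      · simpa [hlt] using hg 1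

end Machine

/-! ### Sorting letters with a heap -/

section Heap

/-- The entries of `A` at the positions `≥ lo` and `< s` form a heap with respect to the keys `L`. -/
def IsHeap (L A : ℕ → ℕ) (lo s : ℕ) : Prop :=
  ∀ j c, lo ≤ j → (c = 2 * j + 1 ∨ c = 2 * j + 2) → c < s → L (A c) ≤ L (A j)

/-- A heap in which the entry at the position `i` may be smaller than its children. -/
structure IsHeapExcept (L A : ℕ → ℕ) (lo s i : ℕ) : Prop where
  heap : ∀ j c, lo ≤ j → j ≠ i → (c = 2 * j + 1 ∨ c = 2 * j + 2) → c < s → L (A c) ≤ L (A j)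
  parent : ∀ j c, lo ≤ j → (i = 2 * j + 1 ∨ i = 2 * j + 2) → (c = 2 * i + 1 ∨ c = 2 * i + 2) →
    c < s → L (A c) ≤ L (A j)

/-- The first `s` entries of `A` and `A'` have the same values. -/
def SameValues (s : ℕ) (A A' : ℕ → ℕ) : Prop := ∀ p, (∃ i < s, A i = p) ↔ ∃ i < s, A' i = p

theorem IsHeap.le_root {L A : ℕ → ℕ} {s : ℕ} (h : IsHeap L A 0 s) (i : ℕ) (hi : i < s) :
    L (A i) ≤ L (A 0) := by
  induction i using Nat.strong_induction_on with
  | _ i ih =>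
    rcases Nat.eq_zero_or_pos i with rfl | hpos
    · exact le_rfl
    · exact (h ((i - 1) / 2) i (Nat.zero_le _) (by omega) hi).trans
        (ih ((i - 1) / 2) (by omega) (by omega))

theorem IsHeapExcept.isHeap {L A : ℕ → ℕ} {lo s i : ℕ} (h : IsHeapExcept L A lo s i)
    (hi : ∀ c, (c = 2 * i + 1 ∨ c = 2 * i + 2) → c < s → L (A c) ≤ L (A i)) :
    IsHeap L A lo s := by
  intro j c hj hc hcs
  by_cases hji : j = i
  · subst hji
    exact hi c hc hcs
  · exact h.heap j c hj hji hc hcs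

theorem IsHeap.isHeapExcept_pred {L A : ℕ → ℕ} {lo s : ℕ} (h : IsHeap L A (lo + 1) s) :
    IsHeapExcept L A lo s lo :=
  ⟨fun j c hj hne => h j c (by omega), fun j c hj h' => by omega⟩

/-- The entry raised to `i` stays below the parent of `i` by the condition `parent`. The new
exceptional position `c` has the raised entry above it, and that entry dominated the children of `c`
before the swap, which restores `parent`. -/
theorem IsHeapExcept.swap {L A : ℕ → ℕ} {lo s i c : ℕ} (h : IsHeapExcept L A lo s i)
    (hlo : lo ≤ i) (hc : c = 2 * i + 1 ∨ c = 2 * i + 2) (hcs : c < s) (hlt : L (A i) < L (A c))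
    (hmax : ∀ c', (c' = 2 * i + 1 ∨ c' = 2 * i + 2) → c' < s → L (A c') ≤ L (A c)) :
    IsHeapExcept L (Function.update (Function.update A i (A c)) c (A i)) lo s c := by
  have hic : i ≠ c := by omega
  have vi : Function.update (Function.update A i (A c)) c (A i) i = A c := by
    rw [Function.update_of_ne hic, Function.update_self]
  have vc : Function.update (Function.update A i (A c)) c (A i) c = A i := Function.update_self ..
  have vo : ∀ x, x ≠ i → x ≠ c → Function.update (Function.update A i (A c)) c (A i) x = A x := by
    intro x h₁ h₂
    rw [Function.update_of_ne h₂, Function.update_of_ne h₁]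
  constructor
  · intro j c' hj hjc hc' hcs'
    by_cases hji : j = i
    · subst hji
      rw [vi]
      by_cases hcc : c' = c
      · rw [hcc, vc]; exact hlt.le
      · rw [vo c' (by omega) hcc]; exact hmax c' hc' hcs'
    · rw [vo j hji hjc]
      by_cases hci : c' = i
      · rw [hci, vi]
        exact h.parent j c hj (by omega) hc hcs
      · rw [vo c' hci (by omega)]
        exact h.heap j c' hj hji hc' hcs'
  · intro j c' hj hc₁ hc₂ hcs'
    obtain rfl : j = i := by omega
    rw [vi, vo c' (by omega) (by omega)]
    exact h.heap c c' (by omega) (by omega) hc₂ hcs'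

theorem SameValues.refl (s : ℕ) (A : ℕ → ℕ) : SameValues s A A := fun _ => Iff.rfl

theorem SameValues.trans {s : ℕ} {A A' A'' : ℕ → ℕ} (h : SameValues s A A')
    (h' : SameValues s A' A'') : SameValues s A A'' := fun p => (h p).trans (h' p)

theorem SameValues.swap {s i j : ℕ} (A : ℕ → ℕ) (hi : i < s) (hj : j < s) :
    SameValues s A (Function.update (Function.update A i (A j)) j (A i)) := by
  intro p
  constructor
  · rintro ⟨x, hx, rfl⟩
    by_cases h₁ : x = i
    · exact ⟨j, hj, by simp [h₁]⟩
    · by_cases h₂ : x = j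
      · refine ⟨i, hi, ?_⟩
        have : i ≠ j := by omega
        simp [h₂, this]
      · exact ⟨x, hx, by simp [h₁, h₂]⟩
  · rintro ⟨x, hx, rfl⟩
    by_cases h₂ : x = j
    · exact ⟨i, hi, by simp [h₂]⟩
    · by_cases h₁ : x = i
      · exact ⟨j, hj, by rw [Function.update_of_ne h₂, h₁, Function.update_self]⟩
      · exact ⟨x, hx, by simp [h₁, h₂]⟩

theorem SameValues.forall_lt {s : ℕ} {A A' : ℕ → ℕ} (h : SameValues s A A') {P : ℕ → Prop}
    (hA : ∀ i < s, P (A i)) : ∀ i < s, P (A' i) := by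
  intro i hi
  obtain ⟨j, hj, e⟩ := (h _).2 ⟨i, hi, rfl⟩
  exact e ▸ hA j hj

/-- The state `s'` differs from `s` at most in the registers in `R` and the arrays in `K`. -/
structure ArrState.Frame (R K : List ℕ) (s s' : ArrState) : Prop where
  reg : ∀ r, r ∉ R → s'.reg r = s.reg r
  arr : ∀ k, k ∉ K → s'.arr k = s.arr k

theorem ArrState.Frame.trans {R K : List ℕ} {s s' s'' : ArrState} (h : Frame R K s s')
    (h' : Frame R K s' s'') : Frame R K s s'' :=
  ⟨fun r hr => (h'.reg r hr).trans (h.reg r hr), fun k hk => (h'.arr k hk).trans (h.arr k hk)⟩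

theorem ArrState.Frame.mono {R K R' K' : List ℕ} {s s' : ArrState} (h : Frame R K s s')
    (hR : R ⊆ R') (hK : K ⊆ K') : Frame R' K' s s' :=
  ⟨fun r hr => h.reg r fun hr' => hr (hR hr'), fun k hk => h.arr k fun hk' => hK hk' |> hk⟩

open Cmd ArrOp

/-- Select the child with the larger key of the entry at the position in register `6`: the
registers `8`, `10`, `11` get its position, entry and key. Register `7` is the size of the heap. -/
def siftSelect : Cmd ArrOp (ℕ × ℕ) :=
  .seq (.block [.add 9 8 3, .load 10 1 8, .load 11 0 10])
    (.ite (9, 7)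
      (.seq (.block [.load 12 1 9, .load 13 0 12])
        (.ite (11, 13) (.block [.move 8 9, .move 10 12, .move 11 13]) .skip))
      .skip)

/-- Swap the entry at the position in register `6` with the selected child if that is larger. -/
def siftSwap : Cmd ArrOp (ℕ × ℕ) :=
  .seq (.block [.load 12 1 6, .load 13 0 12])
    (.ite (13, 11)
      (.block [.store 1 6 10, .store 1 8 12, .move 6 8, .add 8 6 6, .add 8 8 3])
      (.block [.move 8 7]))

/-- Move the entry of the heap in the array `1` at the position in register `6` down. -/
def sift : Cmd ArrOp (ℕ × ℕ) :=
  .seq (.block [.add 8 6 6, .add 8 8 3]) (.loop (8, 7) (.seq siftSelect siftSwap))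

theorem siftSelect_ensures {l W : ℕ} (hW : 4 * (l + 2) ≤ W) {s : ArrState} (h3 : s.reg 3 = 1)
    (h7 : s.reg 7 ≤ l) (h8 : s.reg 8 < s.reg 7) (hA : ∀ i < s.reg 7, s.arr 1 i < l) :
    Ensures (ArrOp.run 6 (l + 2) W) ArrOp.test siftSelect s 12 fun s' =>
      ∃ c, (c = s.reg 8 ∨ c = s.reg 8 + 1) ∧ c < s.reg 7 ∧
        (∀ c', (c' = s.reg 8 ∨ c' = s.reg 8 + 1) → c' < s.reg 7 →
          s.arr 0 (s.arr 1 c') ≤ s.arr 0 (s.arr 1 c)) ∧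
        s'.reg 8 = c ∧ s'.reg 10 = s.arr 1 c ∧ s'.reg 11 = s.arr 0 (s.arr 1 c) ∧
        s.Frame [8, 9, 10, 11, 12, 13] [] s' := by
  have h₁ := hA _ h8
  refine .seq (T₁ := 3) (T₂ := 9) (ensures_block ?_)
  simp only [wp, ArrState.set_reg, ArrState.set_arr, h3, reduceIte, Nat.reduceEqDiff]
  refine ⟨by omega, by omega, by omega, by omega, by omega, .ite (T := 7) (fun hb => ?_) fun hb => ?_⟩
  · simp [ArrOp.test] at hb
    have h₂ := hA _ hb
    refine .seq (T₁ := 2) (T₂ := 5) (ensures_block ?_)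
    simp only [wp, ArrState.set_reg, ArrState.set_arr, reduceIte, Nat.reduceEqDiff]
    refine ⟨by omega, by omega, by omega, by omega, .ite (T := 3) (fun hb' => ?_) fun hb' => ?_⟩
    · simp [ArrOp.test] at hb'
      refine ensures_block ?_
      simp only [wp, ArrState.set_reg, reduceIte, Nat.reduceEqDiff]
      refine ⟨s.reg 8 + 1, .inr rfl, hb, ?_, rfl, rfl, rfl, ⟨fun r hr => ?_, fun k _ => rfl⟩⟩
      · rintro c' (rfl | rfl) _
        · exact hb'.le
        · exact le_rfl
      · simp at hr
        simp [hr]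
    · simp [ArrOp.test] at hb'
      refine .skip ⟨s.reg 8, .inl rfl, h8, ?_, by simp, by simp, by simp,
        ⟨fun r hr => ?_, fun k _ => rfl⟩⟩
      · rintro c' (rfl | rfl) _
        · exact le_rfl
        · exact hb'
      · simp at hr
        simp [hr]
  · simp [ArrOp.test] at hb
    refine .skip ⟨s.reg 8, .inl rfl, h8, ?_, by simp, by simp, by simp,
        ⟨fun r hr => ?_, fun k _ => rfl⟩⟩
    · rintro c' (rfl | rfl) _
      · exact le_rfl
      · omega
    · simp at hr
      simp [hr]

/-- `d` bounds the remaining depth: a child `c` of `i` satisfies `c + 1 ≥ 2 (i + 1)`, so each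
descent lowers `d` by one. The invariant has two forms: either register `6` is the exceptional
position, or the heap is repaired and register `8` has been set to the heap size to end the loop. -/
theorem sift_ensures {l W : ℕ} (hW : 4 * (l + 2) ≤ W) {s : ArrState} (h3 : s.reg 3 = 1)
    {lo d : ℕ} (h6 : s.reg 6 ≤ l) (h7 : s.reg 7 ≤ l) (hA : ∀ i < s.reg 7, s.arr 1 i < l)
    (hlo : lo ≤ s.reg 6) (hheap : IsHeapExcept (s.arr 0) (s.arr 1) lo (s.reg 7) (s.reg 6))
    (hd : s.reg 7 ≤ (s.reg 6 + 1) * 2 ^ d) :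
    Ensures (ArrOp.run 6 (l + 2) W) ArrOp.test sift s (25 * d + 4) fun s' =>
      s.Frame [6, 8, 9, 10, 11, 12, 13] [1] s' ∧ IsHeap (s.arr 0) (s'.arr 1) lo (s.reg 7) ∧
        SameValues (s.reg 7) (s.arr 1) (s'.arr 1) := by
  have ht : 25 * d + 4 = 2 + (25 * d + 2) := by omega
  rw [ht]
  refine .seq (ensures_block ?_)
  simp only [wp, ArrState.set_reg, h3, reduceIte, Nat.reduceEqDiff]
  refine ⟨by omega, by omega, ?_⟩
  refine .loop (fun st T => s.Frame [6, 8, 9, 10, 11, 12, 13] [1] st ∧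
    SameValues (s.reg 7) (s.arr 1) (st.arr 1) ∧
    ((∃ d, st.reg 8 = 2 * st.reg 6 + 1 ∧ lo ≤ st.reg 6 ∧
      IsHeapExcept (s.arr 0) (st.arr 1) lo (s.reg 7) (st.reg 6) ∧
      s.reg 7 ≤ (st.reg 6 + 1) * 2 ^ d ∧ 25 * d + 2 ≤ T) ∨
      (st.reg 8 = s.reg 7 ∧ IsHeap (s.arr 0) (st.arr 1) lo (s.reg 7) ∧ 2 ≤ T))) ?_ ?_ ?_
  · rintro st T ⟨hF, hS, hI⟩ hb
    simp only [ArrOp.test, decide_eq_true_eq] at hb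
    have f7 : st.reg 7 = s.reg 7 := hF.reg 7 (by simp)
    have f3 : st.reg 3 = 1 := (hF.reg 3 (by simp)).trans h3
    have f0 : st.arr 0 = s.arr 0 := hF.arr 0 (by simp)
    rw [f7] at hb
    rcases hI with ⟨d, h8, hlo, hE, hd, hT⟩ | ⟨h8, -, -⟩
    swap
    · omega
    have hA' : ∀ i < s.reg 7, st.arr 1 i < l := hS.forall_lt (P := (· < l)) hA
    obtain ⟨d, rfl⟩ : ∃ d', d = d' + 1 := by
      cases d with
      | zero => simp at hd; omega
      | succ d => exact ⟨d, rfl⟩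
    refine ⟨21, .seq (T₁ := 12) (T₂ := 9)
      ((siftSelect_ensures hW f3 (by omega) (by omega) (by simpa [f7] using hA')).mono le_rfl ?_)⟩
    rintro s₁ ⟨c, hc, hcs, hmax, e8, e10, e11, hF₁⟩
    rw [f7] at hcs hmax
    rw [h8] at hc
    rw [f0] at hmax e11
    have g6 : s₁.reg 6 = st.reg 6 := hF₁.reg 6 (by simp)
    have g3 : s₁.reg 3 = 1 := (hF₁.reg 3 (by simp)).trans f3
    have g7 : s₁.reg 7 = s.reg 7 := (hF₁.reg 7 (by simp)).trans f7
    have g0 : s₁.arr 0 = s.arr 0 := (hF₁.arr 0 (by simp)).trans f0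
    have g1 : s₁.arr 1 = st.arr 1 := hF₁.arr 1 (by simp)
    have hF' : s.Frame [6, 8, 9, 10, 11, 12, 13] [1] s₁ := hF.trans (hF₁.mono (by simp) (by simp))
    have hi := hA' (st.reg 6) (by omega)
    have hmax' : ∀ c', (c' = 2 * st.reg 6 + 1 ∨ c' = 2 * st.reg 6 + 2) → c' < s.reg 7 →
        s.arr 0 (st.arr 1 c') ≤ s.arr 0 (st.arr 1 c) := fun c' h' => hmax c' (by omega)
    refine .seq (T₁ := 2) (T₂ := 7) (ensures_block ?_)
    simp only [wp, ArrState.set_reg, ArrState.set_arr, reduceIte, g6, g0, g1]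
    refine ⟨by omega, by omega, by omega, by omega, .ite (T := 5) (fun hb' => ?_) fun hb' => ?_⟩
    · simp [ArrOp.test, e11] at hb'
      refine ensures_block ?_
      simp only [wp, ArrState.set_reg, ArrState.set_arr, ArrState.put_reg, ArrState.put_arr,
        reduceIte, Nat.reduceEqDiff, g6, g1, g3, e8, e10]
      refine ⟨by omega, by omega, by omega, by omega, by omega, by omega, 25 * d + 2, by omega,
        ⟨fun r hr => ?_, fun k hk => ?_⟩, ?_, .inl ⟨d, by omega, by omega, ?_, ?_, le_rfl⟩⟩
      · simp only [List.mem_cons, List.not_mem_nil, or_false, not_or] at hr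
        simp only [ArrState.set_reg, ArrState.put_reg, hr, if_false]
        exact hF'.reg r (by simp [hr])
      · simp only [List.mem_cons, List.not_mem_nil, or_false] at hk
        simp only [ArrState.set_arr, ArrState.put_arr, hk, if_false]
        exact hF'.arr k (by simpa using hk)
      · exact hS.trans (SameValues.swap _ (by omega) hcs)
      · exact hE.swap hlo (by omega) hcs hb' hmax'
      · calc s.reg 7 ≤ (st.reg 6 + 1) * 2 ^ (d + 1) := hd
          _ = (2 * (st.reg 6 + 1)) * 2 ^ d := by ring
          _ ≤ (c + 1) * 2 ^ d := Nat.mul_le_mul_right _ (by omega)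
    · simp [ArrOp.test, e11] at hb'
      refine (ensures_block ?_).mono (show 1 ≤ 5 by omega) fun _ h => h
      simp only [wp, ArrState.set_reg, ArrState.set_arr, reduceIte, Nat.reduceEqDiff, g1, g7]
      refine ⟨2, by omega, ⟨fun r hr => ?_, fun k hk => ?_⟩, hS, .inr ⟨trivial, ?_, le_rfl⟩⟩
      · simp only [List.mem_cons, List.not_mem_nil, or_false, not_or] at hr
        simp only [ArrState.set_reg, hr, if_false]
        exact hF'.reg r (by simp [hr])
      · exact hF'.arr k hk
      · exact hE.isHeap fun c' h₁ h₂ => (hmax' c' h₁ h₂).trans hb'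
  · rintro st T ⟨hF, hS, hI⟩ hb
    simp only [ArrOp.test, decide_eq_false_iff_not] at hb
    have f7 : st.reg 7 = s.reg 7 := hF.reg 7 (by simp)
    rcases hI with ⟨d, h8, hlo, hE, hd, hT⟩ | ⟨h8, hH, hT⟩
    · exact ⟨by omega, hF, hE.isHeap fun c h₁ h₂ => by omega, hS⟩
    · exact ⟨hT, hF, hH, hS⟩
  · refine ⟨⟨fun r hr => ?_, fun k _ => rfl⟩, .refl _ _, .inl ⟨d, ?_, hlo, hheap, hd, le_rfl⟩⟩
    · simp only [List.mem_cons, List.not_mem_nil, or_false, not_or] at hr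
      simp [hr]
    · simp; omega

end Heap

/-! ### Numbering the letters by heap sort -/

section Classes

open Cmd ArrOp

/-- Turn the array `1` into a heap of all positions. Registers `2`, `3`, `4`, `5` hold the number of
positions, `1`, `0` and `0`. -/
def buildHeap : Cmd ArrOp (ℕ × ℕ) :=
  .seq (.loop (5, 2) (.block [.store 1 5 5, .add 5 5 3]))
    (.loop (4, 5) (.seq (.block [.sub 5 5 3, .move 6 5, .move 7 2]) sift))

/-- Remove the positions from the heap; the array `2` receives a number for each position, the same
number for positions with the same key. -/
def popClasses : Cmd ArrOp (ℕ × ℕ) :=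
  .seq (.block [.move 7 2, .const 14 0, .load 10 1 4, .load 15 0 10])
    (.loop (4, 7) (.seq (.block [.load 10 1 4, .load 11 0 10])
      (.seq (.ite (11, 15) (.block [.add 14 14 3, .move 15 11]) .skip)
        (.seq (.block [.store 2 10 14, .sub 7 7 3, .load 11 1 7, .store 1 4 11, .const 6 0])
          sift))))

/-- Positions are added to the heap from the last to the first, each by one sift. The clause for `l
= 0` is recorded because `popClasses` reads the root even of an empty heap. -/
theorem buildHeap_ensures {l d W : ℕ} (hW : 4 * (l + 2) ≤ W) (hd : l ≤ 2 ^ d) {s : ArrState}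
    (h2 : s.reg 2 = l) (h3 : s.reg 3 = 1) (h4 : s.reg 4 = 0) (h5 : s.reg 5 = 0) :
    Ensures (ArrOp.run 6 (l + 2) W) ArrOp.test buildHeap s ((25 * d + 13) * l + 4) fun s' =>
      s.Frame [5, 6, 7, 8, 9, 10, 11, 12, 13] [1] s' ∧ IsHeap (s.arr 0) (s'.arr 1) 0 l ∧
        SameValues l (fun i => i) (s'.arr 1) ∧ (l = 0 → s'.arr 1 = s.arr 1) := by
  have ht : (25 * d + 13) * l + 4 = (4 * l + 2) + ((25 * d + 9) * l + 2) := by ring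
  rw [ht]
  refine .seq (.loop (fun st T => s.Frame [5] [1] st ∧ st.reg 5 ≤ l ∧
    (∀ i < st.reg 5, st.arr 1 i = i) ∧ (l = 0 → st.arr 1 = s.arr 1) ∧
    4 * (l - st.reg 5) + 2 ≤ T) ?_ ?_ ?_)
  · rintro st T ⟨hF, h5, hA, -, hT⟩ hb
    have f2 : st.reg 2 = l := (hF.reg 2 (by simp)).trans h2
    have f3 : st.reg 3 = 1 := (hF.reg 3 (by simp)).trans h3
    simp only [ArrOp.test, decide_eq_true_eq, f2] at hb
    refine ⟨2, ensures_block ?_⟩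
    simp only [wp, ArrState.set_reg, ArrState.set_arr, ArrState.put_reg, ArrState.put_arr,
      reduceIte, f3]
    refine ⟨by omega, by omega, by omega, 4 * (l - (st.reg 5 + 1)) + 2, by omega,
      ⟨fun r hr => ?_, fun k hk => ?_⟩, by omega, fun i hi => ?_, by omega,
      le_rfl⟩
    · simp only [List.mem_cons, List.not_mem_nil, or_false] at hr
      simp only [ArrState.set_reg, ArrState.put_reg, hr, if_false]
      exact hF.reg r (by simpa using hr)
    · simp only [List.mem_cons, List.not_mem_nil, or_false] at hk
      simp only [ArrState.set_arr, ArrState.put_arr, hk, if_false]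
      exact hF.arr k (by simpa using hk)
    · rw [Function.update_apply]
      split_ifs with h
      · exact h.symm
      · exact hA i (by omega)
  · rintro st T ⟨hF, h5, hA, h0, hT⟩ hb
    have f2 : st.reg 2 = l := (hF.reg 2 (by simp)).trans h2
    simp only [ArrOp.test, decide_eq_false_iff_not, f2] at hb
    refine ⟨by omega, ?_⟩
    refine .loop (fun st T => s.Frame [5, 6, 7, 8, 9, 10, 11, 12, 13] [1] st ∧ st.reg 5 ≤ l ∧
      IsHeap (s.arr 0) (st.arr 1) (st.reg 5) l ∧ SameValues l (fun i => i) (st.arr 1) ∧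
      (l = 0 → st.arr 1 = s.arr 1) ∧ (25 * d + 9) * st.reg 5 + 2 ≤ T) ?_ ?_ ?_
    · rintro st T ⟨hF, h5, hH, hV, h0, hT⟩ hb
      have f2 : st.reg 2 = l := (hF.reg 2 (by simp)).trans h2
      have f3 : st.reg 3 = 1 := (hF.reg 3 (by simp)).trans h3
      have f4 : st.reg 4 = 0 := (hF.reg 4 (by simp)).trans h4
      have f0 : st.arr 0 = s.arr 0 := hF.arr 0 (by simp)
      simp only [ArrOp.test, decide_eq_true_eq, f4] at hb
      obtain ⟨i, hi⟩ : ∃ i, st.reg 5 = i + 1 := ⟨st.reg 5 - 1, by omega⟩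
      refine ⟨3 + (25 * d + 4), .seq (ensures_block ?_)⟩
      simp only [wp, ArrState.set_reg, reduceIte, Nat.reduceEqDiff, f3, hi, f2,
        Nat.add_sub_cancel]
      refine (sift_ensures (lo := i) (d := d) hW ?_ ?_ ?_ ?_ ?_ ?_ ?_).mono le_rfl ?_
      · simpa using f3
      · simp; omega
      · simp
      · simpa using hV.forall_lt (P := (· < l)) fun i hi => hi
      · simp
      · rw [hi] at hH
        simpa [f0] using hH.isHeapExcept_pred
      · simp only [ArrState.set_reg, reduceIte, Nat.reduceEqDiff]
        exact hd.trans (Nat.le_mul_of_pos_left _ (by omega))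
      · rintro s₁ ⟨hF₁, hH₁, hV₁⟩
        simp only [ArrState.set_reg, ArrState.set_arr, reduceIte, f0] at hH₁ hV₁
        have g5 : s₁.reg 5 = i := by simpa using hF₁.reg 5 (by simp)
        refine ⟨(25 * d + 9) * i + 2, ?_, ⟨fun r hr => ?_, fun k hk => ?_⟩, by omega, ?_,
          hV.trans hV₁, by omega, by rw [g5]⟩
        · rw [hi, mul_add] at hT
          omega
        · simp only [List.mem_cons, List.not_mem_nil, or_false, not_or] at hr
          rw [hF₁.reg r (by simp [hr])]
          simp only [ArrState.set_reg, hr, if_false]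
          exact hF.reg r (by simp [hr])
        · exact (hF₁.arr k hk).trans (hF.arr k hk)
        · rwa [g5]
    · rintro st T ⟨hF, h5, hH, hV, h0, hT⟩ hb
      have f4 : st.reg 4 = 0 := (hF.reg 4 (by simp)).trans h4
      simp only [ArrOp.test, decide_eq_false_iff_not, f4] at hb
      have h5' : st.reg 5 = 0 := by omega
      rw [h5'] at hH
      exact ⟨by omega, hF, hH, hV, h0⟩
    · have h5l : st.reg 5 = l := by omega
      rw [h5l] at hA ⊢
      refine ⟨hF.mono (by simp) (by simp), le_rfl, fun j c hj hc hcl => by omega, fun p => ?_,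
        h0, le_rfl⟩
      constructor
      · rintro ⟨i, hi, rfl⟩
        exact ⟨i, hi, hA i hi⟩
      · rintro ⟨i, hi, rfl⟩
        exact ⟨i, hi, (hA i hi).symm⟩
  · refine ⟨⟨fun _ _ => rfl, fun _ _ => rfl⟩, by omega, fun i hi => by omega, fun _ => rfl, by omega⟩

/-- The invariant of the removal of positions from a heap of size `s`: the entries that have been
removed are classified, the current class is `c` and the current key is `x`. -/
structure IsPartialClass (L A cls : ℕ → ℕ) (l s c x : ℕ) (done : ℕ → Prop) : Prop where
  total : ∀ p < l, done p ∨ ∃ i < s, A i = p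
  key : ∀ p, done p → x ≤ L p ∧ (cls p = c ↔ L p = x) ∧ cls p ≤ c
  rest : ∀ i < s, L (A i) ≤ x
  class_iff : ∀ p q, done p → done q → (cls p = cls q ↔ L p = L q)

/-- Keys leave the heap in nonincreasing order. A root with the current key belongs to the current
class; a strictly smaller one opens a class whose number exceeds all numbers in use, and its key
differs from all removed keys. -/
theorem IsPartialClass.pop {L A cls : ℕ → ℕ} {l s c x : ℕ} {done : ℕ → Prop}
    (h : IsPartialClass L A cls l (s + 1) c x done) (hH : IsHeap L A 0 (s + 1)) {c' : ℕ}
    (hc : L (A 0) = x ∧ c' = c ∨ L (A 0) < x ∧ c' = c + 1) {A' : ℕ → ℕ}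
    (hA' : SameValues s (Function.update A 0 (A s)) A') :
    IsPartialClass L A' (Function.update cls (A 0) c') l s c' (L (A 0))
      (fun p => done p ∨ p = A 0) := by
  have hupd : ∀ p, Function.update cls (A 0) c' p = if p = A 0 then c' else cls p :=
    fun p => Function.update_apply ..
  have hval : ∀ i < s, ∃ j < s + 1, Function.update A 0 (A s) i = A j := by
    intro i hi
    by_cases hi0 : i = 0
    · exact ⟨s, by omega, by simp [hi0]⟩
    · exact ⟨i, by omega, by simp [hi0]⟩
  have hkey : ∀ p, done p → p ≠ A 0 → L (A 0) ≤ L p ∧ (cls p = c' ↔ L p = L (A 0)) ∧ cls p ≤ c' := by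
    intro p hp _
    have := h.key p hp
    rcases hc with ⟨h₁, rfl⟩ | ⟨h₁, rfl⟩
    · rw [h₁]; exact this
    · refine ⟨by omega, ⟨fun h => by omega, fun h => by omega⟩, by omega⟩
  constructor
  · intro p hp
    rcases h.total p hp with hd | ⟨i, hi, rfl⟩
    · exact .inl (.inl hd)
    · by_cases hi0 : i = 0
      · exact .inl (.inr (by rw [hi0]))
      · refine .inr ((hA' _).1 ?_)
        by_cases his : i = s
        · exact ⟨0, by omega, by simp [his]⟩
        · exact ⟨i, by omega, by simp [hi0]⟩
  · intro p hp
    rw [hupd]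
    split_ifs with hpA
    · rw [hpA]
      simp
    · exact hkey p (hp.resolve_right hpA) hpA
  · refine hA'.forall_lt (P := fun y => L y ≤ L (A 0)) fun i hi => ?_
    obtain ⟨j, hj, e⟩ := hval i hi
    rw [e]
    exact hH.le_root j hj
  · intro p q hp hq
    rw [hupd, hupd]
    split_ifs with h₁ h₂ h₂
    · rw [h₁, h₂]; simp
    · rw [h₁]
      have := (hkey q (hq.resolve_right h₂) h₂).2.1
      exact ⟨fun h => (this.1 h.symm).symm, fun h => (this.2 h.symm).symm⟩
    · rw [h₂]
      exact (hkey p (hp.resolve_right h₁) h₁).2.1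
    · exact h.class_iff p q (hp.resolve_right h₁) (hq.resolve_right h₂)

theorem IsHeap.isHeapExcept_pop {L A : ℕ → ℕ} {s v : ℕ} (h : IsHeap L A 0 (s + 1)) :
    IsHeapExcept L (Function.update A 0 v) 0 s 0 := by
  constructor
  · intro j c hj hj0 hc hcs
    rw [Function.update_of_ne (by omega), Function.update_of_ne hj0]
    exact h j c hj hc (by omega)
  · intro j c hj h0
    omega

theorem popClasses_ensures {l d W : ℕ} (hW : 4 * (l + 2) ≤ W) (hd : l ≤ 2 ^ d) {s : ArrState}
    (h2 : s.reg 2 = l) (h3 : s.reg 3 = 1) (h4 : s.reg 4 = 0)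
    (hheap : IsHeap (s.arr 0) (s.arr 1) 0 l) (hval : SameValues l (fun i => i) (s.arr 1))
    (hcls : ∀ i ≤ l, s.arr 2 i ≤ l) (hA0 : s.arr 1 0 ≤ l) :
    Ensures (ArrOp.run 6 (l + 2) W) ArrOp.test popClasses s ((25 * d + 17) * l + 6) fun s' =>
      s.Frame [6, 7, 8, 9, 10, 11, 12, 13, 14, 15] [1, 2] s' ∧ (∀ i ≤ l, s'.arr 2 i ≤ l) ∧
        ∀ p < l, ∀ q < l, (s'.arr 2 p = s'.arr 2 q ↔ s.arr 0 p = s.arr 0 q) := by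
  have ht : (25 * d + 17) * l + 6 = 4 + ((25 * d + 17) * l + 2) := by ring
  rw [ht]
  refine .seq (ensures_block ?_)
  simp only [wp, ArrState.set_reg, ArrState.set_arr, reduceIte, Nat.reduceEqDiff, h2, h4]
  -- The root is used as an index before the heap is tested for emptiness; `hA0` keeps this access
  -- in range when `l = 0`.
  refine ⟨by omega, by omega, by omega, by omega, by omega, ?_⟩
  -- The bound on the sum of registers `14` and `7` says that every new class is paid for by a
  -- removed entry; hence class numbers stay at most `l` and can index arrays.
  refine .loop (fun st T => s.Frame [6, 7, 8, 9, 10, 11, 12, 13, 14, 15] [1, 2] st ∧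
    st.reg 7 ≤ l ∧ st.reg 14 + st.reg 7 ≤ l ∧ (∀ i ≤ l, st.arr 2 i ≤ l) ∧
    (∀ i < st.reg 7, st.arr 1 i < l) ∧ IsHeap (s.arr 0) (st.arr 1) 0 (st.reg 7) ∧
    (∃ done, IsPartialClass (s.arr 0) (st.arr 1) (st.arr 2) l (st.reg 7) (st.reg 14) (st.reg 15)
      done) ∧ (25 * d + 17) * st.reg 7 + 2 ≤ T) ?_ ?_ ?_
  · rintro st T ⟨hF, h7, h14, hcls, hA, hH, ⟨done, hD⟩, hT⟩ hb
    have f2 : st.reg 2 = l := (hF.reg 2 (by simp)).trans h2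
    have f3 : st.reg 3 = 1 := (hF.reg 3 (by simp)).trans h3
    have f4 : st.reg 4 = 0 := (hF.reg 4 (by simp)).trans h4
    have f0 : st.arr 0 = s.arr 0 := hF.arr 0 (by simp)
    simp only [ArrOp.test, decide_eq_true_eq, f4] at hb
    obtain ⟨m, hm⟩ : ∃ m, st.reg 7 = m + 1 := ⟨st.reg 7 - 1, by omega⟩
    rw [hm] at hD hH hA
    have h₀ := hA 0 (by omega)
    have hmA := hA m (by omega)
    have hr := hD.rest 0 (by omega)
    refine ⟨2 + (4 + (5 + (25 * d + 4))), .seq (ensures_block ?_)⟩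
    simp only [wp, ArrState.set_reg, ArrState.set_arr, reduceIte, f4, f0]
    refine ⟨by omega, by omega, by omega, by omega, .seq (.mono (T := 4)
      (Q := fun s₁ => ∃ c', (s.arr 0 (st.arr 1 0) = st.reg 15 ∧ c' = st.reg 14 ∨
        s.arr 0 (st.arr 1 0) < st.reg 15 ∧ c' = st.reg 14 + 1) ∧ s₁.reg 10 = st.arr 1 0 ∧
        s₁.reg 14 = c' ∧ s₁.reg 15 = s.arr 0 (st.arr 1 0) ∧
        st.Frame [10, 11, 14, 15] [] s₁) (.ite (T := 2) (fun hb => ?_) fun hb => ?_) le_rfl ?_)⟩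
    · simp [ArrOp.test] at hb
      refine ensures_block ?_
      simp only [wp, ArrState.set_reg, reduceIte, Nat.reduceEqDiff, f3]
      refine ⟨by omega, st.reg 14 + 1, .inr ⟨hb, rfl⟩, by trivial, by trivial, by trivial, fun r hr => ?_,
        fun k _ => rfl⟩
      simp only [List.mem_cons, List.not_mem_nil, or_false, not_or] at hr
      simp [hr]
    · simp [ArrOp.test] at hb
      refine .skip ⟨st.reg 14, .inl ⟨by omega, rfl⟩, by simp, by simp, ?_, fun r hr => ?_,
        fun k _ => rfl⟩
      · simp; omega
      · simp only [List.mem_cons, List.not_mem_nil, or_false, not_or] at hr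
        simp [hr]
    · rintro s₁ ⟨c', hc', e10, e14, e15, hF₁⟩
      have g3 : s₁.reg 3 = 1 := (hF₁.reg 3 (by simp)).trans f3
      have g4 : s₁.reg 4 = 0 := (hF₁.reg 4 (by simp)).trans f4
      have g7 : s₁.reg 7 = m + 1 := (hF₁.reg 7 (by simp)).trans hm
      have g0 : s₁.arr 0 = s.arr 0 := (hF₁.arr 0 (by simp)).trans f0
      have g1 : s₁.arr 1 = st.arr 1 := hF₁.arr 1 (by simp)
      have g2 : s₁.arr 2 = st.arr 2 := hF₁.arr 2 (by simp)
      have hc'm : c' + m ≤ l := by omega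
      refine .seq (ensures_block ?_)
      simp only [wp, ArrState.set_reg, ArrState.set_arr, ArrState.put_reg, ArrState.put_arr,
        reduceIte, Nat.reduceEqDiff, g3, g4, g7, g1, g2, e10, e14, Nat.add_sub_cancel]
      refine ⟨by omega, by omega, by omega, by omega, by omega, by omega, by omega, ?_⟩
      have hvals : ∀ i < m, Function.update (st.arr 1) 0 (st.arr 1 m) i < l := by
        intro i hi
        rw [Function.update_apply]
        split_ifs
        · exact hmA
        · exact hA i (by omega)
      refine (sift_ensures (lo := 0) (d := d) hW ?_ ?_ ?_ ?_ ?_ ?_ ?_).mono le_rfl ?_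
      · simp [g3]
      · simp
      · simp; omega
      · simpa [g1] using hvals
      · simp
      · simp only [ArrState.set_reg, ArrState.set_arr, ArrState.put_reg, ArrState.put_arr,
          reduceIte, Nat.reduceEqDiff, g0, g1, OfNat.zero_ne_ofNat, zero_ne_one]
        exact hH.isHeapExcept_pop
      · simp only [ArrState.set_reg, ArrState.put_reg, reduceIte, Nat.reduceEqDiff]
        have : 0 < 2 ^ d := by positivity
        omega
      · rintro s₂ ⟨hF₂, hH₂, hV₂⟩
        simp only [ArrState.set_reg, ArrState.set_arr, ArrState.put_reg, ArrState.put_arr,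
          reduceIte, Nat.reduceEqDiff, g0, g1, OfNat.zero_ne_ofNat, zero_ne_one] at hH₂ hV₂
        have k7 : s₂.reg 7 = m := by simpa using hF₂.reg 7 (by simp)
        have k14 : s₂.reg 14 = c' := by simpa [e14] using hF₂.reg 14 (by simp)
        have k15 : s₂.reg 15 = s.arr 0 (st.arr 1 0) := by simpa [e15] using hF₂.reg 15 (by simp)
        have k2 : s₂.arr 2 = Function.update (st.arr 2) (st.arr 1 0) c' := by
          simpa [g2] using hF₂.arr 2 (by simp)
        rw [k7, k14, k15, k2]
        refine ⟨(25 * d + 17) * m + 2, ?_, ⟨fun r hr => ?_, fun k hk => ?_⟩, by omega, by omega,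
          fun i hi => ?_, hV₂.forall_lt (P := (· < l)) hvals, hH₂, ⟨_, hD.pop hH hc' hV₂⟩, le_rfl⟩
        · rw [hm, mul_add] at hT
          omega
        · simp only [List.mem_cons, List.not_mem_nil, or_false, not_or] at hr
          rw [hF₂.reg r (by simp [hr])]
          simp only [ArrState.set_reg, ArrState.put_reg, hr, if_false]
          rw [hF₁.reg r (by simp [hr])]
          exact hF.reg r (by simp [hr])
        · simp only [List.mem_cons, List.not_mem_nil, or_false, not_or] at hk
          rw [hF₂.arr k (by simp [hk])]
          simp only [ArrState.set_arr, ArrState.put_arr, hk, if_false]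
          rw [hF₁.arr k (by simp)]
          exact hF.arr k (by simp [hk])
        · rw [Function.update_apply]
          split_ifs
          · omega
          · exact hcls i hi
  · rintro st T ⟨hF, h7, h14, hcls, hA, hH, ⟨done, hD⟩, hT⟩ hb
    have f4 : st.reg 4 = 0 := (hF.reg 4 (by simp)).trans h4
    simp only [ArrOp.test, decide_eq_false_iff_not, f4] at hb
    have hdone : ∀ p < l, done p := by
      intro p hp
      rcases hD.total p hp with h | ⟨i, hi, -⟩
      · exact h
      · omega
    exact ⟨by omega, hF, hcls, fun p hp q hq => hD.class_iff p q (hdone p hp) (hdone q hq)⟩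
  · simp only [ArrState.set_reg, ArrState.set_arr, reduceIte, Nat.reduceEqDiff]
    refine ⟨⟨fun r hr => ?_, fun k _ => rfl⟩, le_rfl, by omega, hcls,
      hval.forall_lt (P := (· < l)) fun i hi => hi, hheap, ⟨fun _ => False, ?_⟩, le_rfl⟩
    · simp only [List.mem_cons, List.not_mem_nil, or_false, not_or] at hr
      simp [hr]
    · exact ⟨fun p hp => .inr ((hval p).1 ⟨p, hp, rfl⟩), fun _ h => h.elim,
        fun i hi => hheap.le_root i hi, fun _ _ h => h.elim⟩

end Classes

/-! ### Embedding all short subwords in linear time -/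

section Scan

open Cmd ArrOp

/-- The entry of `cur` at the class of a letter is the next position of the letter in `v` after the
position `F`; letters are given by their positions `p < l` in the sequence `L`. -/
def IsNext (l : ℕ) (L cls cur : ℕ → ℕ) (v : List ℕ) (F : ℕ) : Prop :=
  ∀ p < l, cur (cls p) = nextPos v (L p) F

/-- The entries of `nxt` link each position of `v` to the next position of the same letter. -/
structure IsLink (nxt : ℕ → ℕ) (v : List ℕ) : Prop where
  link : ∀ j, ∀ h : j < v.length, nxt (j + 1) = nextPos v v[j] (j + 1)
  last : nxt (v.length + 1) = v.length + 1

/-- The numbers `cls` distinguish the letters at the positions `p < l` of the sequence `L`, and `v`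
is a factor of this sequence that starts at the position `o`. -/
structure IsFactor (l : ℕ) (L cls : ℕ → ℕ) (o : ℕ) (v : List ℕ) : Prop where
  le : o + v.length ≤ l
  eq : ∀ j, ∀ h : j < v.length, L (o + j) = v[j]
  cls_le : ∀ i ≤ l, cls i ≤ l
  cls_iff : ∀ p < l, ∀ q < l, (cls p = cls q ↔ L p = L q)

/-- Moving the reference point back across the position `j + 1` affects only the letter standing
there, whose next position becomes `j + 1`. -/
theorem IsNext.pred {l o : ℕ} {L cls cur : ℕ → ℕ} {v : List ℕ} (hv : IsFactor l L cls o v) {j : ℕ}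
    (hj : j < v.length) (h : IsNext l L cls cur v (j + 1)) :
    IsNext l L cls (Function.update cur (cls (o + j)) (j + 1)) v j := by
  intro p hp
  have := hv.le
  have hiff := hv.cls_iff p hp (o + j) (by omega)
  rw [hv.eq j hj] at hiff
  rw [Function.update_apply, nextPos_of_lt _ hj]
  by_cases hc : cls p = cls (o + j)
  · rw [if_pos hc, if_pos (hiff.1 hc).symm]
  · rw [if_neg hc, if_neg fun h' => hc (hiff.2 h'.symm), h p hp]

/-- Moving the reference point across `F + 1` affects only the letter standing there, and its link
gives the new value. At `F = |v|` the class that is read is irrelevant: all next positions, and the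
link, equal `|v| + 1`. -/
theorem IsNext.succ {l o : ℕ} {L cls cur nxt : ℕ → ℕ} {v : List ℕ} (hv : IsFactor l L cls o v)
    (hn : IsLink nxt v) {F : ℕ} (hF : F ≤ v.length) (h : IsNext l L cls cur v F) :
    IsNext l L cls (Function.update cur (cls (o + F)) (nxt (F + 1))) v (F + 1) := by
  intro p hp
  rw [Function.update_apply]
  have := hv.le
  rcases Nat.lt_or_ge F v.length with hF' | hF'
  · have hiff := hv.cls_iff p hp (o + F) (by omega)
    rw [hv.eq F hF'] at hiff
    have h' := h p hp
    rw [nextPos_of_lt _ hF'] at h'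
    by_cases hc : cls p = cls (o + F)
    · rw [if_pos hc, hn.link F hF', hiff.1 hc]
    · rw [if_neg hc, h', if_neg fun h' => hc (hiff.2 h'.symm)]
  · obtain rfl : F = v.length := by omega
    rw [nextPos_of_le _ (by omega), hn.last, h p hp, nextPos_of_le _ le_rfl, ite_self]

/-- Compute the links of `v` in the array `3` and the first positions of all letters in `v` in the
array `4`. Registers `22` and `23` hold the start and the length of `v`. -/
def scanBack : Cmd ArrOp (ℕ × ℕ) :=
  .seq (.block [.add 27 23 3, .const 16 0, .add 17 2 3])
    (.seq (.loop (16, 17) (.block [.store 4 16 27, .add 16 16 3]))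
      (.seq (.block [.store 3 27 27, .move 28 23])
        (.loop (4, 28) (.block [.add 18 22 28, .sub 18 18 3, .load 19 2 18, .load 29 4 19,
          .store 3 28 29, .store 4 19 28, .sub 28 28 3]))))

/-- One round of the computation of `front`: the array `5` contains the values of `front` for some
`k` and receives those for `k + 1`. Registers `20` and `21` hold the start and the length of `u`. -/
def scanForward : Cmd ArrOp (ℕ × ℕ) :=
  .seq (.block [.const 30 0, .const 31 0, .load 32 5 4, .const 33 0])
    (.loop (33, 21)
      (.seq (.loop (30, 32) (.block [.add 30 30 3, .add 18 22 30, .sub 18 18 3, .load 19 2 18,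
          .load 29 3 30, .store 4 19 29]))
        (.seq (.block [.add 18 20 33, .load 19 2 18, .load 29 4 19])
          (.seq (.ite (31, 29) (.block [.move 31 29]) .skip)
            (.block [.add 33 33 3, .load 32 5 33, .store 5 33 31])))))

/-- On the way back through `v`, the table entry of a letter just before it is overwritten is the
next position of that letter; this is the value saved as a link. -/
theorem scanBack_ensures {l W : ℕ} (hW : 4 * (l + 2) ≤ W) {s : ArrState} {v : List ℕ}
    (h2 : s.reg 2 = l) (h3 : s.reg 3 = 1) (h4 : s.reg 4 = 0)
    (hv : IsFactor l (s.arr 0) (s.arr 2) (s.reg 22) v) (h23 : s.reg 23 = v.length) :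
    Ensures (ArrOp.run 6 (l + 2) W) ArrOp.test scanBack s (13 * l + 13) fun s' =>
      s.Frame [16, 17, 18, 19, 27, 28, 29] [3, 4] s' ∧
        IsNext l (s.arr 0) (s.arr 2) (s'.arr 4) v 0 ∧ IsLink (s'.arr 3) v := by
  have hle := hv.le
  have ht : 13 * l + 13 = 3 + ((4 * (l + 1) + 2) + (2 + (9 * l + 2))) := by ring
  rw [ht]
  refine .seq (ensures_block ?_)
  simp only [wp, ArrState.set_reg, reduceIte, Nat.reduceEqDiff, h2, h3, h23]
  refine ⟨by omega, by omega, by omega, ?_⟩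
  refine .seq (.loop (fun st T => s.Frame [16, 17, 18, 19, 27, 28, 29] [3, 4] st ∧
    st.reg 17 = l + 1 ∧ st.reg 27 = v.length + 1 ∧ st.reg 16 ≤ l + 1 ∧
    (∀ i < st.reg 16, st.arr 4 i = v.length + 1) ∧ 4 * (l + 1 - st.reg 16) + 2 ≤ T) ?_ ?_ ?_)
  · rintro st T ⟨hF, h17, h27, h16, hA, hT⟩ hb
    have f3 : st.reg 3 = 1 := (hF.reg 3 (by simp)).trans h3
    simp only [ArrOp.test, decide_eq_true_eq, h17] at hb
    refine ⟨2, ensures_block ?_⟩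
    simp only [wp, ArrState.set_reg, ArrState.set_arr, ArrState.put_reg, ArrState.put_arr,
      reduceIte, Nat.reduceEqDiff, f3, h17, h27]
    refine ⟨by omega, by omega, by omega, 4 * (l + 1 - (st.reg 16 + 1)) + 2, by omega,
      ⟨fun r hr => ?_, fun k hk => ?_⟩, by trivial, by trivial, by omega, fun i hi => ?_, le_rfl⟩
    · simp only [List.mem_cons, List.not_mem_nil, or_false, not_or] at hr
      simp only [ArrState.set_reg, ArrState.put_reg, hr, if_false]
      exact hF.reg r (by simp [hr])
    · simp only [List.mem_cons, List.not_mem_nil, or_false, not_or] at hk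
      simp only [ArrState.set_arr, ArrState.put_arr, hk, if_false]
      exact hF.arr k (by simp [hk])
    · rw [Function.update_apply]
      split_ifs with h
      · rfl
      · exact hA i (by omega)
  · rintro st T ⟨hF, h17, h27, h16, hA, hT⟩ hb
    simp only [ArrOp.test, decide_eq_false_iff_not, h17] at hb
    refine ⟨by omega, .seq (ensures_block ?_)⟩
    have f23 : st.reg 23 = v.length := (hF.reg 23 (by simp)).trans h23
    simp only [wp, ArrState.put_reg, h27, f23]
    refine ⟨by omega, by omega, ?_⟩
    refine .loop (fun st T => s.Frame [16, 17, 18, 19, 27, 28, 29] [3, 4] st ∧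
      st.reg 28 ≤ v.length ∧ IsNext l (s.arr 0) (s.arr 2) (st.arr 4) v (st.reg 28) ∧
      st.arr 3 (v.length + 1) = v.length + 1 ∧
      (∀ j, ∀ h : j < v.length, st.reg 28 ≤ j → st.arr 3 (j + 1) = nextPos v v[j] (j + 1)) ∧
      9 * st.reg 28 + 2 ≤ T) ?_ ?_ ?_
    · rintro st T ⟨hF, h28, hN, hlast, hlink, hT⟩ hb
      have f3 : st.reg 3 = 1 := (hF.reg 3 (by simp)).trans h3
      have f4 : st.reg 4 = 0 := (hF.reg 4 (by simp)).trans h4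
      have f22 : st.reg 22 = s.reg 22 := hF.reg 22 (by simp)
      have f2 : st.arr 2 = s.arr 2 := hF.arr 2 (by simp)
      simp only [ArrOp.test, decide_eq_true_eq, f4] at hb
      obtain ⟨j, hj⟩ : ∃ j, st.reg 28 = j + 1 := ⟨st.reg 28 - 1, by omega⟩
      have hjv : j < v.length := by omega
      have hcls := hv.cls_le (s.reg 22 + j) (by omega)
      rw [hj] at hN hlink
      refine ⟨7, ensures_block ?_⟩
      simp only [wp, ArrState.set_reg, ArrState.set_arr, ArrState.put_reg, ArrState.put_arr,
        reduceIte, Nat.reduceEqDiff, f3, f22, hj, f2, ← Nat.add_assoc, Nat.add_sub_cancel]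
      refine ⟨by omega, by omega, by omega, by omega, by omega, by omega, by omega, by omega,
        by omega, 9 * j + 2, by omega, ⟨fun r hr => ?_, fun k hk => ?_⟩, by omega, hN.pred hv hjv,
        ?_, fun i hi hji => ?_, le_rfl⟩
      · simp only [List.mem_cons, List.not_mem_nil, or_false, not_or] at hr
        simp only [ArrState.set_reg, ArrState.put_reg, hr, if_false]
        exact hF.reg r (by simp [hr])
      · simp only [List.mem_cons, List.not_mem_nil, or_false, not_or] at hk
        simp only [ArrState.set_arr, ArrState.put_arr, hk, if_false]
        exact hF.arr k (by simp [hk])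
      · rw [Function.update_of_ne (by omega), hlast]
      · rw [Function.update_apply]
        split_ifs with h
        · obtain rfl : i = j := by omega
          rw [hN _ (by omega), hv.eq i hi]
        · exact hlink i hi (by omega)
    · rintro st T ⟨hF, h28, hN, hlast, hlink, hT⟩ hb
      have f4 : st.reg 4 = 0 := (hF.reg 4 (by simp)).trans h4
      simp only [ArrOp.test, decide_eq_false_iff_not, f4] at hb
      have h0 : st.reg 28 = 0 := by omega
      rw [h0] at hN hlink
      exact ⟨by omega, hF, hN, ⟨fun j hj => hlink j hj (Nat.zero_le _), hlast⟩⟩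
    · simp only [ArrState.set_reg, ArrState.set_arr, ArrState.put_reg, ArrState.put_arr, reduceIte,
        Nat.reduceEqDiff]
      refine ⟨⟨fun r hr => ?_, fun k hk => ?_⟩, by trivial, fun p hp => ?_,
        Function.update_self .., fun j hj h => by omega, by omega⟩
      · simp only [List.mem_cons, List.not_mem_nil, or_false, not_or] at hr
        simp only [ArrState.set_reg, ArrState.put_reg, hr, if_false]
        exact hF.reg r (by simp [hr])
      · simp only [List.mem_cons, List.not_mem_nil, or_false, not_or] at hk
        simp only [ArrState.set_arr, ArrState.put_arr, hk, if_false]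
        exact hF.arr k (by simp [hk])
      · have := hv.cls_le p hp.le
        rw [nextPos_of_le _ le_rfl, hA _ (by omega)]
  · simp only [ArrState.set_reg, ArrState.set_arr, reduceIte, Nat.reduceEqDiff]
    refine ⟨⟨fun r hr => ?_, fun k hk => rfl⟩, by trivial, by trivial, by omega,
      fun i hi => by omega, by omega⟩
    simp only [List.mem_cons, List.not_mem_nil, or_false, not_or] at hr
    simp only [ArrState.set_reg, hr, if_false]

/-- Linear time is an amortised bound. Register `30`, the reference point of the table, follows the
values `front u v k i`, which are nondecreasing in `i`, and never turns back; all inner loops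
together make at most `|v| + 1` rounds. The budget charges `15` for each letter of `u` and `8` for
each advance. -/
theorem scanForward_ensures {l W : ℕ} (hW : 4 * (l + 2) ≤ W) {s : ArrState} {u v : List ℕ} {k : ℕ}
    (h3 : s.reg 3 = 1) (h4 : s.reg 4 = 0)
    (hv : IsFactor l (s.arr 0) (s.arr 2) (s.reg 22) v) (h23 : s.reg 23 = v.length)
    (hu : IsFactor l (s.arr 0) (s.arr 2) (s.reg 20) u) (h21 : s.reg 21 = u.length)
    (hN : IsNext l (s.arr 0) (s.arr 2) (s.arr 4) v 0) (hL : IsLink (s.arr 3) v)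
    (hG : ∀ j ≤ u.length, s.arr 5 j = front u v k j) :
    Ensures (ArrOp.run 6 (l + 2) W) ArrOp.test scanForward s (23 * l + 14) fun s' =>
      s.Frame [18, 19, 29, 30, 31, 32, 33] [4, 5] s' ∧
        ∀ j ≤ u.length, s'.arr 5 j = front u v (k + 1) j := by
  have hle := hv.le
  have hle' := hu.le
  have ht : 23 * l + 14 = 4 + (15 * l + 8 * (l + 1) + 2) := by ring
  rw [ht]
  refine .seq (ensures_block ?_)
  simp only [wp, ArrState.set_reg, ArrState.set_arr, reduceIte, Nat.reduceEqDiff, h4]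
  refine ⟨by omega, by omega, by omega, by omega, by omega, ?_⟩
  refine .loop (fun st T => s.Frame [18, 19, 29, 30, 31, 32, 33] [4, 5] st ∧
    st.reg 33 ≤ u.length ∧ st.reg 30 ≤ st.reg 32 ∧ st.reg 32 = front u v k (st.reg 33) ∧
    st.reg 31 = front u v (k + 1) (st.reg 33) ∧
    IsNext l (s.arr 0) (s.arr 2) (st.arr 4) v (st.reg 30) ∧
    (∀ j ≤ st.reg 33, st.arr 5 j = front u v (k + 1) j) ∧
    (∀ j ≤ u.length, st.reg 33 < j → st.arr 5 j = front u v k j) ∧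
    15 * (u.length - st.reg 33) + 8 * (v.length + 1 - st.reg 30) + 2 ≤ T) ?_ ?_ ?_
  · rintro st T ⟨hF, h33, h30, h32, h31, hN, hG₁, hG₂, hT⟩ hb
    have f21 : st.reg 21 = u.length := (hF.reg 21 (by simp)).trans h21
    simp only [ArrOp.test, decide_eq_true_eq, f21] at hb
    have hfr := front_le u v k (st.reg 33)
    have hfr' := front_le u v (k + 1) (st.reg 33)
    have hD : ∃ D, D = 8 * (st.reg 32 - st.reg 30) := ⟨_, rfl⟩
    obtain ⟨D, hD⟩ := hD
    refine ⟨(D + 2) + (3 + (3 + 3)), .seq ((Ensures.loop (fun st' T => st.Frame [18, 19, 29, 30] [4] st' ∧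
      st'.reg 30 ≤ st.reg 32 ∧ IsNext l (s.arr 0) (s.arr 2) (st'.arr 4) v (st'.reg 30) ∧
      8 * (st.reg 32 - st'.reg 30) + 2 ≤ T) (Q := fun st' => st.Frame [18, 19, 29, 30] [4] st' ∧
      st'.reg 30 = st.reg 32 ∧ IsNext l (s.arr 0) (s.arr 2) (st'.arr 4) v (st'.reg 30))
      ?_ ?_ ?_).mono le_rfl ?_)⟩
    · rintro s₁ T₁ ⟨hF₁, e30, hN₁, hT₁⟩ hb₁
      have g32 : s₁.reg 32 = st.reg 32 := hF₁.reg 32 (by simp)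
      have g22 : s₁.reg 22 = s.reg 22 := (hF₁.reg 22 (by simp)).trans (hF.reg 22 (by simp))
      have g3 : s₁.reg 3 = 1 := (hF₁.reg 3 (by simp)).trans ((hF.reg 3 (by simp)).trans h3)
      have g2 : s₁.arr 2 = s.arr 2 := (hF₁.arr 2 (by simp)).trans (hF.arr 2 (by simp))
      have g33 : s₁.arr 3 = s.arr 3 := (hF₁.arr 3 (by simp)).trans (hF.arr 3 (by simp))
      simp only [ArrOp.test, decide_eq_true_eq, g32] at hb₁
      -- The reference point may equal `|v|`, so the index can be `l`, one past the last letter;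
      -- `cls_le` includes this index.
      have hcls := hv.cls_le (s.reg 22 + s₁.reg 30) (by omega)
      refine ⟨6, ensures_block ?_⟩
      simp only [wp, ArrState.set_reg, ArrState.set_arr, ArrState.put_reg, ArrState.put_arr,
        reduceIte, Nat.reduceEqDiff, g3, g22, g2, g33, ← Nat.add_assoc, Nat.add_sub_cancel]
      refine ⟨by omega, by omega, by omega, by omega, by omega, by omega, by omega, by omega,
        8 * (st.reg 32 - (s₁.reg 30 + 1)) + 2, by omega, ⟨fun r hr => ?_, fun k hk => ?_⟩, by omega,
        hN₁.succ hv hL (by omega), le_rfl⟩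
      · simp only [List.mem_cons, List.not_mem_nil, or_false, not_or] at hr
        simp only [ArrState.set_reg, ArrState.put_reg, hr, if_false]
        exact hF₁.reg r (by simp [hr])
      · simp only [List.mem_cons, List.not_mem_nil, or_false] at hk
        simp only [ArrState.set_arr, ArrState.put_arr, hk, if_false]
        exact hF₁.arr k (by simp [hk])
    · rintro s₁ T₁ ⟨hF₁, e30, hN₁, hT₁⟩ hb₁
      have g32 : s₁.reg 32 = st.reg 32 := hF₁.reg 32 (by simp)
      simp only [ArrOp.test, decide_eq_false_iff_not, g32] at hb₁
      exact ⟨by omega, hF₁, by omega, hN₁⟩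
    · exact ⟨⟨fun _ _ => rfl, fun _ _ => rfl⟩, h30, hN, by omega⟩
    · rintro s₁ ⟨hF₁, e30, hN₁⟩
      have hF' : s.Frame [18, 19, 29, 30, 31, 32, 33] [4, 5] s₁ :=
        hF.trans (hF₁.mono (by simp) (by simp))
      have g3 : s₁.reg 3 = 1 := (hF'.reg 3 (by simp)).trans h3
      have g20 : s₁.reg 20 = s.reg 20 := hF'.reg 20 (by simp)
      have g31 : s₁.reg 31 = st.reg 31 := hF₁.reg 31 (by simp)
      have g33 : s₁.reg 33 = st.reg 33 := hF₁.reg 33 (by simp)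
      have g2 : s₁.arr 2 = s.arr 2 := hF'.arr 2 (by simp)
      have g5 : s₁.arr 5 = st.arr 5 := hF₁.arr 5 (by simp)
      have hcls := hv.cls_le (s.reg 20 + st.reg 33) (by omega)
      have htarget : s₁.arr 4 (s.arr 2 (s.reg 20 + st.reg 33)) =
          nextPos v (u.getD (st.reg 33) 0) (front u v k (st.reg 33)) := by
        rw [hN₁ _ (by omega), hu.eq _ hb, e30, h32, List.getD_eq_getElem _ _ hb]
      refine .seq (ensures_block ?_)
      simp only [wp, ArrState.set_reg, ArrState.set_arr, reduceIte, g20, g33, g2]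
      refine ⟨by omega, by omega, by omega, by omega, by omega, ?_⟩
      rw [htarget]
      refine .seq (.mono (T := 3) (Q := fun s₂ => s₂.reg 31 = front u v (k + 1) (st.reg 33 + 1) ∧
        s₁.Frame [18, 19, 29, 31] [] s₂) (.ite (T := 1) (fun hb => ?_) fun hb => ?_) le_rfl ?_)
      · simp only [ArrOp.test, decide_eq_true_eq, ArrState.set_reg, reduceIte, Nat.reduceEqDiff] at hb
        refine ensures_block ?_
        simp only [wp, ArrState.set_reg, reduceIte]
        refine ⟨?_, fun r hr => ?_, fun _ _ => rfl⟩
        · rw [front, max_eq_right]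
          omega
        · simp only [List.mem_cons, List.not_mem_nil, or_false, not_or] at hr
          simp only [ArrState.set_reg, hr, if_false]
      · simp only [ArrOp.test, decide_eq_false_iff_not, ArrState.set_reg, reduceIte,
          Nat.reduceEqDiff] at hb
        refine .skip ⟨?_, fun r hr => ?_, fun _ _ => rfl⟩
        · rw [front, max_eq_left]
          · simp; omega
          · omega
        · simp only [List.mem_cons, List.not_mem_nil, or_false, not_or] at hr
          simp only [ArrState.set_reg, hr, if_false]
      · rintro s₂ ⟨k31, hF₂⟩
        have k3 : s₂.reg 3 = 1 := (hF₂.reg 3 (by simp)).trans g3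
        have k30 : s₂.reg 30 = st.reg 32 := (hF₂.reg 30 (by simp)).trans e30
        have k33 : s₂.reg 33 = st.reg 33 := (hF₂.reg 33 (by simp)).trans g33
        have k4 : s₂.arr 4 = s₁.arr 4 := hF₂.arr 4 (by simp)
        have k5 : s₂.arr 5 = st.arr 5 := (hF₂.arr 5 (by simp)).trans g5
        refine ensures_block ?_
        simp only [wp, ArrState.set_reg, ArrState.set_arr, ArrState.put_reg, ArrState.put_arr,
          reduceIte, Nat.reduceEqDiff, k3, k30, k33, k31, k4, k5]
        have hm := front_mono_right u v k (st.reg 33)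
        -- The array `5` is rewritten in place: the level `k` value at the next index is fetched
        -- just before the level `k + 1` value replaces it.
        have hG' := hG₂ (st.reg 33 + 1) (by omega) (by omega)
        rw [e30] at hN₁
        refine ⟨by omega, by omega, by omega, by omega, by omega,
          15 * (u.length - (st.reg 33 + 1)) + 8 * (v.length + 1 - st.reg 32) + 2, by omega,
          ⟨fun r hr => ?_, fun k hk => ?_⟩, by omega, by omega, hG', by trivial, hN₁,
          fun j hj => ?_, fun j hj hj' => ?_, le_rfl⟩
        · simp only [List.mem_cons, List.not_mem_nil, or_false, not_or] at hr
          simp only [ArrState.set_reg, ArrState.put_reg, hr, if_false]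
          rw [hF₂.reg r (by simp [hr])]
          exact hF'.reg r (by simp [hr])
        · simp only [List.mem_cons, List.not_mem_nil, or_false, not_or] at hk
          simp only [ArrState.set_arr, ArrState.put_arr, hk, if_false]
          rw [hF₂.arr k (by simp)]
          exact hF'.arr k (by simp [hk])
        · rw [Function.update_apply]
          split_ifs with h
          · rw [h]
          · exact hG₁ j (by omega)
        · rw [Function.update_of_ne (by omega)]
          exact hG₂ j hj (by omega)
  · rintro st T ⟨hF, h33, h30, h32, h31, hN, hG₁, hG₂, hT⟩ hb
    have f21 : st.reg 21 = u.length := (hF.reg 21 (by simp)).trans h21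
    simp only [ArrOp.test, decide_eq_false_iff_not, f21] at hb
    exact ⟨by omega, hF, fun j hj => hG₁ j (by omega)⟩
  · simp only [ArrState.set_reg, ArrState.set_arr, reduceIte, Nat.reduceEqDiff]
    refine ⟨⟨fun r hr => ?_, fun k hk => rfl⟩, by omega, by omega, hG 0 (by omega),
      (front_zero_right ..).symm, hN, fun j hj => ?_, fun j hj _ => hG j hj, by omega⟩
    · simp only [List.mem_cons, List.not_mem_nil, or_false, not_or] at hr
      simp only [ArrState.set_reg, hr, if_false]
    · obtain rfl : j = 0 := by omega
      rw [hG 0 (by omega), front_zero_right, front_zero_right]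

end Scan

/-! ### The linearithmic decision procedure -/

section RamMain

open Cmd ArrOp

/-- Add `1` to register `24` unless all subwords of `u` of length at most `n` are subwords of `v`.
The registers `20` to `23` hold the starts and the lengths of `u` and `v`. -/
def embedTest (n : ℕ) : Cmd ArrOp (ℕ × ℕ) :=
  .seq (.block [.const 16 0, .add 17 21 3])
    (.seq (.loop (16, 17) (.block [.store 5 16 4, .add 16 16 3]))
      (.seq (.block [.const 25 0, .const 26 n])
        (.seq (.loop (25, 26) (.seq scanBack (.seq scanForward (.block [.add 25 25 3]))))
          (.seq (.block [.load 29 5 21]) (.ite (23, 29) (.block [.add 24 24 3]) .skip)))))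

/-- The array of zeros is `front` at level `0`, and each of the `n` rounds raises the level by one.
The next positions are recomputed in every round because the forward scan uses them up. -/
theorem embedTest_ensures {l W n : ℕ} (hW : (n + 4) * (l + 2) ≤ W) {s : ArrState} {u v : List ℕ}
    (h2 : s.reg 2 = l) (h3 : s.reg 3 = 1) (h4 : s.reg 4 = 0)
    (hv : IsFactor l (s.arr 0) (s.arr 2) (s.reg 22) v) (h23 : s.reg 23 = v.length)
    (hu : IsFactor l (s.arr 0) (s.arr 2) (s.reg 20) u) (h21 : s.reg 21 = u.length)
    (h24 : s.reg 24 ≤ 1) :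
    Ensures (ArrOp.run 6 (l + 2) W) ArrOp.test (embedTest n) s ((36 * l + 32) * n + 4 * l + 16)
      fun s' => s.Frame [16, 17, 18, 19, 24, 25, 26, 27, 28, 29, 30, 31, 32, 33] [3, 4, 5] s' ∧
        s'.reg 24 = s.reg 24 + if front u v n u.length ≤ v.length then 0 else 1 := by
  have hW' : n + 4 * (l + 2) ≤ W := by
    rw [add_mul] at hW
    have : n * 1 ≤ n * (l + 2) := Nat.mul_le_mul_left _ (by omega)
    omega
  have hle := hu.le
  have ht : (36 * l + 32) * n + 4 * l + 16 =
      2 + ((4 * (l + 1) + 2) + (2 + (((36 * l + 32) * n + 2) + (1 + (1 + 2))))) := by ring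
  rw [ht]
  refine .seq (ensures_block ?_)
  simp only [wp, ArrState.set_reg, reduceIte, Nat.reduceEqDiff, h3, h21]
  refine ⟨by omega, by omega, ?_⟩
  refine .seq (.loop (fun st T => s.Frame [16, 17] [5] st ∧ st.reg 17 = u.length + 1 ∧
    st.reg 16 ≤ u.length + 1 ∧ (∀ i < st.reg 16, st.arr 5 i = 0) ∧
    4 * (u.length + 1 - st.reg 16) + 2 ≤ T) ?_ ?_ ?_)
  · rintro st T ⟨hF, h17, h16, hA, hT⟩ hb
    have f3 : st.reg 3 = 1 := (hF.reg 3 (by simp)).trans h3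
    have f4 : st.reg 4 = 0 := (hF.reg 4 (by simp)).trans h4
    simp only [ArrOp.test, decide_eq_true_eq, h17] at hb
    refine ⟨2, ensures_block ?_⟩
    simp only [wp, ArrState.set_reg, ArrState.set_arr, ArrState.put_reg, ArrState.put_arr,
      reduceIte, Nat.reduceEqDiff, f3, f4, h17]
    refine ⟨by omega, by omega, by omega, 4 * (u.length + 1 - (st.reg 16 + 1)) + 2, by omega,
      ⟨fun r hr => ?_, fun k hk => ?_⟩, by trivial, by omega, fun i hi => ?_, le_rfl⟩
    · simp only [List.mem_cons, List.not_mem_nil, or_false, not_or] at hr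
      simp only [ArrState.set_reg, ArrState.put_reg, hr, if_false]
      exact hF.reg r (by simp [hr])
    · simp only [List.mem_cons, List.not_mem_nil, or_false] at hk
      simp only [ArrState.set_arr, ArrState.put_arr, hk, if_false]
      exact hF.arr k (by simp [hk])
    · rw [Function.update_apply]
      split_ifs with h
      · rfl
      · exact hA i (by omega)
  · rintro st T ⟨hF, h17, h16, hA, hT⟩ hb
    simp only [ArrOp.test, decide_eq_false_iff_not, h17] at hb
    refine ⟨by omega, .seq (ensures_block ?_)⟩
    simp only [wp]
    refine ⟨by omega, by omega, .seq (.mono (T := (36 * l + 32) * n + 2) (.loop (fun st T =>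
      s.Frame [16, 17, 18, 19, 25, 26, 27, 28, 29, 30, 31, 32, 33] [3, 4, 5] st ∧
      st.reg 26 = n ∧ st.reg 25 ≤ n ∧ (∀ j ≤ u.length, st.arr 5 j = front u v (st.reg 25) j) ∧
      (36 * l + 32) * (n - st.reg 25) + 2 ≤ T) (Q := fun st =>
      s.Frame [16, 17, 18, 19, 25, 26, 27, 28, 29, 30, 31, 32, 33] [3, 4, 5] st ∧
      ∀ j ≤ u.length, st.arr 5 j = front u v n j) ?_ ?_ ?_) le_rfl ?_)⟩
    · rintro st T ⟨hF, h26, h25, hG, hT⟩ hb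
      have f2 : st.reg 2 = l := (hF.reg 2 (by simp)).trans h2
      have f3 : st.reg 3 = 1 := (hF.reg 3 (by simp)).trans h3
      have f4 : st.reg 4 = 0 := (hF.reg 4 (by simp)).trans h4
      have f0 : st.arr 0 = s.arr 0 := hF.arr 0 (by simp)
      have fc : st.arr 2 = s.arr 2 := hF.arr 2 (by simp)
      have f20 : st.reg 20 = s.reg 20 := hF.reg 20 (by simp)
      have f21 : st.reg 21 = u.length := (hF.reg 21 (by simp)).trans h21
      have f22 : st.reg 22 = s.reg 22 := hF.reg 22 (by simp)
      have f23 : st.reg 23 = v.length := (hF.reg 23 (by simp)).trans h23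
      simp only [ArrOp.test, decide_eq_true_eq, h26] at hb
      refine ⟨(13 * l + 13) + ((23 * l + 14) + 1), .seq ((scanBack_ensures (by omega) f2 f3 f4
        (by rwa [f0, fc, f22]) f23).mono le_rfl ?_)⟩
      rintro s₁ ⟨hF₁, hN, hL⟩
      have g3 : s₁.reg 3 = 1 := (hF₁.reg 3 (by simp)).trans f3
      have g4 : s₁.reg 4 = 0 := (hF₁.reg 4 (by simp)).trans f4
      have g0 : s₁.arr 0 = s.arr 0 := (hF₁.arr 0 (by simp)).trans f0
      have gc : s₁.arr 2 = s.arr 2 := (hF₁.arr 2 (by simp)).trans fc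
      have g5 : s₁.arr 5 = st.arr 5 := hF₁.arr 5 (by simp)
      have g20 : s₁.reg 20 = s.reg 20 := (hF₁.reg 20 (by simp)).trans f20
      have g21 : s₁.reg 21 = u.length := (hF₁.reg 21 (by simp)).trans f21
      have g22 : s₁.reg 22 = s.reg 22 := (hF₁.reg 22 (by simp)).trans f22
      have g23 : s₁.reg 23 = v.length := (hF₁.reg 23 (by simp)).trans f23
      refine .seq ((scanForward_ensures (by omega) g3 g4 (by rwa [g0, gc, g22]) g23
        (by rwa [g0, gc, g20]) g21 (by rwa [g0, gc, ← f0, ← fc]) hL (by rwa [g5])).mono le_rfl ?_)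
      rintro s₂ ⟨hF₂, hG'⟩
      have k3 : s₂.reg 3 = 1 := (hF₂.reg 3 (by simp)).trans g3
      have k25 : s₂.reg 25 = st.reg 25 := (hF₂.reg 25 (by simp)).trans (hF₁.reg 25 (by simp))
      have k26 : s₂.reg 26 = n :=
        ((hF₂.reg 26 (by simp)).trans (hF₁.reg 26 (by simp))).trans h26
      refine ensures_block ?_
      simp only [wp, ArrState.set_reg, ArrState.set_arr, reduceIte, Nat.reduceEqDiff, k3, k25, k26]
      refine ⟨by omega, (36 * l + 32) * (n - (st.reg 25 + 1)) + 2, ?_, ⟨fun r hr => ?_,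
        fun k hk => ?_⟩, by trivial, by omega, hG', le_rfl⟩
      · obtain ⟨m, hm⟩ : ∃ m, n - st.reg 25 = m + 1 := ⟨n - st.reg 25 - 1, by omega⟩
        rw [show n - (st.reg 25 + 1) = m by omega]
        rw [hm, mul_add] at hT
        omega
      · simp only [List.mem_cons, List.not_mem_nil, or_false, not_or] at hr
        simp only [ArrState.set_reg, hr, if_false]
        rw [hF₂.reg r (by simp [hr]), hF₁.reg r (by simp [hr])]
        exact hF.reg r (by simp [hr])
      · simp only [List.mem_cons, List.not_mem_nil, or_false, not_or] at hk
        rw [ArrState.set_arr, hF₂.arr k (by simp [hk]), hF₁.arr k (by simp [hk])]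
        exact hF.arr k (by simp [hk])
    · rintro st T ⟨hF, h26, h25, hG, hT⟩ hb
      simp only [ArrOp.test, decide_eq_false_iff_not, h26] at hb
      obtain h : st.reg 25 = n := by omega
      rw [h] at hG
      exact ⟨by omega, hF, hG⟩
    · simp only [ArrState.set_reg, ArrState.set_arr, reduceIte, Nat.reduceEqDiff]
      refine ⟨⟨fun r hr => ?_, fun k hk => ?_⟩, by trivial, by omega, fun j hj => ?_, by simp⟩
      · simp only [List.mem_cons, List.not_mem_nil, or_false, not_or] at hr
        simp only [ArrState.set_reg, hr, if_false]
        exact hF.reg r (by simp [hr])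
      · simp only [List.mem_cons, List.not_mem_nil, or_false, not_or] at hk
        exact hF.arr k (by simp [hk])
      · rw [hA j (by omega), front]
    · rintro st ⟨hF, hG⟩
      have f3 : st.reg 3 = 1 := (hF.reg 3 (by simp)).trans h3
      have f21 : st.reg 21 = u.length := (hF.reg 21 (by simp)).trans h21
      have f23 : st.reg 23 = v.length := (hF.reg 23 (by simp)).trans h23
      have f24 : st.reg 24 = s.reg 24 := hF.reg 24 (by simp)
      refine .seq (ensures_block ?_)
      simp only [wp, f21]
      refine ⟨by omega, by omega, .ite (T := 1) (fun hb => ?_) fun hb => ?_⟩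
      · simp only [ArrOp.test, decide_eq_true_eq, ArrState.set_reg, reduceIte, Nat.reduceEqDiff,
          f23, hG _ le_rfl] at hb
        refine ensures_block ?_
        simp only [wp, ArrState.set_reg, reduceIte, Nat.reduceEqDiff, f3, f24]
        refine ⟨by omega, ⟨fun r hr => ?_, fun k hk => hF.arr k hk⟩, by rw [if_neg (by omega)]⟩
        simp only [List.mem_cons, List.not_mem_nil, or_false, not_or] at hr
        simp only [ArrState.set_reg, hr, if_false]
        exact hF.reg r (by simp [hr])
      · simp only [ArrOp.test, decide_eq_false_iff_not, ArrState.set_reg, reduceIte,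
          Nat.reduceEqDiff, f23, hG _ le_rfl] at hb
        refine .skip ⟨⟨fun r hr => ?_, fun k hk => hF.arr k hk⟩, ?_⟩
        · simp only [List.mem_cons, List.not_mem_nil, or_false, not_or] at hr
          simp only [ArrState.set_reg, hr, if_false]
          exact hF.reg r (by simp [hr])
        · rw [if_pos (by omega)]
          simp [f24]
  · simp only [ArrState.set_reg, ArrState.set_arr, reduceIte, Nat.reduceEqDiff]
    refine ⟨⟨fun r hr => ?_, fun k hk => rfl⟩, by trivial, by omega, fun i hi => by omega,
      by omega⟩
    simp only [List.mem_cons, List.not_mem_nil, or_false, not_or] at hr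
    simp only [ArrState.set_reg, hr, if_false]

/-- Decide the equivalence of the two sides of an identity; the answer is positive if register `0`
is less than register `1` in the end. -/
def simonTest (n : ℕ) : Cmd ArrOp (ℕ × ℕ) :=
  .seq (.block [.add 2 0 1, .const 3 1, .const 4 0, .const 5 0])
    (.seq buildHeap (.seq popClasses
      (.seq (.block [.const 20 0, .move 21 0, .move 22 0, .move 23 1, .const 24 0])
        (.seq (embedTest n)
          (.seq (.block [.move 20 0, .move 21 1, .const 22 0, .move 23 0])
            (.seq (embedTest n) (.block [.move 0 24, .move 1 3])))))))

/-- Register `24` counts the failures of the two inclusions between sets of short subwords. It is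
not reset in between, and the final comparison with `1` asks whether it is zero. -/
theorem simonTest_ensures (n : ℕ) (e : MonoidIdentity) {d W : ℕ}
    (hW : (n + 4) * (e.length + 2) ≤ W) (hd : e.length ≤ 2 ^ d) :
    Ensures (ArrOp.run 6 (e.length + 2) W) ArrOp.test (simonTest n) (arrInit e)
      ((50 * d + 30) * e.length + 2 * ((36 * e.length + 32) * n + 4 * e.length + 16) + 25) fun s =>
        s.reg 0 < s.reg 1 ↔ SimonEq n e.lhs.toList e.rhs.toList := by
  set l := e.length with hl
  set u := e.lhs.toList with hu
  set v := e.rhs.toList with hv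
  have hlen : u.length + v.length = l := rfl
  have hW' : 4 * (l + 2) ≤ W := (Nat.mul_le_mul_right _ (by omega)).trans hW
  have hW1 : n ≤ W := by
    refine le_trans ?_ hW
    rw [add_mul]
    have : n * 1 ≤ n * (l + 2) := Nat.mul_le_mul_left _ (by omega)
    omega
  have hzero : ∀ k i, 1 ≤ k → (arrInit e).arr k i = 0 := by
    intro k i hk
    have : l + 2 ≤ k * (l + 2) := Nat.le_mul_of_pos_left _ hk
    refine List.getD_eq_default _ _ ?_
    rw [MonoidIdentity.letters, List.length_append]
    change u.length + v.length ≤ k * (l + 2) + i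
    omega
  have hL : ∀ i, (arrInit e).arr 0 i = (u ++ v).getD i 0 := by
    intro i
    simp only [arrInit, Nat.zero_mul, Nat.zero_add]
    rfl
  have ht : (50 * d + 30) * l + 2 * ((36 * l + 32) * n + 4 * l + 16) + 25 =
      4 + (((25 * d + 13) * l + 4) + (((25 * d + 17) * l + 6) +
        (5 + (((36 * l + 32) * n + 4 * l + 16) + (4 + (((36 * l + 32) * n + 4 * l + 16) + 2)))))) := by
    ring
  rw [ht]
  refine .seq (ensures_block ?_)
  have r0 : (arrInit e).reg 0 = u.length := rfl
  have r1 : (arrInit e).reg 1 = v.length := rfl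
  simp only [wp, r0, r1, hlen]
  refine ⟨by omega, by omega, by omega, by omega, ?_⟩
  set s₀ := ((((arrInit e).set 2 l).set 3 1).set 4 0).set 5 0 with hs₀
  have a2 : s₀.reg 2 = l := by simp [hs₀]
  have a3 : s₀.reg 3 = 1 := by simp [hs₀]
  have a4 : s₀.reg 4 = 0 := by simp [hs₀]
  have a0 : s₀.reg 0 = u.length := by simp [hs₀, r0]
  have a1 : s₀.reg 1 = v.length := by simp [hs₀, r1]
  have aA : s₀.arr = (arrInit e).arr := rfl
  refine .seq ((buildHeap_ensures hW' hd a2 a3 a4 (by simp [hs₀])).mono le_rfl ?_)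
  rintro s₁ ⟨hF₁, hH₁, hV₁, hl₁⟩
  have b2 : s₁.reg 2 = l := (hF₁.reg 2 (by simp)).trans a2
  have b3 : s₁.reg 3 = 1 := (hF₁.reg 3 (by simp)).trans a3
  have b4 : s₁.reg 4 = 0 := (hF₁.reg 4 (by simp)).trans a4
  have bL : s₁.arr 0 = s₀.arr 0 := hF₁.arr 0 (by simp)
  have bC : s₁.arr 2 = s₀.arr 2 := hF₁.arr 2 (by simp)
  have hA0 : s₁.arr 1 0 ≤ l := by
    rcases Nat.eq_zero_or_pos l with h | h
    · rw [hl₁ h, aA, hzero 1 0 le_rfl]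
      omega
    · exact (hV₁.forall_lt (P := (· < l)) (fun i hi => hi) 0 h).le
  refine .seq ((popClasses_ensures hW' hd b2 b3 b4 (by rwa [bL]) hV₁ (fun i hi => ?_) hA0).mono
    le_rfl ?_)
  · rw [bC, aA, hzero 2 i (by omega)]
    omega
  rintro s₂ ⟨hF₂, hcls, hiff⟩
  have c2 : s₂.reg 2 = l := (hF₂.reg 2 (by simp)).trans b2
  have c3 : s₂.reg 3 = 1 := (hF₂.reg 3 (by simp)).trans b3
  have c4 : s₂.reg 4 = 0 := (hF₂.reg 4 (by simp)).trans b4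
  have c0 : s₂.reg 0 = u.length := ((hF₂.reg 0 (by simp)).trans (hF₁.reg 0 (by simp))).trans a0
  have c1 : s₂.reg 1 = v.length := ((hF₂.reg 1 (by simp)).trans (hF₁.reg 1 (by simp))).trans a1
  have cL : s₂.arr 0 = (arrInit e).arr 0 := ((hF₂.arr 0 (by simp)).trans bL).trans (by rw [aA])
  have hu' : IsFactor l (s₂.arr 0) (s₂.arr 2) 0 u := by
    refine ⟨by omega, fun j hj => ?_, hcls, fun p hp q hq => ?_⟩
    · rw [cL, hL, Nat.zero_add, List.getD_append _ _ _ _ hj, List.getD_eq_getElem _ _ hj]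
    · rw [hiff p hp q hq, bL, aA, cL]
  have hv' : IsFactor l (s₂.arr 0) (s₂.arr 2) u.length v := by
    refine ⟨by omega, fun j hj => ?_, hcls, fun p hp q hq => ?_⟩
    · rw [cL, hL, List.getD_append_right _ _ _ _ (by omega), Nat.add_sub_cancel_left,
        List.getD_eq_getElem _ _ hj]
    · rw [hiff p hp q hq, bL, aA, cL]
  refine .seq (ensures_block ?_)
  simp only [wp, ArrState.set_reg, reduceIte, c0, c1, OfNat.zero_ne_ofNat,
    OfNat.one_ne_ofNat]
  refine ⟨by omega, by omega, ?_⟩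
  refine .seq ((embedTest_ensures (u := u) (v := v) hW (by simpa using c2) (by simpa using c3)
    (by simpa using c4) (by simpa using hv') (by simp) (by simpa using hu') (by simp)
    (by simp)).mono le_rfl ?_)
  rintro s₃ ⟨hF₃, h24⟩
  simp only [ArrState.set_reg, reduceIte, Nat.zero_add] at h24
  have d2 : s₃.reg 2 = l := by simpa [c2] using hF₃.reg 2 (by simp)
  have d3 : s₃.reg 3 = 1 := by simpa [c3] using hF₃.reg 3 (by simp)
  have d4 : s₃.reg 4 = 0 := by simpa [c4] using hF₃.reg 4 (by simp)
  have d0 : s₃.reg 0 = u.length := by simpa [c0] using hF₃.reg 0 (by simp)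
  have d1 : s₃.reg 1 = v.length := by simpa [c1] using hF₃.reg 1 (by simp)
  have dL : s₃.arr 0 = s₂.arr 0 := by simpa using hF₃.arr 0 (by simp)
  have dC : s₃.arr 2 = s₂.arr 2 := by simpa using hF₃.arr 2 (by simp)
  refine .seq (ensures_block ?_)
  simp only [wp, ArrState.set_reg, reduceIte, d0, d1, OfNat.zero_ne_ofNat,
    OfNat.one_ne_ofNat]
  refine ⟨by omega, ?_⟩
  refine .seq ((embedTest_ensures (u := v) (v := u) hW (by simpa using d2) (by simpa using d3)
    (by simpa using d4) (by simpa [dL, dC] using hu') (by simp) (by simpa [dL, dC] using hv')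
    (by simp) (by simp [h24]; split_ifs <;> omega)).mono le_rfl ?_)
  rintro s₄ ⟨hF₄, k24⟩
  simp only [ArrState.set_reg, reduceIte, Nat.reduceEqDiff, h24] at k24
  have e3 : s₄.reg 3 = 1 := by simpa [d3] using hF₄.reg 3 (by simp)
  refine ensures_block ?_
  simp only [wp, ArrState.set_reg, reduceIte, Nat.reduceEqDiff, e3, k24, zero_ne_one,
    OfNat.ofNat_ne_zero]
  rw [simonEq_iff_front]
  split_ifs with h₁ h₂ h₂ <;> simp [h₁, h₂]

theorem checkId_stylicMonoid_decidableInTime (n : ℕ) :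
    RAM.DecidableInTime (CheckId (StylicMonoid n)) fun l : ℕ => (l : ℝ) * Real.log l := by
  have hlog : Filter.Tendsto (fun l : ℕ => Real.log l) Filter.atTop Filter.atTop :=
    Real.tendsto_log_atTop.comp tendsto_natCast_atTop_atTop
  have hone : (fun _ : ℕ => (1 : ℝ)) =O[Filter.atTop] fun l : ℕ => Real.log l :=
    (Asymptotics.isBigO_const_left_iff_pos_le_norm one_ne_zero).2 ⟨1, one_pos, by
      filter_upwards [hlog.eventually_ge_atTop 1] with l hl
      exact hl.trans (le_abs_self _)⟩
  have hone' : (fun _ : ℕ => (1 : ℝ)) =O[Filter.atTop] fun l : ℕ => (l : ℝ) :=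
    (Asymptotics.isBigO_const_left_iff_pos_le_norm one_ne_zero).2 ⟨1, one_pos, by
      filter_upwards [Filter.eventually_ge_atTop 1] with l hl
      simpa using hl⟩
  have hone₂ : (fun _ : ℕ => (1 : ℝ)) =O[Filter.atTop] fun l : ℕ => (l : ℝ) * Real.log l := by
    simpa using hone'.mul hone
  have hlin : (fun l : ℕ => (l : ℝ)) =O[Filter.atTop] fun l : ℕ => (l : ℝ) * Real.log l := by
    simpa using (Asymptotics.isBigO_refl (fun l : ℕ => (l : ℝ)) Filter.atTop).mul hone
  have hd : (fun l : ℕ => (l : ℝ) * (Nat.log 2 l : ℝ)) =O[Filter.atTop]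
      fun l : ℕ => (l : ℝ) * Real.log l := by
    refine (Asymptotics.isBigO_refl _ _).mul (.of_bound (1 / Real.log 2) ?_)
    filter_upwards with l
    rw [Real.norm_of_nonneg (Nat.cast_nonneg _), Real.norm_of_nonneg (Real.log_natCast_nonneg l),
      one_div_mul_eq_div]
    exact Real.natLog_le_logb l 2
  -- The depth `Nat.log 2 l + 1` satisfies `l ≤ 2 ^ d`. Only the two heap phases depend on it; the
  -- rest of the budget is linear in `l` for fixed `n`.
  refine decidableInTime_of_ensures (simonTest n) (n + 4)
    (fun l => (50 * (Nat.log 2 l + 1) + 30) * l +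
      2 * ((36 * l + 32) * n + 4 * l + 16) + 25) ?_ hone₂ fun e W hW => ?_
  · have : (fun l : ℕ => (((50 * (Nat.log 2 l + 1) + 30) * l +
        2 * ((36 * l + 32) * n + 4 * l + 16) + 25 : ℕ) : ℝ)) = fun l : ℕ =>
          50 * ((l : ℝ) * (Nat.log 2 l : ℝ)) + (88 + 72 * n) * (l : ℝ) + (64 * n + 57) * 1 := by
      funext l
      push_cast
      ring
    rw [this]
    exact ((hd.const_mul_left _).add (hlin.const_mul_left _)).add (hone₂.const_mul_left _)
  · refine (simonTest_ensures n e hW (Nat.lt_pow_succ_log_self one_lt_two _).le).mono le_rfl ?_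
    intro s hs
    rw [hs, mem_checkId_stylicMonoid_iff]

end RamMain

/-! ### Stack programs and Turing machines -/

section StackPrograms

/-- The actions of a stack program with finite memory `σ` and stacks `Γ k`. -/
inductive StackOp {K : Type} (Γ : K → Type) (σ : Type) where
  | push (k : K) (f : σ → Γ k)
  | pop (k : K) (f : σ → Option (Γ k) → σ)
  | load (f : σ → σ)

/-- The tests of a stack program. -/
inductive StackTest (K σ : Type) where
  | mem (f : σ → Bool)
  | nonempty (k : K)

variable {K : Type} {Γ : K → Type} {σ : Type} [DecidableEq K]

/-- The effect of an action. -/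
def StackOp.exec : StackOp Γ σ → σ × (∀ k, List (Γ k)) → σ × ∀ k, List (Γ k)
  | push k f, (r, S) => (r, Function.update S k (f r :: S k))
  | pop k f, (r, S) => (f r (S k).head?, Function.update S k (S k).tail)
  | load f, (r, S) => (f r, S)

/-- The effect of an action as a partial function. -/
def StackOp.run (o : StackOp Γ σ) (q : σ × ∀ k, List (Γ k)) : Option (σ × ∀ k, List (Γ k)) :=
  some (o.exec q)

/-- The outcome of a test. -/
def StackTest.run : StackTest K σ → σ × (∀ k, List (Γ k)) → Bool
  | mem f, (r, _) => f r
  | nonempty k, (_, S) => (S k).head?.isSome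

open Turing

/-- The statement of a Turing machine that carries out one instruction of jump code. The memory of
the machine has an additional bit for the outcome of tests, which is `false` between instructions.
-/
def Jmp.toStmt {Λ : Type} (lab : ℕ → Λ) (i : ℕ) :
    Jmp (StackOp Γ σ) (StackTest K σ) → TM2.Stmt Γ Λ (σ × Bool)
  | act (.push k f) => .push k (fun r => f r.1) (.goto fun _ => lab (i + 1))
  | act (.pop k f) => .pop k (fun r x => (f r.1 x, false)) (.goto fun _ => lab (i + 1))
  | act (.load f) => .load (fun r => (f r.1, false)) (.goto fun _ => lab (i + 1))
  | jump k => .goto fun _ => lab k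
  | branch (.mem f) k => .branch (fun r => f r.1) (.goto fun _ => lab k) (.goto fun _ => lab (i + 1))
  | branch (.nonempty q) k => .peek q (fun r x => (r.1, x.isSome))
      (.branch (fun r => r.2) (.load (fun r => (r.1, false)) (.goto fun _ => lab k))
        (.load (fun r => (r.1, false)) (.goto fun _ => lab (i + 1))))

/-- The statements of the Turing machine that runs jump code. -/
def jumpProgram (P : List (Jmp (StackOp Γ σ) (StackTest K σ))) (i : Fin (P.length + 1)) :
    TM2.Stmt Γ (Fin (P.length + 1)) (σ × Bool) :=
  match P[(i : ℕ)]? with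
  | none => .halt
  | some o => o.toStmt (fun j => ⟨min j P.length, by omega⟩) i

/-- The configuration of a Turing machine that corresponds to a state of jump code. -/
def jumpCfg (L : ℕ) (c : ℕ × (σ × ∀ k, List (Γ k))) : TM2.Cfg Γ (Fin (L + 1)) (σ × Bool) :=
  ⟨some ⟨min c.1 L, by omega⟩, (c.2.1, false), c.2.2⟩

theorem Jmp.stepAux_toStmt {Λ : Type} (lab : ℕ → Λ) {i : ℕ} {s : σ} {S : ∀ k, List (Γ k)}
    {P : List (Jmp (StackOp Γ σ) (StackTest K σ))} {o : Jmp (StackOp Γ σ) (StackTest K σ)}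
    (ho : P[i]? = some o) {c : ℕ × (σ × ∀ k, List (Γ k))}
    (h : Jmp.step StackOp.run StackTest.run P (i, s, S) = some c) :
    TM2.stepAux (o.toStmt lab i) (s, false) S = ⟨some (lab c.1), (c.2.1, false), c.2.2⟩ := by
  simp only [Jmp.step, ho] at h
  cases o with
  | act a =>
    cases a <;>
    · simp only [StackOp.run, StackOp.exec, Option.map_some, Option.some.injEq] at h
      subst h
      rfl
  | jump k =>
    simp only [Option.some.injEq] at h
    subst h
    rfl
  | branch b k =>
    cases b with
    | mem f =>
      simp only [StackTest.run, Option.some.injEq] at h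
      subst h
      by_cases hf : f s = true <;> simp [Jmp.toStmt, TM2.stepAux, hf]
    | nonempty q =>
      simp only [StackTest.run, Option.some.injEq] at h
      subst h
      by_cases hf : (S q).head?.isSome = true <;> simp [Jmp.toStmt, TM2.stepAux, hf]

theorem jumpProgram_step {P : List (Jmp (StackOp Γ σ) (StackTest K σ))}
    {c c' : ℕ × (σ × ∀ k, List (Γ k))} (h : Jmp.step StackOp.run StackTest.run P c = some c') :
    TM2.step (jumpProgram P) (jumpCfg P.length c) = some (jumpCfg P.length c') := by
  obtain ⟨i, s, S⟩ := c
  have hi : i < P.length := by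
    by_contra hi
    simp [Jmp.step, List.getElem?_eq_none (not_lt.1 hi)] at h
  have hm : min i P.length = i := by omega
  have hP := List.getElem?_eq_getElem hi
  simp only [jumpCfg, TM2.step, jumpProgram, hm, hP]
  rw [Jmp.stepAux_toStmt _ hP h]

theorem jumpProgram_steps {P : List (Jmp (StackOp Γ σ) (StackTest K σ))}
    {c c' : ℕ × (σ × ∀ k, List (Γ k))} {t : ℕ}
    (h : Jmp.Steps StackOp.run StackTest.run P c t c') :
    (flip bind (TM2.step (jumpProgram P)))^[t] (some (jumpCfg P.length c)) =
      some (jumpCfg P.length c') := by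
  induction h with
  | refl c => rfl
  | head h _ ih =>
    rw [Function.iterate_succ_apply]
    exact (congrArg _ (jumpProgram_step h)).trans ih

/-- The additional label `P.length` carries the statement `halt`, which accounts for the one extra
step. -/
theorem jumpProgram_halts {P : List (Jmp (StackOp Γ σ) (StackTest K σ))}
    {q q' : σ × ∀ k, List (Γ k)} {t : ℕ}
    (h : Jmp.Steps StackOp.run StackTest.run P (0, q) t (P.length, q')) :
    (flip bind (TM2.step (jumpProgram P)))^[t + 1] (some ⟨some 0, (q.1, false), q.2⟩) =
      some ⟨none, (q'.1, false), q'.2⟩ := by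
  have h₁ := jumpProgram_steps h
  have h₀ : jumpCfg P.length (0, q) = ⟨some 0, (q.1, false), q.2⟩ := by
    simp only [jumpCfg, Nat.zero_min]
    rfl
  rw [h₀] at h₁
  rw [Function.iterate_succ_apply', h₁]
  change TM2.step (jumpProgram P) (jumpCfg P.length (P.length, q')) = _
  simp [jumpCfg, TM2.step, jumpProgram, TM2.stepAux]

/-- The Turing machine that runs jump code. -/
def jumpMachine [Fintype K] [Fintype σ] (k₀ k₁ : K) [Fintype (Γ k₀)] (r : σ)
    (P : List (Jmp (StackOp Γ σ) (StackTest K σ))) : FinTM2 where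
  K := K
  k₀ := k₀
  k₁ := k₁
  Γ := Γ
  Λ := Fin (P.length + 1)
  main := 0
  σ := σ × Bool
  initialState := (r, false)
  m := jumpProgram P

/-- All stacks are empty, except one. -/
def singleStack (k : K) (s : List (Γ k)) : ∀ k, List (Γ k) :=
  Function.update (fun _ => []) k s

theorem dite_eq_singleStack (k : K) (s : List (Γ k)) :
    (fun j => if h : j = k then (by rw [h]; exact s : List (Γ j)) else []) = singleStack k s := by
  funext j
  by_cases hj : j = k
  · subst hj
    simp [singleStack]
  · simp [singleStack, hj]

open Classical in
/-- A language is in `P` if it is decided by a stack program in polynomial time. -/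
theorem mem_classP_of_ensures {I : Type} {L : Language I} [Fintype K] [Fintype σ]
    [hΓ : ∀ k, Finite (Γ k)] (k₀ k₁ : K) (e₀ : Γ k₀ ≃ I) (e₁ : Γ k₁ ≃ Bool) (r : σ)
    (c : Cmd (StackOp Γ σ) (StackTest K σ)) (p : Polynomial ℕ)
    (h : ∀ s : List I, Cmd.Ensures StackOp.run StackTest.run c
      (r, singleStack k₀ (s.map e₀.symm)) (p.eval s.length) fun q =>
        q = (r, singleStack k₁ [e₁.symm (decide (s ∈ L))])) : L ∈ ClassP I := by
  have : Fintype (Γ k₀) := Fintype.ofFinite _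
  choose t ht s' hr hs' using h
  refine ⟨{
    tm := jumpMachine k₀ k₁ r (c.code 0)
    inputAlphabet := e₀
    outputAlphabet := e₁
    time := p + 1
    outputsFun := fun s => {
      steps := t s + 1
      evals_in_steps := ?_
      steps_le_m := ?_ } }, fun k => hΓ k⟩
  · have hsteps := (hr s).steps [] []
    simp only [List.nil_append, List.append_nil, List.length_nil, Nat.zero_add] at hsteps
    have hrun := jumpProgram_halts hsteps
    rw [hs'] at hrun
    have hinit : @Eq (TM2.Cfg Γ (Fin ((c.code 0).length + 1)) (σ × Bool))
        (initList (jumpMachine k₀ k₁ r (c.code 0)) (s.map e₀.symm))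
        ⟨some 0, (r, false), singleStack k₀ (s.map e₀.symm)⟩ :=
      congrArg (TM2.Cfg.mk _ _) (dite_eq_singleStack k₀ _)
    -- A final configuration is required to have the initial memory and no contents on any stack but
    -- the output. This is why the program has to restore `r` and clear its stacks.
    have hfin : @Eq (TM2.Cfg Γ (Fin ((c.code 0).length + 1)) (σ × Bool))
        (haltList (jumpMachine k₀ k₁ r (c.code 0)) [e₁.symm (decide (s ∈ L))])
        ⟨none, (r, false), singleStack k₁ [e₁.symm (decide (s ∈ L))]⟩ :=
      congrArg (TM2.Cfg.mk _ _) (dite_eq_singleStack k₁ _)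
    exact (congrArg (fun o => (flip bind (TM2.step (jumpProgram (c.code 0))))^[t s + 1] (some o))
      hinit).trans (hrun.trans (congrArg some hfin.symm))
  · simpa using ht s

end StackPrograms

/-! ### Greedy embeddings computed by passes over an annotated word -/

section Passes

/-- A set of levels: the level `k` stands for subwords of length `k + 1`. -/
abbrev Marks (m : ℕ) : Type := Fin (m + 1) → Bool

namespace Marks

variable {m : ℕ}

/-- The levels whose predecessor is marked. -/
def lower (M : Marks m) : Marks m := Fin.cons false fun k => M k.castSucc

/-- The union of two sets of levels. -/
def union (M P : Marks m) : Marks m := fun k => M k || P k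

/-- The intersection of two sets of levels. -/
def inter (M P : Marks m) : Marks m := fun k => M k && P k

/-- The levels `k` with `j ≤ F (k + 1)`. -/
def above (m : ℕ) (F : ℕ → ℕ) (j : ℕ) : Marks m := fun k => decide (j ≤ F (k + 1))

/-- The lowest level has the predecessor `F 0 = 0`, which lies before every position, so `false` is
the right value there. -/
theorem lower_above {F : ℕ → ℕ} (hF : F 0 = 0) (j : ℕ) (k : Fin (m + 1)) :
    (above m F (j + 1)).lower k = decide (j + 1 ≤ F k) := by
  refine Fin.cases ?_ (fun k => ?_) k
  · simp [lower, hF]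
  · simp [lower, above]

end Marks

variable {m : ℕ}

/-- The pending levels after a letter `b` with marks `M`, in a pass for the letter `a`. -/
def pending (a : ℕ) (P : Marks m) (b : ℕ) (M : Marks m) : Marks m :=
  if b = a then P.inter M.lower else P

/-- The new annotation of a word after a pass for the letter `a`. -/
def passWord (a : ℕ) : Marks m → List (ℕ × Marks m) → List (ℕ × Marks m)
  | _, [] => []
  | P, x :: l => (x.1, x.2.union P) :: passWord a (pending a P x.1 x.2) l

/-- The pending levels after a pass for the letter `a`. -/
def passRest (a : ℕ) (P : Marks m) (l : List (ℕ × Marks m)) : Marks m :=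
  l.foldl (fun P x => pending a P x.1 x.2) P

/-- The annotation of a word from the position `j` on: the letter at position `i` is marked with the
levels `k` such that `i ≤ F (k + 1)`. -/
def annotate (m : ℕ) (F : ℕ → ℕ) : ℕ → List ℕ → List (ℕ × Marks m)
  | _, [] => []
  | j, b :: v => (b, .above m F (j + 1)) :: annotate m F (j + 1) v

theorem annotate_zero (j : ℕ) (v : List ℕ) :
    annotate m (fun _ => 0) j v = v.map fun b => (b, fun _ => false) := by
  induction v generalizing j with
  | nil => rfl
  | cons b v ih =>
    simp only [annotate, ih, List.map_cons, List.cons.injEq, Prod.mk.injEq, true_and, and_true]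
    funext k
    simp [Marks.above]

/-- A level is pending as long as the next position of `a` after the front of its predecessor has
not been passed. A letter `a` ends the wait exactly if it lies after that front, that is, if the
predecessor level is unmarked there; other letters never end it. -/
theorem pending_nextPos {w : List ℕ} {F : ℕ → ℕ} (hF : F 0 = 0) (a : ℕ) {j : ℕ}
    (hj : j < w.length) :
    pending a (.above m (fun k => nextPos w a (F (k - 1))) (j + 1)) w[j] (.above m F (j + 1)) =
      .above m (fun k => nextPos w a (F (k - 1))) (j + 2) := by
  funext k
  have h₁ : ∀ i ≤ j, nextPos w a i ≤ nextPos w a j := fun i hi => nextPos_mono w a hi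
  have h₂ : ∀ i, j + 1 ≤ i → j + 2 ≤ nextPos w a i := fun i hi => by
    rw [nextPos]; omega
  by_cases h : w[j] = a
  · rw [pending, if_pos h, Marks.inter, Marks.lower_above hF]
    simp only [Marks.above, Nat.add_sub_cancel, ← Bool.decide_and]
    congr 1
    apply propext
    constructor
    · rintro ⟨-, h'⟩
      exact h₂ _ h'
    · intro h'
      refine ⟨by omega, ?_⟩
      by_contra hlt
      have := h₁ (F k) (by omega)
      rw [nextPos_of_lt a hj, if_pos h] at this
      omega
  · rw [pending, if_neg h]
    simp only [Marks.above, Nat.add_sub_cancel]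
    congr 1
    apply propext
    refine ⟨fun h' => ?_, fun h' => by omega⟩
    rcases Nat.lt_or_ge j (F k) with hlt | hge
    · exact h₂ _ hlt
    -- The next position of `a` cannot be `j + 1`, because another letter stands there.
    · have key : ∀ d i, i + d = j → nextPos w a i ≠ j + 1 := by
        intro d
        induction d with
        | zero =>
          intro i hi he
          obtain rfl : i = j := hi
          rw [nextPos_of_lt a hj, if_neg h] at he
          have := h₂ (i + 1) le_rfl
          omega
        | succ d ih =>
          intro i hi he
          rw [nextPos_of_lt a (by omega)] at he
          split_ifs at he
          · omega
          · exact ih (i + 1) (by omega) he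
      have := key (j - F k) (F k) (by omega)
      omega

/-- A position is at most the maximum of two ends iff it is at most one of them; so the union of old
and pending marks realises the `max` in the recursion for `front`. -/
theorem pass_annotate {F : ℕ → ℕ} (hF : F 0 = 0) (a : ℕ) (w : List ℕ) (j : ℕ) (v : List ℕ)
    (hv : v = w.drop j) (hj : j ≤ w.length) :
    passWord a (.above m (fun k => nextPos w a (F (k - 1))) (j + 1)) (annotate m F j v) =
        annotate m (fun k => max (F k) (nextPos w a (F (k - 1)))) j v ∧
      passRest a (.above m (fun k => nextPos w a (F (k - 1))) (j + 1)) (annotate m F j v) =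
        .above m (fun k => nextPos w a (F (k - 1))) (w.length + 1) := by
  induction v generalizing j with
  | nil =>
    have : w.length ≤ j := List.drop_eq_nil_iff.1 hv.symm
    obtain rfl : j = w.length := by omega
    exact ⟨rfl, rfl⟩
  | cons b v ih =>
    have hlt : j < w.length := by
      by_contra h
      rw [List.drop_eq_nil_of_le (not_lt.1 h)] at hv
      simp at hv
    rw [List.drop_eq_getElem_cons hlt, List.cons.injEq] at hv
    obtain ⟨rfl, hv⟩ := hv
    have := ih (j + 1) hv hlt
    rw [annotate, passWord, passRest, List.foldl_cons, pending_nextPos hF a hlt]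
    refine ⟨?_, this.2⟩
    rw [this.1, annotate]
    congr 2
    funext k
    simp [Marks.union, Marks.above, ← Bool.decide_or]

/-- The result of successive passes over an annotated word, together with a flag that is raised if
the last level is pending at the end of a pass. -/
def passes : List ℕ → List (ℕ × Marks m) × Bool → List (ℕ × Marks m) × Bool
  | [], s => s
  | a :: u, s => passes u
      (passWord a (fun _ => true) s.1, s.2 || passRest a (fun _ => true) s.1 (Fin.last m))

/-- Marks on the letters of `v` cannot tell the end `|v|` from the overflow value `|v| + 1`. A level
still pending behind `v` has overflowed; for the last level the flag remembers this. -/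
theorem passes_annotate (u v : List ℕ) (i : ℕ) (x : List ℕ) (hx : x = u.drop i) (b : Bool)
    (hi : i ≤ u.length) :
    passes x (annotate m (fun k => front u v k i) 0 v,
        b || decide (v.length < front u v (m + 1) i)) =
      (annotate m (fun k => front u v k u.length) 0 v,
        b || decide (v.length < front u v (m + 1) u.length)) := by
  induction x generalizing i with
  | nil =>
    have : u.length ≤ i := List.drop_eq_nil_iff.1 hx.symm
    obtain rfl : i = u.length := by omega
    rfl
  | cons a x ih =>
    have hlt : i < u.length := by
      by_contra h
      rw [List.drop_eq_nil_of_le (not_lt.1 h)] at hx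
      simp at hx
    rw [List.drop_eq_getElem_cons hlt, List.cons.injEq] at hx
    obtain ⟨rfl, hx⟩ := hx
    have hF : front u v 0 i = 0 := by simp [front]
    have hp := pass_annotate (m := m) (F := fun k => front u v k i) hF u[i] v 0 v rfl (Nat.zero_le _)
    -- A pass starts with all levels pending because next positions are at least `1`.
    have h1 : (Marks.above m (fun k => nextPos v u[i] (front u v (k - 1) i)) (0 + 1)) =
        fun _ => true := by
      funext k
      exact decide_eq_true (by simp only [nextPos]; omega)
    rw [h1] at hp
    have hfront : ∀ k, front u v (k + 1) (i + 1) =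
        max (front u v (k + 1) i) (nextPos v u[i] (front u v k i)) := by
      intro k
      rw [front, List.getD_eq_getElem _ _ hlt]
    rw [passes, hp.1, hp.2, ← ih (i + 1) hx hlt]
    congr 2
    · have key : ∀ (F G : ℕ → ℕ), (∀ k, F (k + 1) = G (k + 1)) → ∀ (j : ℕ) (w : List ℕ),
          annotate m F j w = annotate m G j w := by
        intro F G h j w
        induction w generalizing j with
        | nil => rfl
        | cons b w ih =>
          rw [annotate, annotate, ih]
          congr 2
          funext k
          simp only [Marks.above, h]
      exact key _ _ (fun k => (hfront k).symm) 0 v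
    · simp only [Marks.above, hfront, Fin.val_last, Nat.add_sub_cancel, Bool.or_assoc,
        ← Bool.decide_or]
      congr 2
      apply propext
      rw [lt_max_iff, Nat.lt_iff_add_one_le, Nat.lt_iff_add_one_le]

theorem passes_eq (u v : List ℕ) (b : Bool) :
    passes u (v.map fun c => (c, fun _ => false), b) =
      (annotate m (fun k => front u v k u.length) 0 v,
        b || !decide (front u v (m + 1) u.length ≤ v.length)) := by
  have := passes_annotate (m := m) u v 0 u rfl b (Nat.zero_le _)
  simp only [front_zero_right, annotate_zero, not_lt_zero, decide_false, Bool.or_false] at this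
  rw [this, ← decide_not]
  simp only [not_le]

end Passes

/-! ### The stack program for the passes -/

section StackMain

open Cmd

namespace Cmd

/-- The program `c` transforms the state `s` into `s'` at a cost of at most `T`. -/
def Takes {α τ S : Type} (A : α → S → Option S) (B : τ → S → Bool) (c : Cmd α τ) (s : S) (T : ℕ)
    (s' : S) : Prop :=
  ∃ t ≤ T, Runs A B c s t s'

namespace Takes

variable {α τ S : Type} {A : α → S → Option S} {B : τ → S → Bool} {c d : Cmd α τ} {b : τ}
  {s s' s'' : S} {T T' : ℕ}

theorem mono (h : Takes A B c s T s') (hT : T ≤ T') : Takes A B c s T' s' := by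
  obtain ⟨t, ht, hr⟩ := h
  exact ⟨t, ht.trans hT, hr⟩

theorem skip : Takes A B .skip s T s := ⟨0, Nat.zero_le _, .skip s⟩

theorem act {a : α} (h : A a s = some s') : Takes A B (.act a) s 1 s' := ⟨1, le_rfl, .act h⟩

theorem seq (h : Takes A B c s T s') (h' : Takes A B d s' T' s'') :
    Takes A B (.seq c d) s (T + T') s'' := by
  obtain ⟨t, ht, hr⟩ := h
  obtain ⟨t', ht', hr'⟩ := h'
  exact ⟨t + t', add_le_add ht ht', .seq hr hr'⟩

theorem ite_true (hb : B b s = true) (h : Takes A B c s T s') :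
    Takes A B (.ite b c d) s (T + 2) s' := by
  obtain ⟨t, ht, hr⟩ := h
  exact ⟨t + 1, by omega, .ite_true hb hr⟩

theorem ite_false (hb : B b s = false) (h : Takes A B d s T s') :
    Takes A B (.ite b c d) s (T + 2) s' := by
  obtain ⟨t, ht, hr⟩ := h
  exact ⟨t + 2, by omega, .ite_false hb hr⟩

theorem loop_true (hb : B b s = true) (h : Takes A B c s T s')
    (h' : Takes A B (.loop b c) s' T' s'') : Takes A B (.loop b c) s (T + 2 + T') s'' := by
  obtain ⟨t, ht, hr⟩ := h
  obtain ⟨t', ht', hr'⟩ := h'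
  exact ⟨t + t' + 2, by omega, .loop_true hb hr hr'⟩

theorem loop_false (hb : B b s = false) : Takes A B (.loop b c) s 2 s :=
  ⟨2, le_rfl, .loop_false hb⟩

end Takes

end Cmd

/-- The symbols on the work stacks. -/
inductive Cell (m : ℕ) where
  | bit (b : Bool)
  | mark (M : Marks m)

/-- The work stacks. -/
inductive Tape where
  | left
  | leftRev
  | right
  | rightRev
  | key
  | keyRev
  deriving DecidableEq

/-- The stacks. -/
inductive Stack where
  | input
  | output
  | work (t : Tape)
  deriving DecidableEq

/-- The symbols on the stacks. -/
abbrev StackSym (m : ℕ) : Stack → Type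
  | .input => IdSymbol
  | .output => Bool
  | .work _ => Cell m

/-- The finite memory. -/
structure Reg (m : ℕ) where
  cur : Option (Cell m)
  tmp : Option (Cell m)
  eq : Bool
  bad : Bool
  side : Bool
  last : Option Bool
  pend : Marks m
  sym : Option IdSymbol

variable {m : ℕ}

instance : Finite Tape := by
  refine Finite.of_injective (β := Fin 6) (fun x => match x with
    | .left => 0
    | .leftRev => 1
    | .right => 2
    | .rightRev => 3
    | .key => 4
    | .keyRev => 5) ?_
  rintro ⟨⟩ ⟨⟩ <;> simp

instance : Finite Stack := by
  refine Finite.of_injective (β := Option (Option Tape)) (fun x => match x with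
    | .work t => some (some t)
    | .input => some none
    | .output => none) ?_
  rintro ⟨⟩ ⟨⟩ <;> simp

instance : Finite IdSymbol := by
  refine Finite.of_injective (β := Option (Option Bool)) (fun x => match x with
    | .bit b => some (some b)
    | .sep => some none
    | .approx => none) ?_
  rintro ⟨⟩ ⟨⟩ <;> simp

instance : Finite (Cell m) := by
  refine Finite.of_injective (β := Bool ⊕ Marks m) (fun x => match x with
    | .bit b => .inl b
    | .mark M => .inr M) ?_
  rintro ⟨⟩ ⟨⟩ <;> simp

instance : Finite (Reg m) := by
  refine Finite.of_injective
    (fun r => (r.cur, r.tmp, r.eq, r.bad, r.side, r.last, r.pend, r.sym)) ?_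
  rintro ⟨⟩ ⟨⟩ h
  simpa using h

instance (k : Stack) : Finite (StackSym m k) := by
  cases k
  · exact inferInstanceAs (Finite IdSymbol)
  · exact inferInstanceAs (Finite Bool)
  · exact inferInstanceAs (Finite (Cell m))

/-- The contents of all stacks. -/
def stackMap (I : List IdSymbol) (O : List Bool) (w : Tape → List (Cell m)) :
    ∀ k, List (StackSym m k)
  | .input => I
  | .output => O
  | .work t => w t

/-- The contents of the work stacks. -/
def tapes (u u' v v' a a' : List (Cell m)) : Tape → List (Cell m)
  | .left => u
  | .leftRev => u'
  | .right => v
  | .rightRev => v'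
  | .key => a
  | .keyRev => a'

section Simp

variable (u u' v v' a a' x : List (Cell m)) (I : List IdSymbol) (O : List Bool)
  (w : Tape → List (Cell m)) (t : Tape)

theorem update_stackMap_input (x : List IdSymbol) :
    Function.update (stackMap I O w) .input x = stackMap x O w := by
  funext k
  cases k <;> rfl

theorem update_stackMap_output (x : List Bool) :
    Function.update (stackMap I O w) .output x = stackMap I x w := by
  funext k
  cases k <;> rfl

theorem update_stackMap_work :
    Function.update (stackMap I O w) (.work t) x = stackMap I O (Function.update w t x) := by
  funext k
  cases k with
  | input => rfl
  | output => rfl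
  | work t' =>
    by_cases h : t' = t
    · subst h
      simp [stackMap]
    · rw [Function.update_of_ne (by simpa using h)]
      simp [stackMap, h]

theorem update_left : Function.update (tapes u u' v v' a a') .left x = tapes x u' v v' a a' := by
  funext k
  cases k <;> rfl

theorem update_leftRev :
    Function.update (tapes u u' v v' a a') .leftRev x = tapes u x v v' a a' := by
  funext k
  cases k <;> rfl

theorem update_right : Function.update (tapes u u' v v' a a') .right x = tapes u u' x v' a a' := by
  funext k
  cases k <;> rfl

theorem update_rightRev :
    Function.update (tapes u u' v v' a a') .rightRev x = tapes u u' v x a a' := by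
  funext k
  cases k <;> rfl

theorem update_key : Function.update (tapes u u' v v' a a') .key x = tapes u u' v v' x a' := by
  funext k
  cases k <;> rfl

theorem update_keyRev : Function.update (tapes u u' v v' a a') .keyRev x = tapes u u' v v' a x := by
  funext k
  cases k <;> rfl

end Simp

/-- The programs. -/
abbrev Prog (m : ℕ) : Type := Cmd (StackOp (StackSym m) (Reg m)) (StackTest Stack (Reg m))

/-- The program `c` transforms the state `s` into `s'` in at most `T` steps. -/
abbrev Prog.Takes (c : Prog m) (s : Reg m × ∀ k, List (StackSym m k)) (T : ℕ)
    (s' : Reg m × ∀ k, List (StackSym m k)) : Prop :=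
  Cmd.Takes StackOp.run StackTest.run c s T s'

theorem takes_block (l : List (StackOp (StackSym m) (Reg m)))
    {s s' : Reg m × ∀ k, List (StackSym m k)} (h : l.foldl (fun s o => o.exec s) s = s') :
    Prog.Takes (.block l) s l.length s' := by
  induction l generalizing s with
  | nil =>
    subst h
    exact .skip
  | cons o l ih => exact (Takes.seq (.act rfl) (ih h)).mono (by simp [Nat.add_comm])

/-- The symbol in a memory cell. -/
def getCell (x : Option (Cell m)) : Cell m := x.getD (.bit false)

/-- Pop a symbol from a work stack into the current cell. -/
def popCur (t : Tape) : StackOp (StackSym m) (Reg m) := .pop (.work t) fun r x => { r with cur := x }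

/-- Pop a symbol from a work stack into the temporary cell. -/
def popTmp (t : Tape) : StackOp (StackSym m) (Reg m) := .pop (.work t) fun r x => { r with tmp := x }

/-- Push a symbol on a work stack. -/
def pushWork (t : Tape) (f : Reg m → Cell m) : StackOp (StackSym m) (Reg m) := .push (.work t) f

section Exec

variable (r : Reg m) (I : List IdSymbol) (O : List Bool) (w : Tape → List (Cell m)) (t : Tape)

theorem exec_popCur : (popCur t).exec (r, stackMap I O w) =
    ({ r with cur := (w t).head? }, stackMap I O (Function.update w t (w t).tail)) :=
  congrArg (Prod.mk _) (update_stackMap_work ..)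

theorem exec_popTmp : (popTmp t).exec (r, stackMap I O w) =
    ({ r with tmp := (w t).head? }, stackMap I O (Function.update w t (w t).tail)) :=
  congrArg (Prod.mk _) (update_stackMap_work ..)

theorem exec_pushWork (f : Reg m → Cell m) : (pushWork t f).exec (r, stackMap I O w) =
    (r, stackMap I O (Function.update w t (f r :: w t))) :=
  congrArg (Prod.mk _) (update_stackMap_work ..)

theorem exec_load (f : Reg m → Reg m) (S : ∀ k, List (StackSym m k)) :
    (StackOp.load f).exec (r, S) = (f r, S) := rfl

theorem run_nonempty : (StackTest.nonempty (.work t)).run (r, stackMap I O w) = (w t).head?.isSome :=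
  rfl

end Exec

/-- Move the contents of the stack `i` to the stack `j`. -/
def drain (i j : Tape) (f : Cell m → Cell m) : Prog m :=
  .loop (.nonempty (.work i)) (.block [popCur i, pushWork j fun r => f (getCell r.cur),
    .load fun r => { r with cur := none }])

theorem drain_takes {i j : Tape} (hij : i ≠ j) (f : Cell m → Cell m) (r : Reg m)
    (hr : r.cur = none) (I : List IdSymbol) (O : List Bool) (w : Tape → List (Cell m)) :
    (drain i j f).Takes (r, stackMap I O w) (5 * (w i).length + 2)
      (r, stackMap I O (Function.update (Function.update w i []) j
        (((w i).map f).reverse ++ w j))) := by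
  induction hl : w i generalizing w with
  | nil =>
    rw [← hl, Function.update_eq_self, hl, List.map_nil, List.reverse_nil, List.nil_append,
      Function.update_eq_self]
    exact .loop_false (by simp [run_nonempty, hl])
  | cons x l ih =>
    have := ih (Function.update (Function.update w i l) j (f x :: w j))
      (by simp [Function.update_of_ne hij])
    have he : Function.update (Function.update (Function.update (Function.update w i l) j
        (f x :: w j)) i []) j ((l.map f).reverse ++ Function.update (Function.update w i l) j
        (f x :: w j) j) =
        Function.update (Function.update w i []) j (((x :: l).map f).reverse ++ w j) := by
      rw [Function.update_comm hij.symm, Function.update_idem, Function.update_idem,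
        Function.update_self]
      simp
    rw [he] at this
    refine Takes.mono (.loop_true (by simp [run_nonempty, hl]) (takes_block _ ?_) this) ?_
    · simp only [List.foldl_cons, List.foldl_nil, exec_popCur, exec_pushWork, exec_load, hl,
        List.head?_cons, List.tail_cons, Function.update_of_ne hij.symm, getCell, Option.getD_some]
      rw [← hr]
    · simp only [List.length_cons, List.length_nil]
      omega

/-- Empty the stack `i`. -/
def clear (i : Tape) : Prog m :=
  .loop (.nonempty (.work i)) (.block [popCur i, .load fun r => { r with cur := none }])

theorem clear_takes (i : Tape) (r : Reg m)
    (hr : r.cur = none) (I : List IdSymbol) (O : List Bool) (w : Tape → List (Cell m)) :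
    (clear i).Takes (r, stackMap I O w) (4 * (w i).length + 2)
      (r, stackMap I O (Function.update w i [])) := by
  induction hl : w i generalizing w with
  | nil =>
    rw [← hl, Function.update_eq_self, hl]
    exact .loop_false (by simp [run_nonempty, hl])
  | cons x l ih =>
    have := ih (Function.update w i l) (by simp)
    rw [Function.update_idem] at this
    refine Takes.mono (.loop_true (by simp [run_nonempty, hl]) (takes_block _ ?_) this) ?_
    · simp only [List.foldl_cons, List.foldl_nil, exec_popCur, exec_load, hl,
        List.head?_cons, List.tail_cons]
      rw [← hr]
    · simp only [List.length_cons, List.length_nil]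
      omega

end StackMain

/-! ### One pass over the annotated word, on stacks -/

section StackPass

open Cmd

variable {m : ℕ}

/-- The cells of an annotated word. -/
def cells (l : List (ℕ × Marks m)) : List (Cell m) :=
  l.flatMap fun x => x.1.bits.map .bit ++ [.mark x.2]

theorem cells_cons (x : ℕ × Marks m) (l : List (ℕ × Marks m)) :
    cells (x :: l) = x.1.bits.map .bit ++ .mark x.2 :: cells l := by
  simp [cells]

namespace Cell

/-- Test for a bit. -/
def isBit : Option (Cell m) → Bool
  | some (.bit _) => true
  | _ => false

/-- Test for equality of bits. -/
def sameBit : Option (Cell m) → Option (Cell m) → Bool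
  | some (.bit b), some (.bit b') => b == b'
  | _, _ => false

/-- The levels of a mark. -/
def levels : Option (Cell m) → Marks m
  | some (.mark M) => M
  | _ => fun _ => false

/-- Remove all levels from a mark. -/
def erase : Cell m → Cell m
  | .bit b => .bit b
  | .mark _ => .mark fun _ => false

end Cell

/-- A memory state in which only three components are relevant. -/
def reg (e bad : Bool) (P : Marks m) : Reg m := ⟨none, none, e, bad, false, none, P, none⟩

/-- Compare the current bit with the next bit of the key. -/
def compareBit : Prog m :=
  .seq (.block [pushWork .rightRev fun r => getCell r.cur, popTmp .key])
    (.ite (.mem fun r => r.tmp.isSome)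
      (.block [pushWork .keyRev fun r => getCell r.tmp,
        .load fun r => { r with eq := r.eq && Cell.sameBit r.cur r.tmp, cur := none, tmp := none }])
      (.block [.load fun r => { r with eq := false, cur := none, tmp := none }]))

/-- Update the current mark, and restore the key. -/
def updateMark : Prog m :=
  .seq (.block [popTmp .key])
    (.seq (.ite (.mem fun r => r.tmp.isSome)
      (.block [pushWork .key fun r => getCell r.tmp, .load fun r => { r with eq := false }]) .skip)
    (.seq (.block [.load fun r => { r with cur := none, tmp := r.cur }])
    (.seq (drain .keyRev .key id)
      (.block [pushWork .rightRev fun r => .mark ((Cell.levels r.tmp).union r.pend),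
        .load fun r => { r with
          eq := true
          tmp := none
          pend := if r.eq = true then r.pend.inter (Cell.levels r.tmp).lower else r.pend }]))))

/-- A pass over the annotated word on the right for the key. -/
def passLoop : Prog m :=
  .loop (.nonempty (.work .right)) (.seq (.block [popCur .right])
    (.ite (.mem fun r => Cell.isBit r.cur) compareBit updateMark))

/-- While the bits `bs` are compared, the key splits into the unread rest and the reversed part
already compared, and the flag records whether `bs` is still a prefix of it. A key that is too short
clears the flag. -/
theorem passLoop_bits (bs α : List Bool) (e bad : Bool) (P : Marks m) (I : List IdSymbol)
    (O : List Bool) (u u' R X β : List (Cell m)) {T : ℕ} {s' : Reg m × ∀ k, List (StackSym m k)}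
    (h : Prog.Takes passLoop (reg (e && bs.isPrefixOf α) bad P, stackMap I O
      (tapes u u' R ((bs.map .bit).reverse ++ X) ((α.drop bs.length).map .bit)
        (((α.take bs.length).map .bit).reverse ++ β))) T s') :
    Prog.Takes passLoop (reg e bad P, stackMap I O
      (tapes u u' (bs.map .bit ++ R) X (α.map .bit) β)) (11 * bs.length + T) s' := by
  induction bs generalizing α e X β with
  | nil => simpa using h
  | cons b bs ih =>
    cases α with
    | nil =>
      have := ih [] false (.bit b :: X) β (by simpa using h)
      refine Takes.mono (.loop_true (T := 1 + ((2 + (1 + 2)) + 2)) rfl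
        (.seq (takes_block _ rfl) (.ite_true rfl
          (.seq (takes_block _ rfl) (.ite_false rfl (takes_block _ rfl))))) ?_)
        (T := 10 + (11 * bs.length + T)) ?_
      · simp only [List.foldl_cons, List.foldl_nil, exec_popCur, exec_popTmp, exec_pushWork,
          exec_load, reg, update_right, update_rightRev, update_key, tapes,
          List.map_cons, List.cons_append, List.head?_cons, List.tail_cons, List.map_nil,
          List.head?_nil, List.tail_nil, getCell, Option.getD_some]
        exact this
      · simp only [List.length_cons]
        omega
    | cons b' α =>
      have := ih α (e && b == b') (.bit b :: X) (.bit b' :: β)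
        (by simpa [List.isPrefixOf, Bool.and_assoc] using h)
      refine Takes.mono (.loop_true (T := 1 + ((2 + (2 + 2)) + 2)) rfl
        (.seq (takes_block _ rfl) (.ite_true rfl
          (.seq (takes_block _ rfl) (.ite_true rfl (takes_block _ rfl))))) ?_)
        (T := 11 + (11 * bs.length + T)) ?_
      · simp only [List.foldl_cons, List.foldl_nil, exec_popCur, exec_popTmp, exec_pushWork,
          exec_load, reg, update_right, update_rightRev, update_key, update_keyRev, tapes,
          List.map_cons, List.cons_append, List.head?_cons, List.tail_cons, getCell,
          Option.getD_some, Cell.sameBit]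
        exact this
      · simp only [List.length_cons]
        omega

/-- Variables are compared on the stacks bit by bit, so distinct indices need distinct expansions.
-/
theorem bits_injective : Function.Injective Nat.bits := by
  intro a
  induction a using Nat.binaryRec' with
  | zero =>
    intro b h
    induction b using Nat.binaryRec' with
    | zero => rfl
    | bit c b hb _ => simp [Nat.bits_append_bit _ _ hb] at h
  | bit c a ha ih =>
    intro b h
    induction b using Nat.binaryRec' with
    | zero => simp [Nat.bits_append_bit _ _ ha] at h
    | bit d b hb _ =>
      rw [Nat.bits_append_bit _ _ ha, Nat.bits_append_bit _ _ hb, List.cons.injEq] at h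
      rw [h.1, ih h.2]

/-- A nonempty rest `κ` means that the key is longer than the index just read, so the letters
differ. The key is reassembled from both stacks for the next letter, and a cell popped only for this
test is put back. -/
theorem updateMark_takes (e bad : Bool) (M P : Marks m) (I : List IdSymbol) (O : List Bool)
    (u u' R X κ κ' : List (Cell m)) :
    updateMark.Takes ({ reg e bad P with cur := some (.mark M) },
        stackMap I O (tapes u u' R X κ κ')) (5 * κ'.length + 11)
      (reg true bad (if (e && κ.isEmpty) = true then P.inter M.lower else P),
        stackMap I O (tapes u u' R (.mark (M.union P) :: X) (κ'.reverse ++ κ) [])) := by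
  have hd : ∀ e' : Bool, (drain .keyRev .key id).Takes
      ({ reg e' bad P with tmp := some (.mark M) }, stackMap I O (tapes u u' R X κ κ'))
      (5 * κ'.length + 2)
      ({ reg e' bad P with tmp := some (.mark M) },
        stackMap I O (tapes u u' R X (κ'.reverse ++ κ) [])) := by
    intro e'
    have := drain_takes (i := .keyRev) (j := .key) (by decide) id
      { reg e' bad P with tmp := some (.mark M) } rfl I O (tapes u u' R X κ κ')
    simpa only [update_keyRev, update_key, tapes, List.map_id] using this
  cases κ with
  | nil =>
    have h₁ : (popTmp .key).exec ({ reg e bad P with cur := some (.mark M) },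
        stackMap I O (tapes u u' R X [] κ')) = ({ reg e bad P with cur := some (.mark M) },
          stackMap I O (tapes u u' R X [] κ')) := by
      simp only [exec_popTmp, update_key, tapes, reg, List.head?_nil, List.tail_nil]
    refine Takes.mono (.seq (takes_block _ h₁) (.seq (.ite_false rfl .skip)
      (.seq (takes_block _ rfl) (.seq (hd e) (takes_block _ ?_)))))
      (T := 1 + ((0 + 2) + (1 + ((5 * κ'.length + 2) + 2)))) ?_
    · simp [exec_load, exec_pushWork, update_rightRev, tapes, reg, Cell.levels]
    · omega
  | cons c κ =>
    have h₁ : (popTmp .key).exec ({ reg e bad P with cur := some (.mark M) },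
        stackMap I O (tapes u u' R X (c :: κ) κ')) =
          ({ reg e bad P with cur := some (.mark M), tmp := some c },
            stackMap I O (tapes u u' R X κ κ')) := by
      simp only [exec_popTmp, update_key, tapes, reg, List.head?_cons, List.tail_cons]
    have h₂ : Prog.Takes (.block [pushWork .key fun r => getCell r.tmp,
        .load fun r => { r with eq := false }])
        ({ reg e bad P with cur := some (.mark M), tmp := some c },
          stackMap I O (tapes u u' R X κ κ')) 2
        ({ reg false bad P with cur := some (.mark M), tmp := some c },
          stackMap I O (tapes u u' R X (c :: κ) κ')) :=
      takes_block _ (by simp only [List.foldl_cons, List.foldl_nil, exec_pushWork, exec_load,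
        update_key, tapes, reg, getCell, Option.getD_some])
    refine Takes.mono (.seq (takes_block _ h₁) (.seq (.ite_true rfl h₂)
      (.seq (takes_block _ rfl) (.seq (hd false) (takes_block _ ?_)))))
      (T := 1 + ((2 + 2) + (1 + ((5 * κ'.length + 2) + 2)))) ?_
    · simp [exec_load, exec_pushWork, update_rightRev, tapes, reg, Cell.levels]
    · omega

theorem passLoop_letter (a b : ℕ) (M P : Marks m) (bad : Bool) (I : List IdSymbol)
    (O : List Bool) (u u' R X : List (Cell m)) {T : ℕ} {s' : Reg m × ∀ k, List (StackSym m k)}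
    (h : Prog.Takes passLoop (reg true bad (pending a P b M), stackMap I O
      (tapes u u' R (.mark (M.union P) :: ((b.bits.map .bit).reverse ++ X)) (a.bits.map .bit) [])) T
      s') :
    Prog.Takes passLoop (reg true bad P, stackMap I O
      (tapes u u' (b.bits.map .bit ++ .mark M :: R) X (a.bits.map .bit) []))
      (11 * b.bits.length + (5 * a.bits.length + 16 + T)) s' := by
  refine passLoop_bits _ _ _ _ _ _ _ _ _ _ _ _ ?_
  have hlen : (a.bits.take b.bits.length).length ≤ a.bits.length := by simp
  -- A prefix of the key that leaves nothing of it over is the whole key.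
  have heq : ((true && b.bits.isPrefixOf a.bits) && (((a.bits.drop b.bits.length).map
      Cell.bit : List (Cell m))).isEmpty) = decide (b = a) := by
    rw [Bool.eq_iff_iff, Bool.true_and, Bool.and_eq_true, List.isPrefixOf_iff_prefix,
      List.isEmpty_iff, List.map_eq_nil_iff, List.drop_eq_nil_iff, decide_eq_true_iff,
      ← bits_injective.eq_iff]
    exact ⟨fun h => h.1.eq_of_length_le h.2, fun h => h ▸ ⟨List.prefix_rfl, le_rfl⟩⟩
  have hu := updateMark_takes (true && b.bits.isPrefixOf a.bits) bad M P I O u u' R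
    ((b.bits.map .bit).reverse ++ X) ((a.bits.drop b.bits.length).map .bit)
    (((a.bits.take b.bits.length).map .bit).reverse ++ [])
  simp only [heq, decide_eq_true_eq, List.append_nil, List.reverse_reverse, ← List.map_append,
    List.take_append_drop, List.length_reverse, List.length_map] at hu
  refine Takes.mono (.loop_true rfl (.seq (takes_block _ ?_) (.ite_false rfl hu)) h) ?_
  · simp only [List.foldl_cons, List.foldl_nil, exec_popCur, update_right, tapes, reg,
      List.head?_cons, List.tail_cons, List.append_nil]
  · simp only [List.length_cons, List.length_nil]
    omega

theorem passLoop_takes (a : ℕ) (l : List (ℕ × Marks m)) (P : Marks m) (bad : Bool)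
    (I : List IdSymbol) (O : List Bool) (u u' X : List (Cell m)) :
    Prog.Takes passLoop
      (reg true bad P, stackMap I O (tapes u u' (cells l) X (a.bits.map .bit) []))
      ((16 + 5 * a.bits.length) * (cells l).length + 2)
      (reg true bad (passRest a P l), stackMap I O
        (tapes u u' [] ((cells (passWord a P l)).reverse ++ X) (a.bits.map .bit) [])) := by
  induction l generalizing P X with
  | nil => exact (Takes.loop_false rfl).mono (by omega)
  | cons x l ih =>
    obtain ⟨b, M⟩ := x
    rw [cells_cons]
    refine Takes.mono (passLoop_letter a b M P bad I O u u' (cells l) X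
      (T := (16 + 5 * a.bits.length) * (cells l).length + 2) ?_) ?_
    · have := ih (pending a P b M) (.mark (M.union P) :: ((b.bits.map .bit).reverse ++ X))
      simpa [passWord, cells_cons, passRest] using this
    · simp only [List.length_append, List.length_map, List.length_cons]
      nlinarith [Nat.zero_le (a.bits.length * b.bits.length)]

end StackPass

/-! ### Comparing two words by passes in both directions -/

section StackTests

open Cmd

variable {m : ℕ}

/-- A pass for the letter whose bits are on the stack `keyRev`. -/
def passLetter : Prog m :=
  .seq (.block [.load fun r => { r with cur := none, eq := true, pend := fun _ => true }])
    (.seq (drain .keyRev .key id) (.seq passLoop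
      (.seq (.block [.load fun r =>
        { r with bad := r.bad || r.pend (Fin.last m), pend := fun _ => false }])
        (.seq (drain .rightRev .right id) (clear .key)))))

/-- Passes over the annotated word on the right for all letters of the word on the left. -/
def passLetters : Prog m :=
  .loop (.nonempty (.work .left))
    (.seq (.block [popCur .left, pushWork .leftRev fun r => getCell r.cur])
      (.ite (.mem fun r => Cell.isBit r.cur)
        (.block [pushWork .keyRev fun r => getCell r.cur, .load fun r => { r with cur := none }])
        passLetter))

theorem length_cells_passWord (a : ℕ) (P : Marks m) (l : List (ℕ × Marks m)) :
    (cells (passWord a P l)).length = (cells l).length := by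
  induction l generalizing P with
  | nil => rfl
  | cons x l ih => simp [passWord, cells_cons, ih]

theorem passLetter_takes (a : ℕ) (M : Marks m) (l : List (ℕ × Marks m)) (bad : Bool)
    (I : List IdSymbol) (O : List Bool) (u u' : List (Cell m)) :
    passLetter.Takes ({ reg true bad (fun _ => false) with cur := some (.mark M) },
        stackMap I O (tapes u u' (cells l) [] [] (a.bits.map .bit).reverse))
      (9 * a.bits.length + (21 + 5 * a.bits.length) * (cells l).length + 10)
      (reg true (bad || passRest a (fun _ => true) l (Fin.last m)) fun _ => false,
        stackMap I O (tapes u u' (cells (passWord a (fun _ => true) l)) [] [] [])) := by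
  have h₁ := drain_takes (i := .keyRev) (j := .key) (by decide) id (reg true bad fun _ => true) rfl
    I O (tapes u u' (cells l) [] [] (a.bits.map .bit).reverse)
  simp only [update_keyRev, update_key, tapes, List.map_id, List.reverse_reverse, List.append_nil,
    List.length_reverse, List.length_map] at h₁
  have h₂ := passLoop_takes a l (fun _ => true) bad I O u u' []
  rw [List.append_nil] at h₂
  have h₃ := drain_takes (i := .rightRev) (j := .right) (by decide) id
    (reg true (bad || passRest a (fun _ => true) l (Fin.last m)) fun _ => false) rfl I O
    (tapes u u' [] (cells (passWord a (fun _ => true) l)).reverse (a.bits.map .bit) [])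
  simp only [update_rightRev, update_right, tapes, List.map_id, List.reverse_reverse,
    List.append_nil, List.length_reverse, length_cells_passWord] at h₃
  have h₄ := clear_takes .key
    (reg true (bad || passRest a (fun _ => true) l (Fin.last m)) fun _ => false) rfl I O
    (tapes u u' (cells (passWord a (fun _ => true) l)) [] (a.bits.map .bit) [])
  simp only [update_key, tapes, List.length_map] at h₄
  refine Takes.mono (.seq (takes_block _ rfl) (.seq h₁ (.seq h₂ (.seq (takes_block _ rfl)
    (.seq h₃ h₄))))) ?_
  simp only [List.length_cons, List.length_nil]
  ring_nf
  omega

theorem passLetters_bits (bs : List Bool) (bad : Bool) (I : List IdSymbol) (O : List Bool)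
    (u u' v k : List (Cell m)) {T : ℕ} {s' : Reg m × ∀ k, List (StackSym m k)}
    (h : Prog.Takes passLetters (reg true bad fun _ => false, stackMap I O
      (tapes u ((bs.map .bit).reverse ++ u') v [] [] ((bs.map .bit).reverse ++ k))) T s') :
    Prog.Takes passLetters (reg true bad fun _ => false, stackMap I O
      (tapes (bs.map .bit ++ u) u' v [] [] k)) (8 * bs.length + T) s' := by
  induction bs generalizing u' k with
  | nil => simpa using h
  | cons b bs ih =>
    have := ih (.bit b :: u') (.bit b :: k) (by simpa using h)
    have h₁ : Prog.Takes (.block [popCur .left, pushWork .leftRev fun r => getCell r.cur])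
        (reg true bad fun _ => false, stackMap I O
          (tapes ((b :: bs).map .bit ++ u) u' v [] [] k)) 2
        ({ reg true bad (fun _ => false) with cur := some (.bit b) }, stackMap I O
          (tapes (bs.map .bit ++ u) (.bit b :: u') v [] [] k)) :=
      takes_block _ (by simp only [List.foldl_cons, List.foldl_nil, exec_pushWork, exec_popCur,
        update_left, update_leftRev, tapes, reg, getCell, Option.getD_some, List.map_cons,
        List.cons_append, List.head?_cons, List.tail_cons])
    have h₂ : Prog.Takes (.block [pushWork .keyRev fun r => getCell r.cur,
        .load fun r => { r with cur := none }])
        ({ reg true bad (fun _ => false) with cur := some (.bit b) }, stackMap I O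
          (tapes (bs.map .bit ++ u) (.bit b :: u') v [] [] k)) 2
        (reg true bad fun _ => false, stackMap I O
          (tapes (bs.map .bit ++ u) (.bit b :: u') v [] [] (.bit b :: k))) :=
      takes_block _ (by simp only [List.foldl_cons, List.foldl_nil, exec_pushWork, exec_load,
        update_keyRev, tapes, reg, getCell, Option.getD_some])
    refine Takes.mono (.loop_true rfl (.seq h₁ (.ite_true rfl h₂)) this) ?_
    simp only [List.length_cons]
    omega

/-- Passes preserve the number of cells, so the fixed bounds `K` and `N` give one cost bound for all
passes and survive the induction. -/
theorem passLetters_takes {K N : ℕ} (x : List (ℕ × Marks m)) (hx : (cells x).length ≤ K)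
    (l : List (ℕ × Marks m)) (hl : (cells l).length ≤ N) (bad : Bool) (I : List IdSymbol)
    (O : List Bool) (u' : List (Cell m)) :
    Prog.Takes passLetters (reg true bad fun _ => false,
        stackMap I O (tapes (cells x) u' (cells l) [] [] []))
      ((17 + (21 + 5 * K) * N) * (cells x).length + 2)
      (reg true (passes (x.map Prod.fst) (l, bad)).2 fun _ => false,
        stackMap I O (tapes [] ((cells x).reverse ++ u')
          (cells (passes (x.map Prod.fst) (l, bad)).1) [] [] [])) := by
  induction x generalizing l bad u' with
  | nil => exact (Takes.loop_false rfl).mono (by omega)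
  | cons y x ih =>
    obtain ⟨a, M⟩ := y
    rw [cells_cons] at hx
    simp only [List.length_append, List.length_map, List.length_cons] at hx
    have h₀ := ih (by omega) (passWord a (fun _ => true) l) (by rwa [length_cells_passWord])
      (bad || passRest a (fun _ => true) l (Fin.last m))
      (.mark M :: ((a.bits.map .bit).reverse ++ u'))
    have h₁ : Prog.Takes (.block [popCur .left, pushWork .leftRev fun r => getCell r.cur])
        (reg true bad fun _ => false, stackMap I O
          (tapes (.mark M :: cells x) ((a.bits.map .bit).reverse ++ u') (cells l) [] []
            ((a.bits.map .bit).reverse ++ []))) 2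
        ({ reg true bad (fun _ => false) with cur := some (.mark M) }, stackMap I O
          (tapes (cells x) (.mark M :: ((a.bits.map .bit).reverse ++ u')) (cells l) [] []
            (a.bits.map .bit).reverse)) :=
      takes_block _ (by simp only [List.foldl_cons, List.foldl_nil, exec_pushWork, exec_popCur,
        update_left, update_leftRev, tapes, reg, getCell, Option.getD_some, List.append_nil,
        List.head?_cons, List.tail_cons])
    have h₂ := passLetter_takes a M l bad I O (cells x)
      (.mark M :: ((a.bits.map .bit).reverse ++ u'))
    rw [cells_cons]
    refine Takes.mono (passLetters_bits _ _ _ _ _ _ _ _ (.loop_true rfl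
      (.seq h₁ (.ite_false rfl h₂)) ?_)) (T := 8 * a.bits.length + (2 +
        (9 * a.bits.length + (21 + 5 * a.bits.length) * (cells l).length + 10 + 2) + 2 +
          ((17 + (21 + 5 * K) * N) * (cells x).length + 2))) ?_
    · simpa [passes, passLetters] using h₀
    · simp only [List.length_append, List.length_map, List.length_cons]
      have h₃ : (21 + 5 * a.bits.length) * (cells l).length ≤ (21 + 5 * K) * N :=
        Nat.mul_le_mul (by omega) hl
      have h₄ : (17 + (21 + 5 * K) * N) * (a.bits.length + ((cells x).length + 1)) =
          17 * a.bits.length + (21 + 5 * K) * N * a.bits.length + 17 + (21 + 5 * K) * N +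
            (17 + (21 + 5 * K) * N) * (cells x).length := by ring
      rw [h₄]
      omega

/-- Exchange the two words, with all levels removed from the annotations. -/
def swapWords : Prog m :=
  .seq (drain .right .rightRev Cell.erase)
    (.seq (drain .leftRev .right id) (drain .rightRev .left id))

theorem map_erase_cells (l : List (ℕ × Marks m)) :
    (cells l).map Cell.erase = cells (l.map fun x => (x.1, fun _ => false)) := by
  induction l with
  | nil => rfl
  | cons x l ih =>
    simp [cells_cons, ih, Cell.erase]

theorem swapWords_takes (u v : List (ℕ × Marks m)) (bad : Bool) (I : List IdSymbol)
    (O : List Bool) :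
    swapWords.Takes (reg true bad fun _ => false,
        stackMap I O (tapes [] (cells u).reverse (cells v) [] [] []))
      (5 * (cells u).length + 10 * (cells v).length + 6)
      (reg true bad fun _ => false, stackMap I O
        (tapes (cells (v.map fun x => (x.1, fun _ => false))) [] (cells u) [] [] [])) := by
  have h₁ := drain_takes (i := .right) (j := .rightRev) (by decide) Cell.erase
    (reg true bad fun _ => false) rfl I O (tapes [] (cells u).reverse (cells v) [] [] [])
  simp only [update_rightRev, update_right, tapes, List.append_nil, map_erase_cells] at h₁
  have h₂ := drain_takes (i := .leftRev) (j := .right) (by decide) id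
    (reg true bad fun _ => false) rfl I O (tapes [] (cells u).reverse []
      (cells (v.map fun x => (x.1, fun _ => false))).reverse [] [])
  simp only [update_leftRev, update_right, tapes, List.map_id, List.reverse_reverse,
    List.append_nil, List.length_reverse] at h₂
  have h₃ := drain_takes (i := .rightRev) (j := .left) (by decide) id
    (reg true bad fun _ => false) rfl I O (tapes [] [] (cells u)
      (cells (v.map fun x => (x.1, fun _ => false))).reverse [] [])
  simp only [update_rightRev, update_left, tapes, List.map_id, List.reverse_reverse,
    List.append_nil, List.length_reverse] at h₃
  refine Takes.mono (.seq h₁ (.seq h₂ h₃)) ?_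
  rw [← map_erase_cells, List.length_map]
  omega

/-- The annotation of a word without levels. -/
def plain (m : ℕ) (u : List ℕ) : List (ℕ × Marks m) := u.map fun a => (a, fun _ => false)

/-- The cells of a word without levels. -/
def wordCells (m : ℕ) (u : List ℕ) : List (Cell m) := cells (plain m u)

/-- Raise a flag unless the words on the left and on the right are equivalent. -/
def compareWords : Prog m :=
  .seq passLetters (.seq swapWords passLetters)

-- The second direction starts from erased annotations but keeps the flag of the first, so the flag
-- reports a failure of either inclusion. The leftover stacks matter only through their lengths,
-- which bound the cost of clearing them.
open Classical in
theorem compareWords_takes {N : ℕ} (u v : List ℕ) (hu : (wordCells m u).length ≤ N)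
    (hv : (wordCells m v).length ≤ N) :
    ∃ w, ((∀ t, (w t).length ≤ N) ∧
      compareWords.Takes (reg true false fun _ => false,
        stackMap [] [] (tapes (wordCells m u) [] (wordCells m v) [] [] []))
      (2 * ((17 + (21 + 5 * N) * N) * N) + 15 * N + 10)
      (reg true (!decide (SimonEq (m + 1) u v)) fun _ => false, stackMap [] [] w)) := by
  have hmap : ∀ x : List ℕ, (plain m x).map Prod.fst = x := by
    intro x
    simp [plain, Function.comp_def]
  have hlen : ∀ (x : List ℕ) (l : List (ℕ × Marks m)) (b : Bool),
      (cells (passes x (l, b)).1).length = (cells l).length := by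
    intro x
    induction x with
    | nil => intro l b; rfl
    | cons a x ih =>
      intro l b
      rw [passes, ih, length_cells_passWord]
  have hfst : ∀ (x y : List ℕ) (b : Bool),
      (passes x (plain m y, b)).1.map
        (fun z => ((z.1, fun _ => false) : ℕ × Marks m)) = plain m y := by
    intro x y b
    have key : ∀ (F : ℕ → ℕ) (j : ℕ) (y : List ℕ), (annotate m F j y).map
        (fun z => ((z.1, fun _ => false) : ℕ × Marks m)) = plain m y := by
      intro F j y
      induction y generalizing j with
      | nil => rfl
      | cons c y ih => rw [annotate, List.map_cons, ih, plain, plain, List.map_cons]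
    rw [plain, passes_eq, key]
    rfl
  have h₁ := passLetters_takes (K := N) (N := N) (plain m u)
    hu (plain m v) hv false [] [] []
  have h₂ := swapWords_takes (plain m u)
    (passes u (plain m v, false)).1
    (passes u (plain m v, false)).2 [] []
  rw [hfst, hlen] at h₂
  have h₃ := passLetters_takes (K := N) (N := N) (plain m v)
    hv (plain m u) hu
    (passes u (plain m v, false)).2 [] [] []
  rw [hmap, List.append_nil] at h₁ h₃
  have hbad : (passes v (plain m u,
      (passes u (plain m v, false)).2)).2 =
      !decide (SimonEq (m + 1) u v) := by
    rw [plain, plain, passes_eq, passes_eq, simonEq_iff_front,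
      Bool.false_or, Bool.decide_and, Bool.not_and]
  rw [hbad] at h₃
  refine ⟨_, fun t => ?_, Takes.mono (.seq h₁ (.seq h₂ h₃)) ?_⟩
  · cases t <;> simp only [tapes, List.length_reverse, hlen, List.length_nil] <;> first
      | exact hu
      | exact hv
      | exact Nat.zero_le _
  · have h₄ := Nat.mul_le_mul_left (17 + (21 + 5 * N) * N) hu
    have h₅ := Nat.mul_le_mul_left (17 + (21 + 5 * N) * N) hv
    rw [wordCells] at hu hv h₄ h₅
    omega

end StackTests

/-! ### Reading and validating the input string -/

section StackParse

open Cmd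

variable {m : ℕ}

/-- The state of the reader of identities: the side, the last bit of the current index, a flag for
errors, and the reversed cells of both words. -/
structure Parse (m : ℕ) where
  side : Bool
  last : Option Bool
  bad : Bool
  left : List (Cell m)
  right : List (Cell m)

namespace Parse

/-- Append cells to the current word. -/
def append (p : Parse m) (l : List (Cell m)) : Parse m :=
  if p.side = true then { p with right := l.reverse ++ p.right }
  else { p with left := l.reverse ++ p.left }

/-- Read a symbol. -/
def next (p : Parse m) : IdSymbol → Parse m
  | .bit b => { p with last := some b }.append [.bit b]
  | .sep => { p with last := none, bad := p.bad || p.last == some false }.append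
      [.mark fun _ => false]
  | .approx => { p with side := true, last := none, bad := p.bad || p.side || p.last.isSome }

/-- The result of reading a string. -/
def read (m : ℕ) (s : List IdSymbol) : Parse m := s.foldl next ⟨false, none, false, [], []⟩

/-- The string that has been read represents an identity. -/
def valid (p : Parse m) : Bool := !(p.bad || !p.side || p.last.isSome)

theorem foldl_bits (p : Parse m) (bs : List Bool) :
    (bs.map .bit).foldl next p =
      { p with last := bs.getLast?.or p.last }.append (bs.map .bit) := by
  induction bs generalizing p with
  | nil => obtain ⟨_ | _, _, _, _, _⟩ := p <;> simp [append]
  | cons b bs ih =>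
    rw [List.map_cons, List.foldl_cons, ih]
    obtain ⟨_ | _, _, _, _, _⟩ := p <;> cases bs <;>
      simp [append, next, List.getLast?_cons]

/-- The most significant digit comes last, so a final `0` would be a redundant leading zero.
Together with `exists_bits_eq`, this shows that remembering the last bit is enough to recognise
expansions of indices. -/
theorem getLast?_bits (k : ℕ) : k.bits.getLast? ≠ some false := by
  induction k using Nat.binaryRec' with
  | zero => simp
  | bit b k h ih =>
    rw [Nat.bits_append_bit _ _ h]
    cases hk : k.bits with
    | nil =>
      have : k = 0 := bits_injective (by simpa using hk)
      simp [h this]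
    | cons c l => rwa [List.getLast?_cons_cons, ← hk]

theorem exists_bits_eq (bs : List Bool) (h : bs.getLast? ≠ some false) : ∃ k : ℕ, k.bits = bs := by
  induction bs with
  | nil => exact ⟨0, Nat.zero_bits⟩
  | cons b bs ih =>
    cases bs with
    | nil =>
      refine ⟨1, ?_⟩
      simp at h
      simp [h]
    | cons c l =>
      rw [List.getLast?_cons_cons] at h
      obtain ⟨k, hk⟩ := ih h
      refine ⟨Nat.bit b k, ?_⟩
      rw [Nat.bits_append_bit _ _ (fun h0 => by simp [h0] at hk), hk]

theorem foldl_encodeWord (p : Parse m) (hp : p.last = none) (w : List ℕ) :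
    (encodeWord (.ofList w)).foldl next p = p.append (wordCells m w) := by
  induction w generalizing p with
  | nil => obtain ⟨_ | _, _, _, _, _⟩ := p <;> simp [encodeWord, append, wordCells, plain, cells]
  | cons a w ih =>
    have h₁ : encodeWord (.ofList (a :: w)) =
        a.bits.map .bit ++ .sep :: encodeWord (.ofList w) := by
      simp [encodeWord]
    have h₂ : wordCells m (a :: w) =
        a.bits.map .bit ++ .mark (fun _ => false) :: wordCells m w := by
      simp [wordCells, plain, cells_cons]
    have h₃ : (a.bits.getLast? == some false) = false := by
      simpa using getLast?_bits a
    rw [h₁, h₂, List.foldl_append, List.foldl_cons, foldl_bits, ih]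
    · obtain ⟨_ | _, _, _, _, _⟩ := p <;> obtain rfl := hp <;> simp [append, next, h₃]
    · obtain ⟨_ | _, _, _, _, _⟩ := p <;> simp [append, next]

theorem read_encodeIdentity (e : MonoidIdentity) : read m (encodeIdentity e) =
    ⟨true, none, false, (wordCells m e.lhs.toList).reverse, (wordCells m e.rhs.toList).reverse⟩ := by
  have h₁ := foldl_encodeWord (m := m) ⟨false, none, false, [], []⟩ rfl e.lhs.toList
  rw [FreeMonoid.ofList_toList] at h₁
  rw [read, encodeIdentity, List.foldl_append, h₁, List.foldl_cons]
  have h₂ := foldl_encodeWord (m := m)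
    ⟨true, none, false, (wordCells m e.lhs.toList).reverse, []⟩ rfl e.rhs.toList
  rw [FreeMonoid.ofList_toList] at h₂
  simpa [append, next] using h₂

/-- This is the invariant of the reader: a string without errors so far consists of a complete left
side with its mark if that mark has been read, complete letters, and the bits of an unfinished
index. -/
theorem exists_of_read (s : List IdSymbol) (h : (read m s).bad = false) :
    ∃ (h : List IdSymbol) (w : FreeMonoid ℕ) (bs : List Bool), s = h ++ encodeWord w ++ bs.map .bit ∧
      (read m s).last = bs.getLast? ∧
      if (read m s).side = true then ∃ w₀, h = encodeWord w₀ ++ [.approx] else h = [] := by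
  induction s using List.reverseRecOn with
  | nil => exact ⟨[], 1, [], by simp [encodeWord], rfl, rfl⟩
  | append_singleton s x ih =>
    have hr : read m (s ++ [x]) = (read m s).next x := by simp [read]
    rw [hr] at h ⊢
    have hside : ∀ (p : Parse m) l, (p.append l).side = p.side ∧ (p.append l).last = p.last ∧
        (p.append l).bad = p.bad := by
      rintro ⟨_ | _, _, _, _, _⟩ l <;> simp [append]
    cases x with
    | bit b =>
      simp only [next, hside] at h ⊢
      obtain ⟨g, w, bs, hs, hl, hw⟩ := ih h
      exact ⟨g, w, bs ++ [b], by simp [hs], by simp, hw⟩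
    | sep =>
      simp only [next, hside, Bool.or_eq_false_iff, beq_eq_false_iff_ne] at h ⊢
      obtain ⟨g, w, bs, hs, hl, hw⟩ := ih h.1
      obtain ⟨k, rfl⟩ := exists_bits_eq bs (hl ▸ h.2)
      exact ⟨g, w * .of k, [], by simp [hs, encodeWord], rfl, hw⟩
    | approx =>
      simp only [next, Bool.or_eq_false_iff, Option.isSome_eq_false_iff, Option.isNone_iff_eq_none]
        at h ⊢
      obtain ⟨g, w, bs, hs, hl, hw⟩ := ih h.1.1
      rw [h.1.2] at hw
      rw [h.2, eq_comm, List.getLast?_eq_none_iff] at hl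
      simp only [Bool.false_eq_true, if_false] at hw
      subst hl hw
      exact ⟨encodeWord w ++ [.approx], 1, [], by simp [hs, encodeWord], rfl, by simp⟩

theorem valid_read_iff (s : List IdSymbol) :
    (read m s).valid = true ↔ ∃ e, encodeIdentity e = s := by
  constructor
  · intro h
    simp only [valid, Bool.not_eq_true', Bool.or_eq_false_iff, Bool.not_eq_false',
      Option.isSome_eq_false_iff, Option.isNone_iff_eq_none] at h
    obtain ⟨g, w, bs, hs, hl, hw⟩ := exists_of_read s h.1.1
    rw [h.1.2, if_pos rfl] at hw
    obtain ⟨w₀, rfl⟩ := hw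
    rw [h.2, eq_comm, List.getLast?_eq_none_iff] at hl
    subst hl
    exact ⟨⟨w₀, w⟩, by simp [hs, encodeIdentity]⟩
  · rintro ⟨e, rfl⟩
    simp [read_encodeIdentity, valid]

theorem length_read (s : List IdSymbol) :
    (read m s).left.length + (read m s).right.length ≤ s.length := by
  induction s using List.reverseRecOn with
  | nil => simp [read]
  | append_singleton s x ih =>
    have hr : read m (s ++ [x]) = (read m s).next x := by simp [read]
    rw [hr, List.length_append]
    generalize read m s = p at ih ⊢
    obtain ⟨_ | _, _, _, _, _⟩ := p <;> cases x <;> simp [next, append] at ih ⊢ <;> omega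

end Parse

/-- The cell for a symbol. -/
def symCell : Option IdSymbol → Cell m
  | some (.bit b) => .bit b
  | _ => .mark fun _ => false

/-- Test for the separator between the two sides. -/
def isApprox : Option IdSymbol → Bool
  | some .approx => true
  | _ => false

/-- The state after reading a symbol. -/
def nextReg (r : Reg m) : Reg m :=
  match r.sym with
  | some (.bit b) => { r with sym := none, last := some b }
  | some .sep => { r with sym := none, last := none, bad := r.bad || r.last == some false }
  | some .approx =>
      { r with sym := none, side := true, last := none, bad := r.bad || r.side || r.last.isSome }
  | none => r

/-- Read the input. -/
def readInput : Prog m :=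
  .loop (.nonempty .input) (.seq (.block [.pop .input fun r x => { r with sym := x }])
    (.seq (.ite (.mem fun r => isApprox r.sym) .skip
      (.ite (.mem fun r => r.side) (.block [pushWork .rightRev fun r => symCell r.sym])
        (.block [pushWork .leftRev fun r => symCell r.sym])))
      (.block [.load nextReg])))

/-- The memory while the input is read. -/
def Parse.reg (p : Parse m) : Reg m :=
  ⟨none, none, true, p.bad, p.side, p.last, fun _ => false, none⟩

theorem readInput_takes (s : List IdSymbol) (p : Parse m) :
    readInput.Takes (p.reg, stackMap s [] (tapes [] p.left [] p.right [] [])) (9 * s.length + 2)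
      ((s.foldl Parse.next p).reg, stackMap [] [] (tapes [] (s.foldl Parse.next p).left []
        (s.foldl Parse.next p).right [] [])) := by
  induction s generalizing p with
  | nil => exact .loop_false rfl
  | cons x s ih =>
    have h₁ : Prog.Takes (.block [.pop .input fun r x => { r with sym := x }])
        (p.reg, stackMap (x :: s) [] (tapes [] p.left [] p.right [] [])) 1
        ({ p.reg with sym := some x }, stackMap s [] (tapes [] p.left [] p.right [] [])) :=
      takes_block _ (congrArg (Prod.mk _) (update_stackMap_input ..))
    have h₂ : Prog.Takes (.seq (.ite (.mem fun r => isApprox r.sym) .skip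
        (.ite (.mem fun r => r.side) (.block [pushWork .rightRev fun r => symCell r.sym])
          (.block [pushWork .leftRev fun r => symCell r.sym]))) (.block [.load nextReg]))
        ({ p.reg with sym := some x }, stackMap s [] (tapes [] p.left [] p.right [] [])) 6
        ((p.next x).reg, stackMap s [] (tapes [] (p.next x).left [] (p.next x).right [] [])) := by
      obtain ⟨side, last, bad, left, right⟩ := p
      have hR : ∀ y : Option IdSymbol, Prog.Takes (.block [pushWork .rightRev fun r => symCell r.sym])
          ({ Parse.reg ⟨true, last, bad, left, right⟩ with sym := y },
            stackMap s [] (tapes [] left [] right [] [])) 1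
          ({ Parse.reg ⟨true, last, bad, left, right⟩ with sym := y },
            stackMap s [] (tapes [] left [] (symCell y :: right) [] [])) := fun y =>
        takes_block _ (by simp only [List.foldl_cons, List.foldl_nil, exec_pushWork,
          update_rightRev, tapes])
      have hL : ∀ y : Option IdSymbol, Prog.Takes (.block [pushWork .leftRev fun r => symCell r.sym])
          ({ Parse.reg ⟨false, last, bad, left, right⟩ with sym := y },
            stackMap s [] (tapes [] left [] right [] [])) 1
          ({ Parse.reg ⟨false, last, bad, left, right⟩ with sym := y },
            stackMap s [] (tapes [] (symCell y :: left) [] right [] [])) := fun y =>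
        takes_block _ (by simp only [List.foldl_cons, List.foldl_nil, exec_pushWork,
          update_leftRev, tapes])
      cases x with
      | approx => exact (Takes.seq (.ite_true rfl (.skip (T := 0))) (takes_block _ rfl)).mono (by simp)
      | sep =>
        cases side with
        | true => exact Takes.seq (.ite_false rfl (.ite_true rfl (hR _))) (takes_block _ rfl)
        | false => exact Takes.seq (.ite_false rfl (.ite_false rfl (hL _))) (takes_block _ rfl)
      | bit b =>
        cases side with
        | true => exact Takes.seq (.ite_false rfl (.ite_true rfl (hR _))) (takes_block _ rfl)
        | false => exact Takes.seq (.ite_false rfl (.ite_false rfl (hL _))) (takes_block _ rfl)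
    refine Takes.mono (.loop_true rfl (.seq h₁ h₂) (ih (p.next x))) ?_
    simp only [List.length_cons]
    omega

end StackParse

/-! ### The polynomial-time decision procedure -/

section StackDecide

open Cmd

variable {m : ℕ}

/-- Empty the listed work stacks. -/
def clearAll : List Tape → Prog m
  | [] => .skip
  | t :: l => .seq (clear t) (clearAll l)

theorem clearAll_takes {N : ℕ} (l : List Tape) (r : Reg m) (hr : r.cur = none)
    (I : List IdSymbol) (O : List Bool) (w : Tape → List (Cell m)) (hw : ∀ t, (w t).length ≤ N) :
    (clearAll l).Takes (r, stackMap I O w) ((4 * N + 2) * l.length)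
      (r, stackMap I O fun t => if t ∈ l then [] else w t) := by
  induction l generalizing w with
  | nil => exact .skip
  | cons t l ih =>
    have h₁ := (clear_takes t r hr I O w).mono (T' := 4 * N + 2) (by have := hw t; omega)
    have h₂ := ih (Function.update w t []) fun t' => by
      rw [Function.update_apply]
      split_ifs
      · simp
      · exact hw t'
    have he : (fun t' => if t' ∈ t :: l then [] else w t') =
        fun t' => if t' ∈ l then [] else Function.update w t [] t' := by
      funext t'
      by_cases h : t' = t
      · simp [h]
      · simp [h]
    rw [he]
    refine Takes.mono (.seq h₁ h₂) ?_
    rw [List.length_cons]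
    exact le_of_eq (by ring)

/-- Decide whether the input represents an identity with equivalent sides. -/
def decideIdentity : Prog m :=
  .seq readInput (.seq (.block [.load fun r =>
      { r with bad := r.bad || !r.side || r.last.isSome, side := false, last := none }])
    (.seq (drain .leftRev .left id) (.seq (drain .rightRev .right id)
      (.seq (.ite (.mem fun r => !r.bad) compareWords .skip)
        (.seq (clearAll [.left, .leftRev, .right, .rightRev, .key, .keyRev])
          (.block [.push .output fun r => !r.bad,
            .load fun _ => reg true false fun _ => false]))))))

-- The condition on `b` says only that it is the correct answer, which also covers strings that
-- represent no identity: for these the error flag stays raised and the comparison is skipped. The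
-- cubic term comes from the passes, whose number, length and cost per cell are each linear in the
-- input.
open Classical in
theorem decideIdentity_takes (s : List IdSymbol) (b : Bool)
    (hb : if b = true then ∃ e, encodeIdentity e = s ∧ SimonEq (m + 1) e.lhs.toList e.rhs.toList
      else ∀ e, encodeIdentity e = s → ¬ SimonEq (m + 1) e.lhs.toList e.rhs.toList) :
    decideIdentity.Takes (reg true false fun _ => false, stackMap s [] fun _ => [])
      (10 * s.length ^ 3 + 42 * s.length ^ 2 + 92 * s.length + 33)
      (reg (m := m) true false fun _ => false, stackMap [] [b] fun _ => []) := by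
  set N := s.length with hN
  set p := Parse.read m s with hp
  have hlen : p.left.length + p.right.length ≤ N := Parse.length_read s
  have h₁ := readInput_takes (m := m) s ⟨false, none, false, [], []⟩
  have h0 : tapes [] [] [] [] [] [] = fun _ => ([] : List (Cell m)) := by
    funext t
    cases t <;> rfl
  change readInput.Takes _ _ (p.reg, stackMap [] [] (tapes [] p.left [] p.right [] [])) at h₁
  rw [h0] at h₁
  have h₂ := drain_takes (i := .leftRev) (j := .left) (by decide) id
    (reg true (!p.valid) fun _ => false) rfl [] [] (tapes [] p.left [] p.right [] [])
  simp only [update_leftRev, update_left, tapes, List.map_id, List.append_nil] at h₂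
  have h₃ := drain_takes (i := .rightRev) (j := .right) (by decide) id
    (reg true (!p.valid) fun _ => false) rfl [] [] (tapes p.left.reverse [] [] p.right [] [])
  simp only [update_rightRev, update_right, tapes, List.map_id, List.append_nil] at h₃
  have h₄ : ∃ w, (∀ t, (w t).length ≤ N) ∧ Prog.Takes
      (.ite (.mem fun r => !r.bad) compareWords .skip)
      (reg true (!p.valid) fun _ => false, stackMap [] []
        (tapes p.left.reverse [] p.right.reverse [] [] []))
      (2 * ((17 + (21 + 5 * N) * N) * N) + 15 * N + 10 + 2)
      (reg true (!b) fun _ => false, stackMap [] [] w) := by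
    have hcmp : ∀ e, encodeIdentity e = s → (b = decide (SimonEq (m + 1) e.lhs.toList e.rhs.toList)) →
        p.valid = true ∧ ∃ w, (∀ t, (w t).length ≤ N) ∧ compareWords.Takes
          (reg true false fun _ => false, stackMap [] []
            (tapes p.left.reverse [] p.right.reverse [] [] []))
          (2 * ((17 + (21 + 5 * N) * N) * N) + 15 * N + 10)
          (reg true (!b) fun _ => false, stackMap [] [] w) := by
      intro e he hbe
      have hre : p = ⟨true, none, false, (wordCells m e.lhs.toList).reverse,
          (wordCells m e.rhs.toList).reverse⟩ := by
        rw [hp, ← he, Parse.read_encodeIdentity]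
      rw [hre] at hlen
      simp only [List.length_reverse] at hlen
      refine ⟨by rw [hre]; rfl, ?_⟩
      rw [hre, hbe]
      simp only [List.reverse_reverse]
      exact compareWords_takes _ _ (by omega) (by omega)
    have hok : p.valid = true → (∃ w, (∀ t, (w t).length ≤ N) ∧ compareWords.Takes
          (reg true false fun _ => false, stackMap [] []
            (tapes p.left.reverse [] p.right.reverse [] [] []))
          (2 * ((17 + (21 + 5 * N) * N) * N) + 15 * N + 10)
          (reg true (!b) fun _ => false, stackMap [] [] w)) → ∃ w, (∀ t, (w t).length ≤ N) ∧
        Prog.Takes (.ite (.mem fun r => !r.bad) compareWords .skip)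
          (reg true (!p.valid) fun _ => false, stackMap [] []
            (tapes p.left.reverse [] p.right.reverse [] [] []))
          (2 * ((17 + (21 + 5 * N) * N) * N) + 15 * N + 10 + 2)
          (reg true (!b) fun _ => false, stackMap [] [] w) := by
      rintro hv ⟨w, hw, h⟩
      refine ⟨w, hw, ?_⟩
      rw [hv]
      exact .ite_true rfl h
    cases b with
    | true =>
      obtain ⟨e, he, hS⟩ := hb
      obtain ⟨hv, h⟩ := hcmp e he (by simp [hS])
      exact hok hv h
    | false =>
      cases hv : p.valid with
      | true =>
        obtain ⟨e, he⟩ := (Parse.valid_read_iff s).1 hv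
        obtain ⟨-, h⟩ := hcmp e he (by simpa using hb e he)
        have := hok hv h
        rwa [hv] at this
      | false =>
        refine ⟨_, fun t => ?_, .ite_false rfl .skip⟩
        cases t <;> simp only [tapes, List.length_reverse, List.length_nil] <;> omega
  obtain ⟨w, hw, h₄⟩ := h₄
  have h₅ := clearAll_takes [.left, .leftRev, .right, .rightRev, .key, .keyRev]
    (reg true (!b) fun _ => false) rfl [] [] w hw
  have hnil : (fun t => if t ∈ [Tape.left, .leftRev, .right, .rightRev, .key, .keyRev] then []
      else w t) = fun _ => [] := by
    funext t
    cases t <;> simp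
  rw [hnil] at h₅
  have h₆ : Prog.Takes (.block [.push .output fun r => !r.bad,
      .load fun _ => reg true false fun _ => false])
      (reg (m := m) true (!b) fun _ => false, stackMap [] [] fun _ => []) 2
      (reg true false fun _ => false, stackMap [] [b] fun _ => []) := by
    refine takes_block _ (congrArg (Prod.mk _) ?_)
    refine (update_stackMap_output ..).trans ?_
    simp [reg, stackMap]
  have h₇ : Prog.Takes (.block [.load fun r =>
      { r with bad := r.bad || !r.side || r.last.isSome, side := false, last := none }])
      (p.reg, stackMap [] [] (tapes [] p.left [] p.right [] [])) 1
      (reg true (!p.valid) fun _ => false,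
        stackMap [] [] (tapes [] p.left [] p.right [] [])) :=
    takes_block _ (by simp only [List.foldl_cons, List.foldl_nil, exec_load, Parse.reg, reg,
      Parse.valid, Bool.not_not])
  refine Takes.mono (.seq h₁ (.seq h₇ (.seq h₂ (.seq h₃ (.seq h₄ (.seq h₅ h₆)))))) ?_
  simp only [List.length_cons, List.length_nil]
  ring_nf
  omega

theorem encodeIdentity_image_checkId_mem_classP {n : ℕ} (hn : 1 ≤ n) :
    (encodeIdentity '' CheckId (StylicMonoid n) : Language IdSymbol) ∈ ClassP IdSymbol := by
  classical
  -- The levels `0, …, m` stand for the subword lengths `1, …, n`, so there must be at least one.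
  obtain ⟨m, rfl⟩ : ∃ m, n = m + 1 := ⟨n - 1, by omega⟩
  have : Fintype Stack := Fintype.ofFinite _
  have : Fintype (Reg m) := Fintype.ofFinite _
  have hnil : (fun _ => [] : ∀ k, List (StackSym m k)) = stackMap [] [] fun _ => [] := by
    funext k
    cases k <;> rfl
  refine mem_classP_of_ensures (Γ := StackSym m) Stack.input Stack.output (Equiv.refl IdSymbol)
    (Equiv.refl Bool) (reg true false fun _ => false) decideIdentity
    (10 * Polynomial.X ^ 3 + 42 * Polynomial.X ^ 2 + 92 * Polynomial.X + 33) fun s => ?_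
  have hs : singleStack (Γ := StackSym m) Stack.input (s.map (Equiv.refl IdSymbol).symm) =
      stackMap s [] fun _ => [] := by
    rw [singleStack, hnil, update_stackMap_input]
    simp
  have ho : ∀ b : Bool, singleStack (Γ := StackSym m) Stack.output [(Equiv.refl Bool).symm b] =
      stackMap [] [b] fun _ => [] := by
    intro b
    rw [singleStack, hnil, update_stackMap_output]
    simp
  obtain ⟨t, ht, hr⟩ := decideIdentity_takes (m := m) s
    (decide (s ∈ encodeIdentity '' CheckId (StylicMonoid (m + 1)))) (by
      split_ifs with h
      · obtain ⟨e, he, hes⟩ := of_decide_eq_true h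
        exact ⟨e, hes, (mem_checkId_stylicMonoid_iff _ _).1 he⟩
      · intro e he hS
        exact h (decide_eq_true ⟨e, (mem_checkId_stylicMonoid_iff _ _).2 hS, he⟩))
  refine ⟨t, ?_, _, ?_, rfl⟩
  · simpa using ht
  · rw [hs, ho]
    convert hr using 5
    exact Iff.rfl

end StackDecide

theorem mainTheorem5 (n : ℕ) (hn : 1 ≤ n) :
    RAM.DecidableInTime (CheckId (StylicMonoid n)) (fun l : ℕ => (l : ℝ) * Real.log l) ∧
      (encodeIdentity '' CheckId (StylicMonoid n) : Language IdSymbol) ∈ ClassP IdSymbol := by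
  exact ⟨checkId_stylicMonoid_decidableInTime n, encodeIdentity_image_checkId_mem_classP hn⟩
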